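/- Let $X(\cdot)$ be a real centred stationary Gaussian process with power spectral density $S_X$ and variance $\sigma_X^2=\int_{\mathbb R} S_X(f)\,df<\infty$, and let $\eta(\cdot)$ be a real stationary Gaussian noise, independent of $X(\cdot)$, with power spectral density $S_\eta$ (not necessarily integrable). Put $S_{X+\eta}=S_X+S_\eta$ and $S(f)=S_X^2(f)/S_{X+\eta}(f)$, with $S(f)=0$ where $S_{X+\eta}(f)=0$. Let $f_s>0$, $P\ge 1$ an integer, and $w=f_s/P$. For measurable filters $H_1,\dots,H_P:\mathbb R\to\mathbb C$ with $\int S_{X+\eta}|H_p|^2<\infty$, let $Z_p$ be the output of the linear time-invariant system with frequency response $H_p$ and input $X+\eta$, and let $Y_p[n]=Z_p(n/w)$, $n\in\mathbb Z$, be its samples at frequency $f_s/P$. The MMSE is $$\mathsf{mmse}_{X|\mathbf Y}(f_s)=\lim_{T\to\infty}\frac1{2T}\int_{-T}^{T}\mathbb E\,|X(t)-\tilde X(t)|^2\,dt ,$$ where $\tilde X(t)$ is the optimal linear estimator of $X(t)$ from the samples, i.e. the orthogonal projection of $X(t)$ onto the closed complex linear span of all $Y_p[n]$ in $L^2$. Let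 $\widetilde{\mathbf S}_{X|\mathbf Y}(f)=\tilde{\mathbf S}_{\mathbf Y}^{-\frac12 *}(f)\,\mathbf K(f)\,\tilde{\mathbf S}_{\mathbf Y}^{-\frac12}(f)$ with the $P\times P$ matrices $$(\tilde{\mathbf S}_{\mathbf Y}(f))_{ij}=\sum_{k\in\mathbb Z}\{S_{X+\eta}H_i^*H_j\}(f-kw),\qquad (\mathbf K(f))_{ij}=\sum_{k\in\mathbb Z}\{S_X^2H_i^*H_j\}(f-kw),$$ the inverse square root being that of the Moore–Penrose inverse where $\tilde{\mathbf S}_{\mathbf Y}(f)$ is singular. A measurable set $F\subset\mathbb R$ is aliasing-free with respect to $w$ if, after removal of a Lebesgue null set, no two distinct points of $F$ differ by an integer multiple of $w$. Call $F_1^\star,\dots,F_P^\star$ successive maximal aliasing-free sets with respect to $w$ and $S$ if each $F_p^\star$ is aliasing-free with respect to $w$, the sets are pairwise disjoint up to null sets, and for every $p$ $$\int_{F_p^\star}S(f)\,df=\int_{-w/2}^{w/2}J_p^\star(f)\,df,\qquad J_p^\star(f)=\sup_{k\in\mathbb Z}\bigl\{S\cdot\mathbf 1_{\mathbb R\setminus(F_1^\star\cup\dots\cup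 F_{p-1}^\star)}\bigr\}(f-kw).$$ Theorem. (a) Successive maximal aliasing-free sets with respect to $w=f_s/P$ and $S$ exist, and can be chosen symmetric about $0$. (b) For all filters $H_1,\dots,H_P$ as above the MMSE exists and equals $\sigma_X^2-\int_{-w/2}^{w/2}\mathrm{Tr}\,\widetilde{\mathbf S}_{X|\mathbf Y}(f)\,df$. If moreover the filters have real impulse responses, i.e. $H_p(-f)=H_p^*(f)$ for almost every $f$, the same holds with $\tilde X(t)=\mathbb E[X(t)\mid\mathbf Y[\cdot]]$. (c) Let $F_1^\star,\dots,F_P^\star$ be any successive maximal aliasing-free sets with respect to $w$ and $S$. Then the filters $H_p^\star=\mathbf 1_{F_p^\star}$ are optimal: for all filters $H_1,\dots,H_P$ as above and almost every $f$, $\mathrm{Tr}\,\widetilde{\mathbf S}_{X|\mathbf Y}(f)\le\mathrm{Tr}\,\widetilde{\mathbf S}^\star_{X|\mathbf Y}(f)$, where $\widetilde{\mathbf S}^\star_{X|\mathbf Y}$ is the matrix of the filters $H_p^\star$; more strongly, for every $i=1,\dots,P$ the $i$-th largest eigenvalue of $\widetilde{\mathbf S}_{X|\mathbf Y}(f)$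 is at most the $i$-th largest eigenvalue of $\widetilde{\mathbf S}^\star_{X|\mathbf Y}(f)$. Consequently $\sigma_X^2-\int_{-w/2}^{w/2}\mathrm{Tr}\,\widetilde{\mathbf S}_{X|\mathbf Y}(f)\,df$ is minimized by $H_1^\star,\dots,H_P^\star$, and its minimal value is $$\mathsf{mmse}^\star_{X|\mathbf Y}(f_s)=\sigma_X^2-\sum_{p=1}^P\int_{F_p^\star}\frac{S_X^2(f)}{S_{X+\eta}(f)}\,df=\sigma_X^2-\sum_{p=1}^P\int_{-w/2}^{w/2}J_p^\star(f)\,df .$$ -/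

import Mathlib

open MeasureTheory ProbabilityTheory Filter Topology ComplexConjugate

namespace FilterBank

noncomputable section

/-! ### Spectral objects

`SX`, `Sη` are the power spectral densities of the source and of the noise, `w = f_s / P` is the
sampling frequency of a single branch, `H p` is the frequency response of the `p`-th filter. -/

/-- The function `S_X² / S_{X+η}`, where `S_{X+η} = S_X + S_η`; it is `0` where `S_{X+η} = 0`. -/
def snr (SX Sη : ℝ → ℝ) (f : ℝ) : ℝ := SX f ^ 2 / (SX f + Sη f)

/-- The filters are measurable and the outputs of the filters have finite variance:
`∫ S_{X+η} |H_p|² < ∞`. -/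
def Admissible (SX Sη : ℝ → ℝ) {P : ℕ} (H : Fin P → ℝ → ℂ) : Prop :=
  ∀ p, Measurable (H p) ∧ Integrable (fun f => (SX f + Sη f) * ‖H p f‖ ^ 2)

/-- The matrix with entries `∑_k {S H_i^* H_j}(f - w k)`. -/
def foldedMatrix (S : ℝ → ℝ) (w : ℝ) {P : ℕ} (H : Fin P → ℝ → ℂ) (f : ℝ) :
    Matrix (Fin P) (Fin P) ℂ :=
  Matrix.of fun i j =>
    ∑' k : ℤ, (S (f - w * k) : ℂ) * conj (H i (f - w * k)) * H j (f - w * k)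

/-- `S̃_Y(f)`. -/
def matSY (SX Sη : ℝ → ℝ) (w : ℝ) {P : ℕ} (H : Fin P → ℝ → ℂ) (f : ℝ) :
    Matrix (Fin P) (Fin P) ℂ :=
  foldedMatrix (fun f => SX f + Sη f) w H f

/-- `K(f)`. -/
def matK (SX : ℝ → ℝ) (w : ℝ) {P : ℕ} (H : Fin P → ℝ → ℂ) (f : ℝ) :
    Matrix (Fin P) (Fin P) ℂ :=
  foldedMatrix (fun f => SX f ^ 2) w H f

/-- `A^{-1/2}` for a positive semidefinite matrix `A`, through the functional calculus.
As `(√0)⁻¹ = 0`, it vanishes on the kernel of `A`, so that for singular `A` it is the square root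
of the Moore–Penrose inverse. -/
def invSqrt {P : ℕ} (A : Matrix (Fin P) (Fin P) ℂ) : Matrix (Fin P) (Fin P) ℂ :=
  cfc (fun x : ℝ => (√x)⁻¹) A

/-- `S̃_{X|Y}(f) = S̃_Y^{-1/2 *}(f) K(f) S̃_Y^{-1/2}(f)`. -/
def matSXY (SX Sη : ℝ → ℝ) (w : ℝ) {P : ℕ} (H : Fin P → ℝ → ℂ) (f : ℝ) :
    Matrix (Fin P) (Fin P) ℂ :=
  (invSqrt (matSY SX Sη w H f)).conjTranspose * matK SX w H f * invSqrt (matSY SX Sη w H f)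

theorem foldedMatrix_isHermitian (S : ℝ → ℝ) (w : ℝ) {P : ℕ} (H : Fin P → ℝ → ℂ) (f : ℝ) :
    (foldedMatrix S w H f).IsHermitian := by
  ext i j
  simp only [foldedMatrix, Matrix.conjTranspose_apply, Matrix.of_apply, tsum_star]
  refine tsum_congr fun k => ?_
  simp
  ring

theorem matSXY_isHermitian (SX Sη : ℝ → ℝ) (w : ℝ) {P : ℕ} (H : Fin P → ℝ → ℂ) (f : ℝ) :
    (matSXY SX Sη w H f).IsHermitian :=
  Matrix.isHermitian_conjTranspose_mul_mul _ (foldedMatrix_isHermitian _ w H f)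

/-- `Tr S̃_{X|Y}(f)`, a real number since the matrix is Hermitian. -/
def traceSXY (SX Sη : ℝ → ℝ) (w : ℝ) {P : ℕ} (H : Fin P → ℝ → ℂ) (f : ℝ) : ℝ :=
  (matSXY SX Sη w H f).trace.re

/-- The eigenvalues of `S̃_{X|Y}(f)` with multiplicity, in decreasing order. -/
def eigSXY (SX Sη : ℝ → ℝ) (w : ℝ) {P : ℕ} (H : Fin P → ℝ → ℂ) (f : ℝ) :
    Fin (Fintype.card (Fin P)) → ℝ :=
  (matSXY_isHermitian SX Sη w H f).eigenvalues₀

/-! ### Aliasing-free sets -/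

/-- `F` is measurable and, outside a Lebesgue null set, no two distinct frequencies of `F` differ
by an integer multiple of `w`. -/
def AliasingFree (w : ℝ) (F : Set ℝ) : Prop :=
  MeasurableSet F ∧ ∃ N : Set ℝ, volume N = 0 ∧
    ∀ f₁ ∈ F \ N, ∀ f₂ ∈ F \ N, f₁ ≠ f₂ → ∀ k : ℤ, f₁ - f₂ ≠ w * k

/-- `J_p(f) = sup_k {S · 1_{ℝ ∖ (F_1 ∪ ⋯ ∪ F_{p-1})}}(f - k w)`. -/
def Jstar (S : ℝ → ℝ) (w : ℝ) {P : ℕ} (F : Fin P → Set ℝ) (p : Fin P) (f : ℝ) : ℝ :=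
  ⨆ k : ℤ, (⋃ q : Fin P, ⋃ _ : q < p, F q)ᶜ.indicator S (f - k * w)

/-- `F_1, …, F_P` are successive maximal aliasing-free sets with respect to `w` and `S`: each one
is aliasing-free, they do not overlap, and `F_p` collects from almost every class of frequencies
modulo `w` the largest value of `S` left over by `F_1, …, F_{p-1}`. -/
structure SuccessiveMaximal (S : ℝ → ℝ) (w : ℝ) {P : ℕ} (F : Fin P → Set ℝ) : Prop where
  aliasingFree : ∀ p, AliasingFree w (F p)
  disjoint : ∀ p q, p ≠ q → volume (F p ∩ F q) = 0
  maximal : ∀ p, ∫ f in F p, S f = ∫ f in (-(w / 2))..(w / 2), Jstar S w F p f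

/-- The filters `H_p = 1_{F_p}`. -/
def indicatorBank {P : ℕ} (F : Fin P → Set ℝ) (p : Fin P) : ℝ → ℂ :=
  (F p).indicator fun _ => 1

/-- Every filter has a real impulse response. -/
def RealResponse {P : ℕ} (H : Fin P → ℝ → ℂ) : Prop :=
  ∀ p, ∀ᵐ f : ℝ, H p (-f) = conj (H p f)

/-! ### Processes, sampling and estimation -/

/-- `W i`, `i : ι`, are (jointly) the outputs of the linear time invariant systems with frequency
responses `G i` when all of them are driven by one real centred stationary Gaussian process with
power spectral density `S`: they are jointly Gaussian and centred, and have the joint second order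
statistics given by the spectral representation. (The input need not have finite variance, so that
for instance white noise is covered.) -/
structure IsFilteredGaussian {Ω : Type*} [MeasurableSpace Ω] (μ : Measure Ω) {ι : Type*}
    (S : ℝ → ℝ) (G : ι → ℝ → ℂ) (W : ι → ℝ → Ω → ℂ) : Prop where
  measurable : ∀ i t, Measurable (W i t)
  gaussian : IsGaussianProcess (fun it : ι × ℝ => W it.1 it.2) μ
  mean : ∀ i t, ∫ ω, W i t ω ∂μ = 0
  cov : ∀ i j s t, ∫ ω, W i s ω * conj (W j t ω) ∂μ =
    ∫ f : ℝ, (S f : ℂ) * G i f * conj (G j f) * Complex.exp (2 * Real.pi * Complex.I * f * (s - t))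
  pseudoCov : ∀ i j s t, ∫ ω, W i s ω * W j t ω ∂μ =
    ∫ f : ℝ, (S f : ℂ) * G i f * G j (-f) * Complex.exp (2 * Real.pi * Complex.I * f * (s - t))

/-- `X` is the source, `U p` its image and `V p` the image of the noise under the filter `H p`;
the noise is independent of the source. The source itself is the output of the filter `1`. -/
structure IsModel {Ω : Type*} [MeasurableSpace Ω] (μ : Measure Ω) (SX Sη : ℝ → ℝ) {P : ℕ}
    (H : Fin P → ℝ → ℂ) (X : ℝ → Ω → ℝ) (U V : Fin P → ℝ → Ω → ℂ) : Prop where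
  source : IsFilteredGaussian μ SX (fun o : Option (Fin P) => o.elim (fun _ => 1) H)
    (fun o => o.elim (fun t ω => (X t ω : ℂ)) U)
  noise : IsFilteredGaussian μ Sη H V
  indep : IndepFun (fun ω => (fun t => X t ω, fun (p : Fin P) t => U p t ω))
    (fun ω (p : Fin P) t => V p t ω) μ

/-- The samples `Y_p[n] = Z_p(n / w)`, `Z_p = U_p + V_p`, of all the branches. -/
def samples {Ω : Type*} {P : ℕ} (w : ℝ) (U V : Fin P → ℝ → Ω → ℂ) (pn : Fin P × ℤ) (ω : Ω) : ℂ :=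
  U pn.1 (pn.2 / w) ω + V pn.1 (pn.2 / w) ω

/-- The least mean square error in estimating `x` linearly from the family `Y`, i.e. the squared
`L²`-distance of `x` to the closed complex linear span of `Y`. -/
def linearError {Ω : Type*} [MeasurableSpace Ω] (μ : Measure Ω) {ι : Type*}
    (x : Ω → ℝ) (Y : ι → Ω → ℂ) : ℝ :=
  ⨅ c : ι →₀ ℂ, ∫ ω, ‖(x ω : ℂ) - c.sum fun i a => a * Y i ω‖ ^ 2 ∂μ

/-- The mean square error of the estimator `E[x | Y]`. -/
def condExpError {Ω : Type*} [MeasurableSpace Ω] (μ : Measure Ω) {ι : Type*}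
    (x : Ω → ℝ) (Y : ι → Ω → ℂ) : ℝ :=
  ∫ ω, (x ω - (μ[x | ⨆ i, MeasurableSpace.comap (Y i) inferInstance]) ω) ^ 2 ∂μ

/-- `m = lim_{T → ∞} (1 / 2T) ∫_{-T}^{T} e(t) dt`. -/
def HasTimeAverage (e : ℝ → ℝ) (m : ℝ) : Prop :=
  Tendsto (fun T : ℝ => (1 / (2 * T)) * ∫ t in (-T)..T, e t) atTop (𝓝 m)

end

end FilterBank

namespace FilterBank

noncomputable section

/-! ### Folding an integral over the real line -/

/-! Sampling at rate `w` cannot separate the frequencies `f - w k`, so the argument takes place on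
one class modulo `w` at a time. A finite linear combination of samples acts on source plus noise as
a filter `∑ p, H p * c p` whose multipliers `c p` are `w`-periodic trigonometric polynomials. The
covariance formulas and the independence of the noise turn its mean square error into a spectral
integral (`IsModel.integral_norm_sq`), and folding that integral over one period leaves, on each
class, the power of the source plus the quadratic functional `c^* A c - 2 Re c^* b`, with `A =
S̃_Y(f)` and `b` the folded cross spectrum at time `t` (`spectralError_eq`). As `b` is orthogonal to
the kernel of `A`, the minimum is `-b^* A⁺ b`, which is minus `energy A b`. Trigonometric
polynomials are dense in the relevant weighted `L²` spaces, so the infimum over samples is the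
integral of the pointwise minima (`iInf_spectralError_eq`).

In `t` this error has period `1 / w`, so its time average is the mean over one period. The
components of `A^{-1/2} b` are, up to a phase, Fourier series in `t`; Parseval's identity converts
the mean of the energy into `Tr S̃_{X|Y}(f)` (`FoldSummable.integral_energy`).

Optimality is a Courant–Fischer argument on each class (`eigSXY_le_Jstar`). Since `S_X² = S ·
S_{X+η}`, the form of `K` is at most `J` times that of `S̃_Y` on vectors whose combined filter
vanishes wherever `S` might exceed `J`. Each earlier maximal set meets a class at most once, so
forcing the combined filter to vanish on the first `i` sets costs `i` linear conditions, and the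
eigenvalue number `i` is at most the largest value of `S` left. For the indicator filters the trace
equals the sum of these bounds, hence every bound is attained. The sets themselves arise by greedily
removing an argmax in each class, with ties broken symmetrically.

For real filters all samples are real and jointly Gaussian with the source, so conditional
expectation on finitely many samples is linear; martingale convergence and Fatou's lemma extend the
comparison to all samples. -/

theorem ae_forall_shift {p : ℝ → Prop} (h : ∀ᵐ f, p f) (w : ℝ) :
    ∀ᵐ f : ℝ, ∀ k : ℤ, p (f - w * k) :=
  ae_all_iff.2 fun k =>
    (measurePreserving_sub_right volume (w * (k : ℝ))).quasiMeasurePreserving.ae h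

/-- Every frequency has a translate in the fundamental cell, and the countably many translates of an
exceptional null set are still null; `hp` carries the property back from the translate. -/
theorem ae_of_ae_Ioc {p : ℝ → Prop} {w : ℝ} (hw : 0 < w)
    (hp : ∀ f, ∀ k : ℤ, p (f - w * k) → p f)
    (h : ∀ᵐ f ∂volume.restrict (Set.Ioc (-(w / 2)) (w / 2)), p f) : ∀ᵐ f : ℝ, p f := by
  rw [ae_restrict_iff' measurableSet_Ioc] at h
  filter_upwards [ae_forall_shift h w] with f hf
  obtain ⟨k, hk, -⟩ := existsUnique_sub_zsmul_mem_Ioc hw f (-(w / 2))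
  refine hp f k (hf k ?_)
  rw [zsmul_eq_mul, mul_comm] at hk
  exact ⟨hk.1, by linarith [hk.2]⟩

theorem hasSum_setIntegral_shift {F : ℝ → ℝ} (hF : Integrable F) {w : ℝ} (hw : 0 < w) (a : ℝ) :
    HasSum (fun k : ℤ => ∫ f in Set.Ioc a (a + w), F (f - w * k)) (∫ f, F f) := by
  have h := hasSum_integral_iUnion (μ := volume) (f := F)
    (s := fun n : ℤ => Set.Ioc (a + n • w) (a + (n + 1) • w)) (fun _ => measurableSet_Ioc)
    (Set.pairwise_disjoint_Ioc_add_zsmul a w)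
    (by rw [iUnion_Ioc_add_zsmul hw a]; exact hF.integrableOn)
  rw [iUnion_Ioc_add_zsmul hw a, Measure.restrict_univ] at h
  -- The shift `f ↦ f - w k` carries the fixed cell to the cell of index `-k`.
  rw [← (Equiv.neg ℤ).hasSum_iff] at h
  refine (congrArg (fun g : ℤ → ℝ => HasSum g (∫ f, F f)) (funext fun k => ?_)).mpr h
  change _ = ∫ x in Set.Ioc (a + (-k) • w) (a + (-k + 1) • w), F x
  have := (measurePreserving_sub_right volume (w * (k : ℝ))).setIntegral_preimage_emb
    (MeasurableEquiv.subRight (w * (k : ℝ))).measurableEmbedding F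
    (Set.Ioc (a + (-k) • w) (a + (-k + 1) • w))
  rw [← this]
  congr 2
  ext x
  simp only [Set.mem_Ioc, Set.mem_preimage, zsmul_eq_mul]
  push_cast
  constructor <;> rintro ⟨h1, h2⟩ <;> constructor <;> linarith

theorem tsum_lintegral_shift_ne_top {F : ℝ → ℝ} (hF : Integrable F) {w : ℝ} (hw : 0 < w) (a : ℝ) :
    ∑' k : ℤ, ∫⁻ f in Set.Ioc a (a + w), ‖F (f - w * k)‖ₑ ≠ ⊤ := by
  have h := (hasSum_setIntegral_shift hF.norm hw a).summable
  have h' : ∀ k : ℤ, ∫⁻ f in Set.Ioc a (a + w), ‖F (f - w * k)‖ₑ =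
      ENNReal.ofReal (∫ f in Set.Ioc a (a + w), ‖F (f - w * k)‖) := fun k =>
    (ofReal_integral_norm_eq_lintegral_enorm (hF.comp_sub_right (w * (k : ℝ))).integrableOn).symm
  simp_rw [h']
  exact h.tsum_ofReal_ne_top

theorem ae_summable_shift {F : ℝ → ℝ} (hF : Integrable F) {w : ℝ} (hw : 0 < w) :
    ∀ᵐ f : ℝ, Summable fun k : ℤ => F (f - w * k) := by
  have h : ∀ a : ℝ, ∀ᵐ f ∂volume.restrict (Set.Ioc a (a + w)),
      Summable fun k : ℤ => ‖F (f - w * k)‖ := fun a => by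
    refine summable_norm_of_tsum_eLpNorm_ne_top (p := 1) le_rfl
      (fun k => (hF.comp_sub_right (w * (k : ℝ))).aestronglyMeasurable.restrict) ?_
    simp_rw [eLpNorm_one_eq_lintegral_enorm]
    exact tsum_lintegral_shift_ne_top hF hw a
  rw [← Measure.restrict_univ (μ := volume), ← iUnion_Ioc_add_zsmul hw 0,
    ae_restrict_iUnion_iff]
  intro n
  have := h (0 + n • w)
  rw [add_assoc, ← add_one_zsmul] at this
  filter_upwards [this] with f hf using hf.of_norm

theorem integral_eq_integral_tsum_shift {F : ℝ → ℝ} (hF : Integrable F) {w : ℝ} (hw : 0 < w) :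
    ∫ f, F f = ∫ f in (-(w / 2))..(w / 2), ∑' k : ℤ, F (f - w * k) := by
  have e : -(w / 2) + w = w / 2 := by ring
  have h := hasSum_setIntegral_shift hF hw (-(w / 2))
  rw [intervalIntegral.integral_of_le (by linarith), ← h.tsum_eq, e]
  rw [integral_tsum]
  · exact fun k => (hF.comp_sub_right (w * (k : ℝ))).aestronglyMeasurable.restrict
  · have := tsum_lintegral_shift_ne_top hF hw (-(w / 2))
    rwa [e] at this

theorem intervalIntegrable_tsum_shift {F : ℝ → ℝ} (hF : Integrable F) {w : ℝ} (hw : 0 < w) :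
    IntervalIntegrable (fun f => ∑' k : ℤ, F (f - w * k)) volume (-(w / 2)) (w / 2) := by
  have e : -(w / 2) + w = w / 2 := by ring
  have hm : ∀ k : ℤ, AEStronglyMeasurable (fun f => F (f - w * k))
      (volume.restrict (Set.Ioc (-(w / 2)) (w / 2))) :=
    fun k => (hF.comp_sub_right (w * (k : ℝ))).aestronglyMeasurable.restrict
  rw [intervalIntegrable_iff_integrableOn_Ioc_of_le (by linarith)]
  refine ⟨(AEMeasurable.tsum fun k => (hm k).aemeasurable).aestronglyMeasurable, ?_⟩
  rw [hasFiniteIntegral_iff_enorm]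
  have h := tsum_lintegral_shift_ne_top hF hw (-(w / 2))
  rw [e, ← lintegral_tsum fun k => (hm k).enorm] at h
  exact lt_of_le_of_lt (lintegral_mono fun f => enorm_tsum_le_tsum_enorm) h.lt_top

theorem tsum_shift_periodic {E : Type*} [AddCommMonoid E] [TopologicalSpace E] (F : ℝ → E)
    (w : ℝ) : Function.Periodic (fun f => ∑' k : ℤ, F (f - w * k)) w := by
  intro f
  beta_reduce
  rw [← (Equiv.subRight (1 : ℤ)).tsum_eq fun k : ℤ => F (f - w * k)]
  refine tsum_congr fun k => ?_
  rw [Equiv.subRight_apply]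
  congr 1
  push_cast
  ring

/-! ### Time averages of periodic functions -/

/-- The integral over `[0, s]` differs from `⌊s / T⌋` times the integral over one period by a
bounded amount, and `⌊s / T⌋ / s → 1 / T`. The symmetric average is half the sum of the one-sided
averages of `e` and of its reflection. -/
theorem hasTimeAverage_of_periodic {e : ℝ → ℝ} {T : ℝ} (hT : 0 < T) (he : Function.Periodic e T)
    (hi : IntervalIntegrable e volume 0 T) :
    HasTimeAverage e ((1 / T) * ∫ t in (0 : ℝ)..T, e t) := by
  have hii := he.intervalIntegrable₀ hT.ne' hi
  set A := ∫ t in (0 : ℝ)..T, e t with hA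
  have key : ∀ g : ℝ → ℝ, Function.Periodic g T → IntervalIntegrable g volume 0 T →
      Tendsto (fun s : ℝ => (1 / s) * ∫ t in (0 : ℝ)..s, g t) atTop
        (𝓝 ((1 / T) * ∫ t in (0 : ℝ)..T, g t)) := by
    intro g hg hgi
    have hfl : Tendsto (fun s : ℝ => (⌊s / T⌋ : ℝ) / s) atTop (𝓝 (1 / T)) := by
      have h1 := (tendsto_nat_floor_div_atTop (R := ℝ)).comp (tendsto_id.atTop_div_const hT)
      have h2 := h1.mul_const (1 / T)
      rw [one_mul] at h2
      refine h2.congr' ?_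
      filter_upwards [eventually_gt_atTop 0] with s hs
      simp only [Function.comp_apply, id]
      rw [← natCast_floor_eq_intCast_floor (by positivity)]
      field_simp
    have hb : ∀ c : ℝ, Tendsto
        (fun s : ℝ => (1 / s) * (c + ⌊s / T⌋ • ∫ t in (0 : ℝ)..T, g t)) atTop
        (𝓝 ((1 / T) * ∫ t in (0 : ℝ)..T, g t)) := by
      intro c
      have h1 : Tendsto (fun s : ℝ => c / s) atTop (𝓝 0) := tendsto_const_nhds.div_atTop tendsto_id
      have h2 := h1.add (hfl.mul_const (∫ t in (0 : ℝ)..T, g t))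
      rw [zero_add] at h2
      refine h2.congr fun s => ?_
      simp only [zsmul_eq_mul]
      ring
    refine tendsto_of_tendsto_of_tendsto_of_le_of_le' 
      (hb (sInf ((fun t => ∫ x in (0 : ℝ)..t, g x) '' Set.Icc 0 T)))
      (hb (sSup ((fun t => ∫ x in (0 : ℝ)..t, g x) '' Set.Icc 0 T))) ?_ ?_
    · filter_upwards [eventually_gt_atTop 0] with s hs
      exact mul_le_mul_of_nonneg_left (hg.sInf_add_zsmul_le_integral_of_pos hgi hT s)
        (by positivity)
    · filter_upwards [eventually_gt_atTop 0] with s hs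
      exact mul_le_mul_of_nonneg_left (hg.integral_le_sSup_add_zsmul_of_pos hgi hT s)
        (by positivity)
  have hneg : Function.Periodic (fun t => e (-t)) T := fun t => by
    have := he (-(t + T))
    beta_reduce
    rw [← this]; congr 1; ring
  have hnegi : IntervalIntegrable (fun t => e (-t)) volume 0 T := by
    have := (IntervalIntegrable.iff_comp_neg (by simp)).1 (hii (-0) (-T))
    simpa using this
  have hnegA : ∫ t in (0 : ℝ)..T, e (-t) = A := by
    rw [intervalIntegral.integral_comp_neg]
    have := he.intervalIntegral_add_eq (-T) 0
    simpa using this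
  have h := ((key e he hi).add (key _ hneg hnegi)).mul_const (1 / 2)
  rw [hnegA] at h
  have e1 : (1 / T * A + 1 / T * A) * (1 / 2) = 1 / T * A := by ring
  rw [e1] at h
  refine h.congr' ?_
  filter_upwards [eventually_gt_atTop 0] with s hs
  have h1 : ∫ t in (0 : ℝ)..s, e (-t) = ∫ t in (-s)..0, e t := by
    rw [intervalIntegral.integral_comp_neg]; simp
  rw [h1, ← intervalIntegral.integral_add_adjacent_intervals (hii (-s) 0) (hii 0 s)]
  field_simp
  ring

end

end FilterBank

namespace FilterBank

noncomputable section

/-! ### Maximal aliasing-free sets -/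

/-- The frequencies at which `S` is positive and larger than at all the other frequencies of their
class modulo `w`; ties are broken in favour of the frequency closest to `0`. -/
def argmaxSet (S : ℝ → ℝ) (w : ℝ) : Set ℝ :=
  {f | 0 < S f ∧ ∀ k : ℤ, k ≠ 0 →
    S (f - w * k) < S f ∨ (S (f - w * k) = S f ∧ |f| < |f - w * k|)}

theorem measurableSet_argmaxSet {S : ℝ → ℝ} (hS : Measurable S) (w : ℝ) :
    MeasurableSet (argmaxSet S w) := by
  have hs : ∀ k : ℤ, Measurable fun f => S (f - w * k) := fun k =>
    hS.comp (measurable_id.sub_const _)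
  have ha : ∀ k : ℤ, Measurable fun f : ℝ => |f - w * k| := fun k => by fun_prop
  have ha0 : Measurable fun f : ℝ => |f| := by fun_prop
  have : argmaxSet S w = {f | 0 < S f} ∩ ⋂ k : ℤ, ⋂ _ : k ≠ 0,
      ({f | S (f - w * k) < S f} ∪ ({f | S (f - w * k) = S f} ∩ {f | |f| < |f - w * k|})) := by
    ext f
    simp [argmaxSet]
  rw [this]
  refine (measurableSet_lt measurable_const hS).inter (MeasurableSet.iInter fun k =>
    MeasurableSet.iInter fun _ => ?_)
  exact (measurableSet_lt (hs k) hS).union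
    ((measurableSet_eq_fun (hs k) hS).inter (measurableSet_lt ha0 (ha k)))

theorem eq_of_mem_argmaxSet {S : ℝ → ℝ} {w f : ℝ} {k l : ℤ} (hk : f - w * k ∈ argmaxSet S w)
    (hl : f - w * l ∈ argmaxSet S w) : k = l := by
  by_contra hne
  have h1 := hk.2 (l - k) (sub_ne_zero.2 (Ne.symm hne))
  have h2 := hl.2 (k - l) (sub_ne_zero.2 hne)
  have e1 : f - w * k - w * ((l - k : ℤ) : ℝ) = f - w * l := by push_cast; ring
  have e2 : f - w * l - w * ((k - l : ℤ) : ℝ) = f - w * k := by push_cast; ring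
  rw [e1] at h1
  rw [e2] at h2
  rcases h1 with h1 | h1 <;> rcases h2 with h2 | h2
  · exact lt_asymm h1 h2
  · exact h1.ne' h2.1
  · exact h2.ne' h1.1
  · exact lt_asymm h1.2 h2.2

theorem aliasingFree_argmaxSet {S : ℝ → ℝ} (hS : Measurable S) (w : ℝ) :
    AliasingFree w (argmaxSet S w) := by
  refine ⟨measurableSet_argmaxSet hS w, ∅, measure_empty, fun f₁ h₁ f₂ h₂ hne k hk => ?_⟩
  have e2 : f₂ = f₁ - w * k := by linarith
  have h := eq_of_mem_argmaxSet (f := f₁) (k := 0) (l := k) (by simpa using h₁.1)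
    (by rw [← e2]; exact h₂.1)
  subst h
  simp at e2
  exact hne e2.symm

theorem neg_mem_argmaxSet {S : ℝ → ℝ} (hS : ∀ f, S (-f) = S f) (w f : ℝ) :
    -f ∈ argmaxSet S w ↔ f ∈ argmaxSet S w := by
  have key : ∀ f, f ∈ argmaxSet S w → -f ∈ argmaxSet S w := by
    rintro f ⟨h0, h⟩
    refine ⟨by rwa [hS], fun k hk => ?_⟩
    have := h (-k) (neg_ne_zero.2 hk)
    have e : -f - w * k = -(f - w * ((-k : ℤ) : ℝ)) := by push_cast; ring
    rw [e, hS, hS, abs_neg, abs_neg]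
    exact this
  exact ⟨fun h => by simpa using key _ h, key f⟩

/-- Summability leaves only finitely many points of the class above a given positive level, so a
maximum exists, and among the maximizers one is closest to `0`. Two distinct points of the class
with equal absolute value would make `2 f` a multiple of `w`, which `hf` excludes. -/
theorem exists_mem_argmaxSet {S : ℝ → ℝ} {w f : ℝ} (hw : 0 < w)
    (hs : Summable fun k : ℤ => S (f - w * k)) (hf : ∀ k : ℤ, 2 * f ≠ w * k) {k₁ : ℤ}
    (hk₁ : 0 < S (f - w * k₁)) : ∃ k : ℤ, f - w * k ∈ argmaxSet S w := by
  have hfin : {k : ℤ | S (f - w * k₁) ≤ S (f - w * k)}.Finite := by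
    have := hs.tendsto_cofinite_zero.eventually_lt_const hk₁
    rw [eventually_cofinite] at this
    exact this.subset fun k hk => not_lt.2 hk
  obtain ⟨k₂, hk₂, hmax⟩ := hfin.toFinset.exists_max_image (fun k => S (f - w * k))
    ⟨k₁, by simp⟩
  obtain ⟨k₀, hk₀, hmin⟩ := (hfin.toFinset.filter
    fun k : ℤ => S (f - w * k) = S (f - w * k₂)).exists_min_image (fun k : ℤ => |f - w * k|)
    ⟨k₂, by simpa using hk₂⟩
  simp only [Finset.mem_filter, Set.Finite.mem_toFinset, Set.mem_ofPred_eq] at hk₂ hmax hk₀ hmin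
  refine ⟨k₀, ⟨lt_of_lt_of_le hk₁ hk₀.1, fun k hk => ?_⟩⟩
  have e : f - w * k₀ - w * k = f - w * ((k₀ + k : ℤ) : ℝ) := by push_cast; ring
  rw [e]
  have hle : S (f - w * ((k₀ + k : ℤ) : ℝ)) ≤ S (f - w * k₀) := by
    by_cases h : S (f - w * k₁) ≤ S (f - w * ((k₀ + k : ℤ) : ℝ))
    · rw [hk₀.2]; exact hmax _ h
    · exact (not_le.1 h).le.trans hk₀.1
  rcases hle.lt_or_eq with h | h
  · exact Or.inl h
  refine Or.inr ⟨h, lt_of_le_of_ne (hmin (k₀ + k) ⟨?_, ?_⟩) fun habs => ?_⟩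
  · rw [h]; exact hk₀.1
  · rw [h]; exact hk₀.2
  · rcases abs_eq_abs.1 habs with h' | h'
    · push_cast at h'
      have : w * (k : ℝ) = 0 := by linarith
      rcases mul_eq_zero.1 this with h0 | h0
      · exact hw.ne' h0
      · exact hk (by exact_mod_cast h0)
    · refine hf (k₀ + (k₀ + k)) ?_
      push_cast at h' ⊢
      linarith

theorem tsum_indicator_argmaxSet {S : ℝ → ℝ} (h0 : ∀ f, 0 ≤ S f) {w f : ℝ} (hw : 0 < w)
    (hs : Summable fun k : ℤ => S (f - w * k)) (hf : ∀ k : ℤ, 2 * f ≠ w * k) :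
    ∑' k : ℤ, (argmaxSet S w).indicator S (f - w * k) = ⨆ k : ℤ, S (f - k * w) := by
  simp_rw [mul_comm _ w]
  by_cases h : ∃ k₁ : ℤ, 0 < S (f - w * k₁)
  · obtain ⟨k₁, hk₁⟩ := h
    obtain ⟨k, hk⟩ := exists_mem_argmaxSet hw hs hf hk₁
    have hle : ∀ l : ℤ, S (f - w * l) ≤ S (f - w * k) := by
      intro l
      by_cases hl : l = k
      · rw [hl]
      · have := hk.2 (l - k) (sub_ne_zero.2 hl)
        have e1 : f - w * k - w * ((l - k : ℤ) : ℝ) = f - w * l := by push_cast; ring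
        rw [e1] at this
        rcases this with h | h
        · exact h.le
        · exact h.1.le
    rw [tsum_eq_single k, Set.indicator_of_mem hk]
    · exact le_antisymm (le_ciSup ⟨_, Set.forall_mem_range.2 hle⟩ k) (ciSup_le hle)
    · intro l hl
      exact Set.indicator_of_notMem (fun h => hl (eq_of_mem_argmaxSet h hk)) _
  · push Not at h
    have hz : ∀ k : ℤ, S (f - w * k) = 0 := fun k => le_antisymm (h k) (h0 _)
    have hz' : ∀ k : ℤ, (argmaxSet S w).indicator S (f - w * k) = 0 := fun k =>
      Set.indicator_apply_eq_zero.2 fun _ => hz k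
    simp [hz, hz']

theorem ae_two_mul_ne (w : ℝ) : ∀ᵐ f : ℝ, ∀ k : ℤ, 2 * f ≠ w * k := by
  rw [ae_all_iff]
  intro k
  have : ∀ᵐ f : ℝ, f ≠ w * k / 2 := Measure.ae_ne volume (w * k / 2)
  filter_upwards [this] with f hf h
  exact hf (by linarith)

theorem setIntegral_argmaxSet {S : ℝ → ℝ} (hS : Measurable S) (h0 : ∀ f, 0 ≤ S f)
    (hi : Integrable S) {w : ℝ} (hw : 0 < w) :
    ∫ f in argmaxSet S w, S f = ∫ f in (-(w / 2))..(w / 2), ⨆ k : ℤ, S (f - k * w) := by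
  have hm := measurableSet_argmaxSet hS w
  rw [← integral_indicator hm, integral_eq_integral_tsum_shift (hi.indicator hm) hw]
  refine intervalIntegral.integral_congr_ae ?_
  filter_upwards [ae_summable_shift hi hw, ae_two_mul_ne w] with f hf hf' _
  exact tsum_indicator_argmaxSet h0 hw hf hf'

/-- The union of the first `n` sets obtained by repeatedly removing the `argmaxSet`. -/
def greedyUnion (S : ℝ → ℝ) (w : ℝ) : ℕ → Set ℝ
  | 0 => ∅
  | n + 1 => greedyUnion S w n ∪ argmaxSet ((greedyUnion S w n)ᶜ.indicator S) w

theorem measurableSet_greedyUnion {S : ℝ → ℝ} (hS : Measurable S) (w : ℝ) (n : ℕ) :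
    MeasurableSet (greedyUnion S w n) := by
  induction n with
  | zero => exact MeasurableSet.empty
  | succ n ih => exact ih.union (measurableSet_argmaxSet (hS.indicator ih.compl) w)

theorem indicator_compl_even {S : ℝ → ℝ} (hS : ∀ f, S (-f) = S f) {G : Set ℝ}
    (hG : ∀ f, -f ∈ G ↔ f ∈ G) (f : ℝ) : Gᶜ.indicator S (-f) = Gᶜ.indicator S f := by
  by_cases h : f ∈ G
  · rw [Set.indicator_of_notMem (by simpa [hG] using h), Set.indicator_of_notMem (by simpa using h)]
  · rw [Set.indicator_of_mem (by simpa [hG] using h), Set.indicator_of_mem (by simpa using h), hS]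

theorem neg_mem_greedyUnion {S : ℝ → ℝ} (hS : ∀ f, S (-f) = S f) (w : ℝ) (n : ℕ) (f : ℝ) :
    -f ∈ greedyUnion S w n ↔ f ∈ greedyUnion S w n := by
  induction n generalizing f with
  | zero => simp [greedyUnion]
  | succ n ih =>
    simp only [greedyUnion, Set.mem_union, ih,
      neg_mem_argmaxSet (indicator_compl_even hS ih)]

theorem greedyUnion_eq_iUnion (S : ℝ → ℝ) (w : ℝ) (n : ℕ) :
    greedyUnion S w n = ⋃ q : ℕ, ⋃ _ : q < n, argmaxSet ((greedyUnion S w q)ᶜ.indicator S) w := by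
  induction n with
  | zero => simp [greedyUnion]
  | succ n ih =>
    rw [greedyUnion]
    nth_rewrite 1 [ih]
    ext f
    simp only [Set.mem_union, Set.mem_iUnion, Nat.lt_succ_iff_lt_or_eq]
    constructor
    · rintro (⟨q, hq, h⟩ | h)
      · exact ⟨q, Or.inl hq, h⟩
      · exact ⟨n, Or.inr rfl, h⟩
    · rintro ⟨q, hq | rfl, h⟩
      · exact Or.inl ⟨q, hq, h⟩
      · exact Or.inr h

/-- Greedy removal of argmax sets. Breaking ties by `|f|` keeps the argmax set of an even function
symmetric, and removing a symmetric set keeps the remainder even. -/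
theorem exists_successiveMaximal {S : ℝ → ℝ} (hS : Measurable S) (h0 : ∀ f, 0 ≤ S f)
    (hi : Integrable S) (he : ∀ f, S (-f) = S f) {w : ℝ} (hw : 0 < w) (P : ℕ) :
    ∃ F : Fin P → Set ℝ, SuccessiveMaximal S w F ∧ ∀ p f, -f ∈ F p ↔ f ∈ F p := by
  set R : ℕ → ℝ → ℝ := fun n => (greedyUnion S w n)ᶜ.indicator S with hR
  have hRm : ∀ n, Measurable (R n) := fun n =>
    hS.indicator (measurableSet_greedyUnion hS w n).compl
  -- Membership in an argmax set requires a strictly positive value, while the remainder is `0` on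
  -- what has been removed.
  have hsub : ∀ n, argmaxSet (R n) w ⊆ (greedyUnion S w n)ᶜ := by
    intro n f hf hmem
    have := hf.1
    simp [hR, hmem] at this
  have hU : ∀ p : Fin P, (⋃ q : Fin P, ⋃ _ : q < p, argmaxSet (R q) w) = greedyUnion S w p := by
    intro p
    rw [greedyUnion_eq_iUnion]
    ext f
    simp only [Set.mem_iUnion]
    constructor
    · rintro ⟨q, hq, h⟩
      exact ⟨q, hq, h⟩
    · rintro ⟨q, hq, h⟩
      exact ⟨⟨q, hq.trans p.2⟩, hq, h⟩
  have hdisj : ∀ m n : ℕ, m < n → argmaxSet (R m) w ∩ argmaxSet (R n) w = ∅ := by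
    intro m n hmn
    refine Set.eq_empty_of_forall_notMem fun f hf => hsub n hf.2 ?_
    rw [greedyUnion_eq_iUnion]
    exact Set.mem_iUnion₂.2 ⟨m, hmn, hf.1⟩
  refine ⟨fun p => argmaxSet (R p) w, ⟨fun p => aliasingFree_argmaxSet (hRm p) w,
    fun p q hpq => ?_, fun p => ?_⟩, fun p f => neg_mem_argmaxSet
      (indicator_compl_even he (neg_mem_greedyUnion he w p)) w f⟩
  · rcases lt_or_gt_of_ne hpq with h | h
    · rw [hdisj p q h, measure_empty]
    · rw [Set.inter_comm, hdisj q p h, measure_empty]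
  · simp only [Jstar, hU p]
    rw [← setIntegral_argmaxSet (hRm p) (fun f => Set.indicator_nonneg (fun f _ => h0 f) f)
      (hi.indicator (measurableSet_greedyUnion hS w p).compl) hw]
    refine setIntegral_congr_fun (measurableSet_argmaxSet (hRm p) w) fun f hf => ?_
    exact (Set.indicator_of_mem (hsub p hf) S).symm

/-! ### Almost everywhere description of successive maximal sets -/

theorem AliasingFree.ae_subsingleton {w : ℝ} {F : Set ℝ} (hw : w ≠ 0) (h : AliasingFree w F) :
    ∀ᵐ f : ℝ, ∀ k l : ℤ, f - w * k ∈ F → f - w * l ∈ F → k = l := by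
  obtain ⟨_, N, hN, h⟩ := h
  have hN' : ∀ᵐ f : ℝ, f ∉ N := measure_eq_zero_iff_ae_notMem.1 hN
  filter_upwards [ae_forall_shift hN' w] with f hf k l hk hl
  by_contra hne
  refine h _ ⟨hk, hf k⟩ _ ⟨hl, hf l⟩ (fun e => hne ?_) (l - k) (by push_cast; ring)
  have : w * (k : ℝ) = w * l := by linarith
  exact_mod_cast mul_left_cancel₀ hw this

theorem measurable_Jstar {S : ℝ → ℝ} (hS : Measurable S) {w : ℝ} {P : ℕ} {F : Fin P → Set ℝ}
    (hF : ∀ p, MeasurableSet (F p)) (p : Fin P) : Measurable (Jstar S w F p) := by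
  have hm : Measurable ((⋃ q : Fin P, ⋃ _ : q < p, F q)ᶜ.indicator S) :=
    hS.indicator (MeasurableSet.iUnion fun q => MeasurableSet.iUnion fun _ => hF q).compl
  exact Measurable.iSup fun k => hm.comp (measurable_id.sub_const _)

theorem Jstar_nonneg {S : ℝ → ℝ} (h0 : ∀ f, 0 ≤ S f) (w : ℝ) {P : ℕ} (F : Fin P → Set ℝ)
    (p : Fin P) (f : ℝ) : 0 ≤ Jstar S w F p f :=
  Real.iSup_nonneg fun _ => Set.indicator_nonneg (fun x _ => h0 x) _

theorem Jstar_sub (S : ℝ → ℝ) (w : ℝ) {P : ℕ} (F : Fin P → Set ℝ) (p : Fin P) (f : ℝ) (k : ℤ) :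
    Jstar S w F p (f - w * k) = Jstar S w F p f := by
  refine (Equiv.addLeft k).iSup_congr fun l => ?_
  congr 1
  rw [Equiv.coe_addLeft]
  push_cast
  ring

theorem bddAbove_Jstar {S : ℝ → ℝ} (h0 : ∀ f, 0 ≤ S f) {w f : ℝ}
    (hs : Summable fun k : ℤ => S (f - w * k)) (G : Set ℝ) :
    BddAbove (Set.range fun k : ℤ => G.indicator S (f - k * w)) := by
  refine ⟨∑' k : ℤ, S (f - w * k), Set.forall_mem_range.2 fun k => ?_⟩
  rw [mul_comm]
  exact (Set.indicator_le_self' (fun x _ => h0 x) _).trans (hs.le_tsum k fun l _ => h0 _)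

theorem ae_notMem_of_successiveMaximal {S : ℝ → ℝ} {w : ℝ} {P : ℕ}
    {F : Fin P → Set ℝ} (hF : SuccessiveMaximal S w F) (p : Fin P) :
    ∀ᵐ f : ℝ, ∀ k : ℤ, f - w * k ∈ F p → f - w * k ∉ ⋃ q : Fin P, ⋃ _ : q < p, F q := by
  have : ∀ᵐ f : ℝ, f ∈ F p → f ∉ ⋃ q : Fin P, ⋃ _ : q < p, F q := by
    have h : ∀ q : Fin P, ∀ᵐ f : ℝ, q < p → f ∉ F p ∩ F q := fun q => by
      by_cases hq : q < p
      · filter_upwards [measure_eq_zero_iff_ae_notMem.1 (hF.disjoint p q hq.ne')] with f hf _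
          using hf
      · exact Eventually.of_forall fun f h => absurd h hq
    filter_upwards [ae_all_iff.2 h] with f hf hfp hmem
    obtain ⟨q, hq, hfq⟩ := Set.mem_iUnion₂.1 hmem
    exact hf q hq ⟨hfp, hfq⟩
  exact ae_forall_shift this w

/-- Maximality is given only as an equality of integrals. Pointwise, `F p` meets almost every class
at most once and avoids the earlier sets, so the folded indicator is at most `Jstar`; equal
integrals then force equality almost everywhere on one period, and periodicity does the rest. -/
theorem ae_tsum_indicator_eq_Jstar {S : ℝ → ℝ} (hS : Measurable S) (h0 : ∀ f, 0 ≤ S f)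
    (hi : Integrable S) {w : ℝ} (hw : 0 < w) {P : ℕ} {F : Fin P → Set ℝ}
    (hF : SuccessiveMaximal S w F) (p : Fin P) :
    IntervalIntegrable (Jstar S w F p) volume (-(w / 2)) (w / 2) ∧
    ∀ᵐ f : ℝ, ∑' k : ℤ, (F p).indicator S (f - w * k) = Jstar S w F p f := by
  have hm := fun q => (hF.aliasingFree q).1
  have hle : ∀ᵐ f : ℝ, ∑' k : ℤ, (F p).indicator S (f - w * k) ≤ Jstar S w F p f := by
    filter_upwards [(hF.aliasingFree p).ae_subsingleton hw.ne',
      ae_notMem_of_successiveMaximal hF p, ae_summable_shift hi hw] with f h1 h2 h3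
    have hb := bddAbove_Jstar h0 h3 (⋃ q : Fin P, ⋃ _ : q < p, F q)ᶜ
    by_cases h : ∃ k : ℤ, f - w * k ∈ F p
    · obtain ⟨k, hk⟩ := h
      rw [tsum_eq_single k fun l hl => Set.indicator_of_notMem (fun h => hl (h1 _ _ h hk)) _,
        Set.indicator_of_mem hk]
      refine le_trans (le_of_eq ?_) (le_ciSup hb k)
      rw [mul_comm (k : ℝ) w, Set.indicator_of_mem (Set.mem_compl (h2 k hk))]
    · push Not at h
      simp only [Set.indicator_of_notMem (h _), tsum_zero]
      exact Jstar_nonneg h0 w F p f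
  have hge : ∀ᵐ f : ℝ, Jstar S w F p f ≤ ∑' k : ℤ, S (f - w * k) := by
    filter_upwards [ae_summable_shift hi hw] with f h3
    refine ciSup_le fun k => ?_
    rw [mul_comm]
    exact (Set.indicator_le_self' (fun x _ => h0 x) _).trans (h3.le_tsum k fun l _ => h0 _)
  have hJ : IntervalIntegrable (Jstar S w F p) volume (-(w / 2)) (w / 2) := by
    refine (intervalIntegrable_tsum_shift hi hw).mono_fun
      (measurable_Jstar hS hm p).aestronglyMeasurable ?_
    refine ae_restrict_of_ae ?_
    filter_upwards [hge] with f hf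
    rw [Real.norm_of_nonneg (Jstar_nonneg h0 w F p f),
      Real.norm_of_nonneg (tsum_nonneg fun k => h0 _)]
    exact hf
  refine ⟨hJ, ?_⟩
  have hFi := hi.indicator (hm p)
  have heq := hF.maximal p
  rw [← integral_indicator (hm p), integral_eq_integral_tsum_shift hFi hw] at heq
  have hT := intervalIntegrable_tsum_shift hFi hw
  have hww : -(w / 2) ≤ w / 2 := by linarith
  rw [intervalIntegral.integral_of_le hww, intervalIntegral.integral_of_le hww] at heq
  rw [intervalIntegrable_iff_integrableOn_Ioc_of_le hww] at hT
  have hJ' := hJ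
  rw [intervalIntegrable_iff_integrableOn_Ioc_of_le hww] at hJ'
  have hae := (integral_eq_iff_of_ae_le hT hJ' (ae_restrict_of_ae hle)).1 heq
  refine ae_of_ae_Ioc hw (fun f k h => ?_) hae
  have hp := (tsum_shift_periodic ((F p).indicator S) w).sub_int_mul_eq (x := f) k
  rw [← Jstar_sub S w F p f k, ← h, mul_comm w (k : ℝ)]
  exact hp.symm

end

end FilterBank

namespace FilterBank

noncomputable section

/-! ### Matrix lemmas -/

open Matrix
open scoped ComplexOrder

section MatrixLemmas

variable {P : ℕ} {A : Matrix (Fin P) (Fin P) ℂ}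

theorem invSqrt_conjTranspose (A : Matrix (Fin P) (Fin P) ℂ) : (invSqrt A)ᴴ = invSqrt A :=
  (cfc_predicate (p := IsSelfAdjoint) (fun x : ℝ => (√x)⁻¹) A : IsSelfAdjoint _)

theorem mul_invSqrt_comm (hA : A.PosSemidef) : A * invSqrt A = invSqrt A * A := by
  have hA' : IsSelfAdjoint A := hA.1
  exact ((Commute.refl A).cfc_real _).eq.symm

/-- The square of `invSqrt A` is a generalized inverse of `A`: this is the scalar identity `x ·
x^{-1/2} · x^{-1/2} · x = x` on the spectrum, valid also at `x = 0` because `(√0)⁻¹ = 0`. -/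
theorem mul_invSqrt_sq_mul (hA : A.PosSemidef) : A * invSqrt A * invSqrt A * A = A := by
  have hA' : IsSelfAdjoint A := hA.1
  have hfin : (spectrum ℝ A).Finite := by
    rw [hA.1.spectrum_real_eq_range_eigenvalues]; exact Set.finite_range _
  -- The function `(√x)⁻¹` is discontinuous at `0`, but on a finite spectrum every function is
  -- continuous.
  have hc : ∀ g : ℝ → ℝ, ContinuousOn g (spectrum ℝ A) := fun g => hfin.continuousOn g
  have hid : cfc (fun x : ℝ => x) A = A := cfc_id' ℝ A
  have h1 : A * invSqrt A * invSqrt A * A = cfc (fun x : ℝ => x * (√x)⁻¹ * (√x)⁻¹ * x) A := by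
    rw [cfc_mul _ _ A (hc _) (hc _), cfc_mul _ _ A (hc _) (hc _), cfc_mul _ _ A (hc _) (hc _), hid]
    rfl
  rw [h1]
  conv_rhs => rw [← hid]
  refine cfc_congr fun x hx => ?_
  rw [hA.1.spectrum_real_eq_range_eigenvalues] at hx
  obtain ⟨i, rfl⟩ := hx
  have h0 := hA.eigenvalues_nonneg i
  set x := hA.1.eigenvalues i
  change x * (√x)⁻¹ * (√x)⁻¹ * x = x
  rcases h0.eq_or_lt with h | h
  · rw [← h]; simp
  · have h2 := Real.mul_self_sqrt h0
    have h3 : √x ≠ 0 := (Real.sqrt_pos.2 h).ne'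
    calc x * (√x)⁻¹ * (√x)⁻¹ * x = x * (x * (√x * √x)⁻¹) := by rw [mul_inv]; ring
      _ = x := by rw [h2, mul_inv_cancel₀ h.ne', mul_one]

theorem re_star_dotProduct_self (v : Fin P → ℂ) : (star v ⬝ᵥ v).re = ∑ p, ‖v p‖ ^ 2 := by
  simp only [dotProduct, Complex.re_sum, Pi.star_apply]
  refine Finset.sum_congr rfl fun p _ => ?_
  rw [Complex.star_def, ← Complex.normSq_eq_conj_mul_self, Complex.ofReal_re,
    Complex.normSq_eq_norm_sq]

theorem re_star_dotProduct_comm (u v : Fin P → ℂ) : (star u ⬝ᵥ v).re = (star v ⬝ᵥ u).re := by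
  have h : star u ⬝ᵥ v = star (star v ⬝ᵥ u) := by rw [star_dotProduct]
  rw [h, Complex.star_def, Complex.conj_re]

theorem star_mulVec_dotProduct (hA : A.IsHermitian) (u v : Fin P → ℂ) :
    star (A *ᵥ u) ⬝ᵥ v = star u ⬝ᵥ (A *ᵥ v) := by
  rw [star_mulVec, hA.eq, dotProduct_mulVec]

theorem invSqrt_isHermitian (A : Matrix (Fin P) (Fin P) ℂ) : (invSqrt A).IsHermitian :=
  invSqrt_conjTranspose A

/-- A vector orthogonal to the kernel of `A` is in the range of `A`. -/
theorem mulVec_invSqrt_invSqrt (hA : A.PosSemidef) {b : Fin P → ℂ}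
    (hb : ∀ v, A *ᵥ v = 0 → star v ⬝ᵥ b = 0) :
    A *ᵥ (invSqrt A *ᵥ (invSqrt A *ᵥ b)) = b := by
  set R := invSqrt A with hR
  set v := b - A *ᵥ (R *ᵥ (R *ᵥ b)) with hv
  have hAv : A *ᵥ v = 0 := by
    rw [hv, mulVec_sub]
    have : A * A * R * R = A := by
      calc A * A * R * R = A * (A * R) * R := by simp only [mul_assoc]
        _ = A * (R * A) * R := congrArg (fun B => A * B * R) (mul_invSqrt_comm hA)
        _ = A * R * (A * R) := by simp only [mul_assoc]
        _ = A * R * (R * A) := congrArg (fun B => A * R * B) (mul_invSqrt_comm hA)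
        _ = A * R * R * A := by simp only [mul_assoc]
        _ = A := mul_invSqrt_sq_mul hA
    simp only [mulVec_mulVec, ← mul_assoc]
    rw [this, sub_self]
  have h1 := hb v hAv
  have h2 : star v ⬝ᵥ (A *ᵥ (R *ᵥ (R *ᵥ b))) = 0 := by
    rw [← star_mulVec_dotProduct hA.1, hAv]; simp
  have h3 : star v ⬝ᵥ v = 0 := by
    conv_lhs => rw [hv, dotProduct_sub, ← hv, h1, h2, sub_zero]
  have h4 : v = 0 := dotProduct_star_self_eq_zero.1 h3
  rw [hv, sub_eq_zero] at h4
  exact h4.symm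

/-- The value at `b` of the quadratic form of the Moore–Penrose inverse of `A`. -/
def energy (A : Matrix (Fin P) (Fin P) ℂ) (b : Fin P → ℂ) : ℝ :=
  (star (invSqrt A *ᵥ b) ⬝ᵥ (invSqrt A *ᵥ b)).re

theorem energy_eq_sum (A : Matrix (Fin P) (Fin P) ℂ) (b : Fin P → ℂ) :
    energy A b = ∑ p, ‖(invSqrt A *ᵥ b) p‖ ^ 2 := re_star_dotProduct_self _

theorem energy_nonneg (A : Matrix (Fin P) (Fin P) ℂ) (b : Fin P → ℂ) : 0 ≤ energy A b := by
  rw [energy_eq_sum]; positivity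

/-- The quadratic functional `c^* A c - 2 Re c^* b`. -/
def quadValue (A : Matrix (Fin P) (Fin P) ℂ) (b c : Fin P → ℂ) : ℝ :=
  (star c ⬝ᵥ (A *ᵥ c)).re - 2 * (star c ⬝ᵥ b).re

theorem energy_eq (hA : A.PosSemidef) {y b : Fin P → ℂ} (hy : A *ᵥ y = b) :
    energy A b = (star y ⬝ᵥ (A *ᵥ y)).re := by
  rw [energy, star_mulVec_dotProduct (invSqrt_isHermitian A), ← hy,
    star_mulVec_dotProduct hA.1, mulVec_mulVec, mulVec_mulVec, mulVec_mulVec]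
  congr 3
  simpa [mul_assoc] using mul_invSqrt_sq_mul hA

/-- Completing the square around a solution `y` of `A y = b`. -/
theorem quadValue_add_energy (hA : A.PosSemidef) {y b : Fin P → ℂ} (hy : A *ᵥ y = b)
    (c : Fin P → ℂ) :
    quadValue A b c + energy A b = (star (y - c) ⬝ᵥ (A *ᵥ (y - c))).re := by
  rw [energy_eq hA hy, quadValue, ← hy, mulVec_sub, star_sub, sub_dotProduct, dotProduct_sub,
    dotProduct_sub]
  have h : (star y ⬝ᵥ (A *ᵥ c)).re = (star c ⬝ᵥ (A *ᵥ y)).re := by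
    rw [← star_mulVec_dotProduct hA.1, re_star_dotProduct_comm]
  simp only [Complex.sub_re, h]
  ring

theorem re_quadForm_nonneg (hA : A.PosSemidef) (c : Fin P → ℂ) :
    0 ≤ (star c ⬝ᵥ (A *ᵥ c)).re :=
  hA.re_dotProduct_nonneg c

theorem neg_energy_le_quadValue (hA : A.PosSemidef) {b : Fin P → ℂ}
    (hb : ∀ v, A *ᵥ v = 0 → star v ⬝ᵥ b = 0) (c : Fin P → ℂ) :
    -energy A b ≤ quadValue A b c := by
  have h := quadValue_add_energy hA (mulVec_invSqrt_invSqrt hA hb) c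
  have := re_quadForm_nonneg hA (invSqrt A *ᵥ (invSqrt A *ᵥ b) - c)
  linarith

/-- The solution of `(A + ε) c = b`. -/
def ridge (A : Matrix (Fin P) (Fin P) ℂ) (ε : ℝ) (b : Fin P → ℂ) : Fin P → ℂ :=
  (A + (ε : ℂ) • 1)⁻¹ *ᵥ b

theorem mulVec_ridge (hA : A.PosSemidef) {ε : ℝ} (hε : 0 < ε) (b : Fin P → ℂ) :
    A *ᵥ ridge A ε b + (ε : ℂ) • ridge A ε b = b := by
  have hpd : (A + (ε : ℂ) • (1 : Matrix (Fin P) (Fin P) ℂ)).PosDef :=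
    Matrix.PosDef.posSemidef_add hA (PosDef.one.smul (by exact_mod_cast hε))
  have hu : IsUnit (A + (ε : ℂ) • (1 : Matrix (Fin P) (Fin P) ℂ)).det :=
    (Matrix.isUnit_iff_isUnit_det _).1 hpd.isUnit
  have h : (A + (ε : ℂ) • (1 : Matrix (Fin P) (Fin P) ℂ)) *ᵥ ridge A ε b = b := by
    rw [ridge, mulVec_mulVec, mul_nonsing_inv _ hu, one_mulVec]
  rwa [add_mulVec, smul_mulVec, one_mulVec] at h

/-- The ridge solution `c` satisfies `A (y - c) = ε c`, so its excess over the minimum is `ε (Re y^*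
c - |c|²)`. Nonnegativity of this excess gives `|c|² ≤ Re y^* c`, hence `|c| ≤ |y|` for every `ε`,
and an excess of order `ε`. -/
theorem ridge_bounds (hA : A.PosSemidef) {y b : Fin P → ℂ} (hy : A *ᵥ y = b) {ε : ℝ}
    (hε : 0 < ε) :
    ∑ p, ‖ridge A ε b p‖ ^ 2 ≤ ∑ p, ‖y p‖ ^ 2 ∧
      quadValue A b (ridge A ε b) + energy A b ≤ ε * ∑ p, ‖y p‖ ^ 2 ∧
      quadValue A b (ridge A ε b) ≤ 0 := by
  set c := ridge A ε b with hc
  have hAc : A *ᵥ c + (ε : ℂ) • c = b := mulVec_ridge hA hε b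
  have hz : A *ᵥ (y - c) = (ε : ℂ) • c := by
    rw [mulVec_sub, hy, ← hAc]; abel
  have h1 : quadValue A b c + energy A b = ε * ((star y ⬝ᵥ c).re - ∑ p, ‖c p‖ ^ 2) := by
    rw [quadValue_add_energy hA hy, hz, dotProduct_smul, star_sub, sub_dotProduct,
      ← re_star_dotProduct_self, smul_eq_mul, Complex.re_ofReal_mul, Complex.sub_re]
  have h2 : 0 ≤ quadValue A b c + energy A b := by
    rw [quadValue_add_energy hA hy]; exact re_quadForm_nonneg hA _
  have h3 : ∑ p, ‖c p‖ ^ 2 ≤ (star y ⬝ᵥ c).re := by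
    rw [h1] at h2
    nlinarith [nonneg_of_mul_nonneg_right h2 hε]
  have h4 : (star y ⬝ᵥ c).re ≤ (∑ p, ‖y p‖ ^ 2 + ∑ p, ‖c p‖ ^ 2) / 2 := by
    have h5 : 0 ≤ (star (y - c) ⬝ᵥ (y - c)).re := by
      rw [re_star_dotProduct_self]; positivity
    rw [star_sub, sub_dotProduct, dotProduct_sub, dotProduct_sub] at h5
    simp only [Complex.sub_re] at h5
    rw [re_star_dotProduct_self, re_star_dotProduct_self, re_star_dotProduct_comm c y] at h5
    linarith
  have h6 : 0 ≤ ∑ p, ‖c p‖ ^ 2 := by positivity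
  refine ⟨by linarith, ?_, ?_⟩
  · rw [h1]
    exact mul_le_mul_of_nonneg_left (by linarith) hε.le
  · rw [quadValue]
    have h7 := congrArg (fun u => (star c ⬝ᵥ u).re) hAc
    simp only [dotProduct_add, dotProduct_smul, Complex.add_re, smul_eq_mul,
      Complex.re_ofReal_mul] at h7
    rw [re_star_dotProduct_self] at h7
    have h8 := re_quadForm_nonneg hA c
    nlinarith [mul_nonneg hε.le h6]

theorem quadValue_zero (A : Matrix (Fin P) (Fin P) ℂ) (b : Fin P → ℂ) : quadValue A b 0 = 0 := by
  simp [quadValue]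

/-- The ridge solution with parameter `1 / (n + 1)`, replaced by `0` where it is too large. -/
def truncRidge (A : Matrix (Fin P) (Fin P) ℂ) (b : Fin P → ℂ) (n : ℕ) : Fin P → ℂ :=
  if ∑ p, ‖ridge A (1 / (n + 1)) b p‖ ^ 2 ≤ n then ridge A (1 / (n + 1)) b else 0

theorem norm_truncRidge_le (A : Matrix (Fin P) (Fin P) ℂ) (b : Fin P → ℂ) (n : ℕ) (p : Fin P) :
    ‖truncRidge A b n p‖ ^ 2 ≤ n := by
  rw [truncRidge]
  split_ifs with h
  · exact (Finset.single_le_sum (f := fun p => ‖ridge A (1 / (n + 1)) b p‖ ^ 2)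
      (fun _ _ => by positivity) (Finset.mem_univ p)).trans h
  · simp

/-- Both branches of the truncation have a value between `-energy A b` and `0`. The bound does not
depend on `n` and serves for dominated convergence. -/
theorem abs_quadValue_truncRidge_le (hA : A.PosSemidef) {b : Fin P → ℂ}
    (hb : ∀ v, A *ᵥ v = 0 → star v ⬝ᵥ b = 0) (n : ℕ) :
    |quadValue A b (truncRidge A b n)| ≤ energy A b := by
  rw [truncRidge]
  split_ifs with h
  · have h1 := (ridge_bounds hA (mulVec_invSqrt_invSqrt hA hb)
      (ε := 1 / ((n : ℝ) + 1)) (by positivity)).2.2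
    rw [abs_of_nonpos h1]
    linarith [neg_energy_le_quadValue hA hb (ridge A (1 / ((n : ℝ) + 1)) b)]
  · rw [quadValue_zero, abs_zero]
    exact energy_nonneg A b

theorem tendsto_quadValue_truncRidge (hA : A.PosSemidef) {b : Fin P → ℂ}
    (hb : ∀ v, A *ᵥ v = 0 → star v ⬝ᵥ b = 0) :
    Tendsto (fun n => quadValue A b (truncRidge A b n)) atTop (𝓝 (-energy A b)) := by
  set y := invSqrt A *ᵥ (invSqrt A *ᵥ b) with hy
  have hAy : A *ᵥ y = b := mulVec_invSqrt_invSqrt hA hb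
  have h0 : Tendsto (fun n : ℕ => -energy A b + 1 / ((n : ℝ) + 1) * ∑ p, ‖y p‖ ^ 2) atTop
      (𝓝 (-energy A b)) := by
    have := (tendsto_one_div_add_atTop_nhds_zero_nat (𝕜 := ℝ)).mul_const (∑ p, ‖y p‖ ^ 2)
    simpa using this.const_add (-energy A b)
  refine tendsto_of_tendsto_of_tendsto_of_le_of_le' tendsto_const_nhds h0
    (Eventually.of_forall fun n => neg_energy_le_quadValue hA hb _) ?_
  -- The ridge solutions are bounded by the norm of `y`, so the truncation is inactive from `N` on.
  obtain ⟨N, hN⟩ := exists_nat_ge (∑ p, ‖y p‖ ^ 2)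
  filter_upwards [eventually_ge_atTop N] with n hn
  have hb' := ridge_bounds hA hAy (ε := 1 / ((n : ℝ) + 1)) (by positivity)
  rw [truncRidge, if_pos (hb'.1.trans (hN.trans (by exact_mod_cast hn)))]
  linarith [hb'.2.1]

/-- `A^{-1/2} A A^{-1/2}` is an orthogonal projection, hence a contraction. -/
theorem re_invSqrt_quadForm_le (hA : A.PosSemidef) (c : Fin P → ℂ) :
    (star (invSqrt A *ᵥ c) ⬝ᵥ (A *ᵥ (invSqrt A *ᵥ c))).re ≤ (star c ⬝ᵥ c).re := by
  set R := invSqrt A with hR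
  set d := R *ᵥ (A *ᵥ (R *ᵥ c)) with hd
  have h1 : star (R *ᵥ c) ⬝ᵥ (A *ᵥ (R *ᵥ c)) = star c ⬝ᵥ d := by
    rw [star_mulVec_dotProduct (invSqrt_isHermitian A)]
  have h2 : star d ⬝ᵥ d = star c ⬝ᵥ d := by
    rw [hd, star_mulVec_dotProduct (invSqrt_isHermitian A), star_mulVec_dotProduct hA.1,
      star_mulVec_dotProduct (invSqrt_isHermitian A)]
    congr 1
    simp only [mulVec_mulVec]
    congr 1
    have := mul_invSqrt_sq_mul hA
    calc R * (A * (R * (R * (A * R)))) = R * (A * R * R * A) * R := by simp only [mul_assoc]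
      _ = R * (A * R) := by rw [this, mul_assoc]
  rw [h1]
  have h3 : 0 ≤ (star (c - d) ⬝ᵥ (c - d)).re := by
    rw [re_star_dotProduct_self]; positivity
  rw [star_sub, sub_dotProduct, dotProduct_sub, dotProduct_sub, h2] at h3
  simp only [Complex.sub_re] at h3
  rw [re_star_dotProduct_comm d c] at h3
  linarith

/-- If a Hermitian form is at most `J` on a subspace of codimension at most `i`, then the
eigenvalue number `i` (counted from `0`, in decreasing order) is at most `J`. -/
theorem eigenvalues₀_le_of_forall (hA : A.IsHermitian) (i : Fin (Fintype.card (Fin P))) {τ : Type*}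
    [Fintype τ] (hτ : Fintype.card τ ≤ i) (L : (Fin P → ℂ) →ₗ[ℂ] (τ → ℂ)) {J : ℝ}
    (h : ∀ c, L c = 0 → (star c ⬝ᵥ (A *ᵥ c)).re ≤ J * (star c ⬝ᵥ c).re) :
    hA.eigenvalues₀ i ≤ J := by
  classical
  have hsym := isSymmetric_toEuclideanLin_iff.mpr hA
  set v := hsym.eigenvectorBasis finrank_euclideanSpace with hv
  let Φ : (Set.Iic i → ℂ) →ₗ[ℂ] (Fin P → ℂ) :=
    (WithLp.linearEquiv 2 ℂ (Fin P → ℂ)).toLinearMap ∘ₗ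
      Fintype.linearCombination ℂ (fun j : Set.Iic i => v j)
  -- The first `i + 1` eigenvectors span more dimensions than `L` has conditions, so some nonzero
  -- combination is annihilated by `L`; on it the form is at least the eigenvalue number `i` times
  -- the squared norm.
  have hcard : Module.finrank ℂ (τ → ℂ) < Module.finrank ℂ (Set.Iic i → ℂ) := by
    rw [Module.finrank_fintype_fun_eq_card, Module.finrank_fintype_fun_eq_card]
    have : Fintype.card (Set.Iic i) = i + 1 := by simp
    omega
  obtain ⟨a, ha, ha0⟩ : ∃ a ∈ LinearMap.ker (L ∘ₗ Φ), a ≠ 0 :=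
    (Submodule.ne_bot_iff _).1 (LinearMap.ker_ne_bot_of_finrank_lt hcard)
  set x : EuclideanSpace ℂ (Fin P) := ∑ j : Set.Iic i, a j • v j with hx
  have hΦ : Φ a = x.ofLp := by
    simp [Φ, Fintype.linearCombination_apply, hx]
  have hLx : L x.ofLp = 0 := by
    rw [← hΦ]; exact ha
  have key := h _ hLx
  have hinner : ∀ j k : Set.Iic i, inner ℂ (v j) (v k) = if j = k then (1 : ℂ) else 0 := by
    intro j k
    rw [orthonormal_iff_ite.1 v.orthonormal]
    simp [Subtype.ext_iff]
  have hxx : inner ℂ x x = ((∑ j : Set.Iic i, ‖a j‖ ^ 2 : ℝ) : ℂ) := by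
    simp only [hx, sum_inner, inner_sum, inner_smul_left, inner_smul_right, hinner]
    simp [Complex.mul_conj']
  have hAx : Matrix.toEuclideanLin A x = ∑ j : Set.Iic i, (a j * hA.eigenvalues₀ j) • v j := by
    rw [hx, map_sum]
    refine Finset.sum_congr rfl fun j _ => ?_
    rw [map_smul, hv, hsym.apply_eigenvectorBasis, smul_smul]
    rfl
  have hxA : inner ℂ x (Matrix.toEuclideanLin A x) =
      ((∑ j : Set.Iic i, hA.eigenvalues₀ j * ‖a j‖ ^ 2 : ℝ) : ℂ) := by
    rw [hAx]
    simp only [hx, sum_inner, inner_sum, inner_smul_left, inner_smul_right, hinner]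
    simp only [mul_ite, mul_one, mul_zero, Finset.sum_ite_eq', Finset.mem_univ, if_true]
    push_cast
    refine Finset.sum_congr rfl fun j _ => ?_
    rw [← Complex.conj_mul']
    ring
  have e1 : star x.ofLp ⬝ᵥ x.ofLp = inner ℂ x x := by
    rw [EuclideanSpace.inner_eq_star_dotProduct, dotProduct_comm]
  have e2 : star x.ofLp ⬝ᵥ (A *ᵥ x.ofLp) = inner ℂ x (Matrix.toEuclideanLin A x) := by
    rw [EuclideanSpace.inner_eq_star_dotProduct, dotProduct_comm]; rfl
  rw [e1, e2, hxx, hxA, Complex.ofReal_re, Complex.ofReal_re] at key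
  have hpos : 0 < ∑ j : Set.Iic i, ‖a j‖ ^ 2 := by
    obtain ⟨j, hj⟩ := Function.ne_iff.1 ha0
    exact Finset.sum_pos' (fun _ _ => by positivity) ⟨j, Finset.mem_univ j, by
      have : a j ≠ 0 := hj
      positivity⟩
  have hle : hA.eigenvalues₀ i * ∑ j : Set.Iic i, ‖a j‖ ^ 2 ≤
      ∑ j : Set.Iic i, hA.eigenvalues₀ j * ‖a j‖ ^ 2 := by
    rw [Finset.mul_sum]
    refine Finset.sum_le_sum fun j _ => mul_le_mul_of_nonneg_right ?_ (by positivity)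
    exact hA.eigenvalues₀_antitone j.2
  exact le_of_mul_le_mul_right (hle.trans key) hpos

theorem sum_eigenvalues₀ (hA : A.IsHermitian) : ∑ i, hA.eigenvalues₀ i = A.trace.re := by
  rw [hA.trace_eq_sum_eigenvalues, Complex.re_sum]
  simp only [Matrix.IsHermitian.eigenvalues, Complex.coe_algebraMap, Complex.ofReal_re]
  exact (Equiv.sum_comp _ _).symm

end MatrixLemmas

end

end FilterBank

namespace FilterBank

noncomputable section

open Matrix
open scoped ComplexOrder

/-! ### Folded matrices -/

section Folded

variable {S : ℝ → ℝ} {w : ℝ} {P : ℕ} {H : Fin P → ℝ → ℂ} {f : ℝ}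

theorem hasSum_foldedMatrix_apply (h0 : ∀ f, 0 ≤ S f)
    (hs : ∀ p, Summable fun k : ℤ => S (f - w * k) * ‖H p (f - w * k)‖ ^ 2) (i j : Fin P) :
    HasSum (fun k : ℤ => (S (f - w * k) : ℂ) * conj (H i (f - w * k)) * H j (f - w * k))
      (foldedMatrix S w H f i j) := by
  refine Summable.hasSum (Summable.of_norm_bounded ((hs i).add (hs j)) fun k => ?_)
  rw [norm_mul, norm_mul, RCLike.norm_conj, Complex.norm_real, Real.norm_of_nonneg (h0 _)]
  nlinarith [mul_nonneg (h0 (f - w * k)) (sq_nonneg (‖H i (f - w * k)‖ - ‖H j (f - w * k)‖)),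
    mul_nonneg (h0 (f - w * k)) (sq_nonneg (‖H i (f - w * k)‖)),
    mul_nonneg (h0 (f - w * k)) (sq_nonneg (‖H j (f - w * k)‖))]

/-- The folded matrix is a weighted Gram matrix of the vectors `k ↦ H p (f - w k)`, so its form sums
the weighted power of the combined filter along the class. The positivity statements and
term-by-term comparisons below rest on this. -/
theorem hasSum_quadForm (h0 : ∀ f, 0 ≤ S f)
    (hs : ∀ p, Summable fun k : ℤ => S (f - w * k) * ‖H p (f - w * k)‖ ^ 2) (c : Fin P → ℂ) :
    HasSum (fun k : ℤ => ((S (f - w * k) * ‖∑ p, H p (f - w * k) * c p‖ ^ 2 : ℝ) : ℂ))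
      (star c ⬝ᵥ (foldedMatrix S w H f *ᵥ c)) := by
  have h : HasSum (fun k : ℤ => ∑ i, ∑ j, star (c i) *
      ((S (f - w * k) : ℂ) * conj (H i (f - w * k)) * H j (f - w * k) * c j))
      (∑ i, ∑ j, star (c i) * (foldedMatrix S w H f i j * c j)) :=
    hasSum_sum fun i _ => hasSum_sum fun j _ =>
      ((hasSum_foldedMatrix_apply h0 hs i j).mul_right (c j)).mul_left _
  have e : star c ⬝ᵥ (foldedMatrix S w H f *ᵥ c) =
      ∑ i, ∑ j, star (c i) * (foldedMatrix S w H f i j * c j) := by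
    simp only [dotProduct, mulVec, Finset.mul_sum, Pi.star_apply]
  rw [e]
  refine h.congr_fun fun k => ?_
  push_cast
  rw [← Complex.conj_mul', map_sum, Finset.sum_mul_sum, Finset.mul_sum]
  refine Finset.sum_congr rfl fun i _ => ?_
  rw [Finset.mul_sum]
  refine Finset.sum_congr rfl fun j _ => ?_
  rw [map_mul, Complex.star_def]
  ring

theorem hasSum_re_quadForm (h0 : ∀ f, 0 ≤ S f)
    (hs : ∀ p, Summable fun k : ℤ => S (f - w * k) * ‖H p (f - w * k)‖ ^ 2) (c : Fin P → ℂ) :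
    HasSum (fun k : ℤ => S (f - w * k) * ‖∑ p, H p (f - w * k) * c p‖ ^ 2)
      (star c ⬝ᵥ (foldedMatrix S w H f *ᵥ c)).re := by
  simpa only [Complex.ofReal_re] using Complex.hasSum_re (hasSum_quadForm h0 hs c)

theorem foldedMatrix_posSemidef (h0 : ∀ f, 0 ≤ S f)
    (hs : ∀ p, Summable fun k : ℤ => S (f - w * k) * ‖H p (f - w * k)‖ ^ 2) :
    (foldedMatrix S w H f).PosSemidef := by
  refine .of_dotProduct_mulVec_nonneg (foldedMatrix_isHermitian S w H f) fun c => ?_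
  have h := hasSum_quadForm h0 hs c
  exact h.nonneg fun k => by
    have := h0 (f - w * k)
    exact_mod_cast by positivity

end Folded

section Model

variable {SX Sη : ℝ → ℝ} {w : ℝ} {P : ℕ} {H : Fin P → ℝ → ℂ} {f : ℝ}

/-- The series over the frequencies congruent to `f` that define the folded matrices converge. -/
def FoldSummable (SX Sη : ℝ → ℝ) (w : ℝ) {P : ℕ} (H : Fin P → ℝ → ℂ) (f : ℝ) : Prop :=
  (Summable fun k : ℤ => SX (f - w * k)) ∧
    ∀ p, Summable fun k : ℤ => (SX (f - w * k) + Sη (f - w * k)) * ‖H p (f - w * k)‖ ^ 2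

theorem ae_foldSummable (hX : Integrable SX) (hH : Admissible SX Sη H) (hw : 0 < w) :
    ∀ᵐ f : ℝ, FoldSummable SX Sη w H f := by
  filter_upwards [ae_summable_shift hX hw, ae_all_iff.2 fun p => ae_summable_shift (hH p).2 hw]
    with f h1 h2 using ⟨h1, h2⟩

theorem FoldSummable.source (hf : FoldSummable SX Sη w H f) (hX : ∀ f, 0 ≤ SX f)
    (hη : ∀ f, 0 ≤ Sη f) (p : Fin P) :
    Summable fun k : ℤ => SX (f - w * k) * ‖H p (f - w * k)‖ ^ 2 :=
  (hf.2 p).of_nonneg_of_le (fun k => mul_nonneg (hX _) (by positivity)) fun k =>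
    mul_le_mul_of_nonneg_right (by linarith [hη (f - w * k)]) (by positivity)

/-- One factor `SX` is bounded by its sum over the class. -/
theorem FoldSummable.source_sq (hf : FoldSummable SX Sη w H f) (hX : ∀ f, 0 ≤ SX f)
    (hη : ∀ f, 0 ≤ Sη f) (p : Fin P) :
    Summable fun k : ℤ => SX (f - w * k) ^ 2 * ‖H p (f - w * k)‖ ^ 2 := by
  refine ((hf.source hX hη p).mul_left (∑' k : ℤ, SX (f - w * k))).of_nonneg_of_le
    (fun k => by positivity) fun k => ?_
  rw [sq, mul_assoc]
  exact mul_le_mul_of_nonneg_right (hf.1.le_tsum k fun l _ => hX _)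
    (mul_nonneg (hX _) (by positivity))

theorem matSY_posSemidef (hf : FoldSummable SX Sη w H f) (hX : ∀ f, 0 ≤ SX f)
    (hη : ∀ f, 0 ≤ Sη f) : (matSY SX Sη w H f).PosSemidef :=
  foldedMatrix_posSemidef (fun f => add_nonneg (hX f) (hη f)) hf.2

theorem snr_nonneg (hX : ∀ f, 0 ≤ SX f) (hη : ∀ f, 0 ≤ Sη f) (f : ℝ) : 0 ≤ snr SX Sη f :=
  div_nonneg (sq_nonneg _) (add_nonneg (hX f) (hη f))

/-- Where `SX + Sη` vanishes, so does `SX`; hence the identity survives division by zero and allows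
`K` and `S̃_Y` to be compared term by term. -/
theorem snr_mul (hX : ∀ f, 0 ≤ SX f) (hη : ∀ f, 0 ≤ Sη f) (f : ℝ) :
    snr SX Sη f * (SX f + Sη f) = SX f ^ 2 := by
  rw [snr]
  by_cases h : SX f + Sη f = 0
  · have : SX f = 0 := by linarith [hX f, hη f]
    simp [this]
  · rw [div_mul_cancel₀ _ h]

theorem snr_le (hX : ∀ f, 0 ≤ SX f) (hη : ∀ f, 0 ≤ Sη f) (f : ℝ) : snr SX Sη f ≤ SX f := by
  refine div_le_of_le_mul₀ (add_nonneg (hX f) (hη f)) (hX f) ?_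
  nlinarith [mul_nonneg (hX f) (hη f)]

theorem measurable_snr (hX : Measurable SX) (hη : Measurable Sη) : Measurable (snr SX Sη) :=
  (hX.pow_const 2).div (hX.add hη)

theorem integrable_snr (hXm : Measurable SX) (hηm : Measurable Sη) (hX : ∀ f, 0 ≤ SX f)
    (hη : ∀ f, 0 ≤ Sη f) (hi : Integrable SX) : Integrable (snr SX Sη) := by
  refine hi.mono' (measurable_snr hXm hηm).aestronglyMeasurable (Eventually.of_forall fun f => ?_)
  rw [Real.norm_of_nonneg (snr_nonneg hX hη f)]
  exact snr_le hX hη f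

/-! ### Bounds on the eigenvalues -/

theorem FoldSummable.snr (hf : FoldSummable SX Sη w H f) (hX : ∀ f, 0 ≤ SX f)
    (hη : ∀ f, 0 ≤ Sη f) : Summable fun k : ℤ => snr SX Sη (f - w * k) :=
  hf.1.of_nonneg_of_le (fun _ => snr_nonneg hX hη _) fun _ => snr_le hX hη _

/-- With `z = S̃_Y^{-1/2} c`, the form of `S̃_{X|Y}` at `c` is that of `K` at `z`. If the combined
filter of `z` vanishes on the earlier sets, each surviving term has `S ≤ J`, so the form is at most
`J z^* S̃_Y z ≤ J |c|²`. The index `i` starts at `0`, so there are exactly `i` earlier sets. -/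
theorem eigSXY_le_Jstar (hf : FoldSummable SX Sη w H f) (hX : ∀ f, 0 ≤ SX f)
    (hη : ∀ f, 0 ≤ Sη f) {F : Fin P → Set ℝ}
    (hF : ∀ q, ∀ k l : ℤ, f - w * k ∈ F q → f - w * l ∈ F q → k = l)
    (i : Fin (Fintype.card (Fin P))) :
    eigSXY SX Sη w H f i ≤ Jstar (snr SX Sη) w F (i.cast (Fintype.card_fin P)) f := by
  classical
  set p := i.cast (Fintype.card_fin P) with hp
  set A := matSY SX Sη w H f with hA
  have hApsd : A.PosSemidef := matSY_posSemidef hf hX hη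
  set R := invSqrt A with hR
  set J := Jstar (snr SX Sη) w F p f with hJ
  have hJ0 : 0 ≤ J := Jstar_nonneg (snr_nonneg hX hη) w F p f
  let emb : Fin p → Fin P := fun q => ⟨q, q.2.trans p.2⟩
  choose κ hκ using fun (q : Fin P) (h : ∃ k : ℤ, f - w * k ∈ F q) => h
  let ev : ℤ → (Fin P → ℂ) →ₗ[ℂ] ℂ := fun k =>
    (Fintype.linearCombination ℂ (fun r => H r (f - w * k))) ∘ₗ R.mulVecLin
  -- One condition per earlier set: the combined filter vanishes at the single point of the class in
  -- that set. A set that misses the class imposes nothing.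
  let L : (Fin P → ℂ) →ₗ[ℂ] (Fin p → ℂ) := LinearMap.pi fun q =>
    if h : ∃ k : ℤ, f - w * k ∈ F (emb q) then ev (κ _ h) else 0
  refine eigenvalues₀_le_of_forall (matSXY_isHermitian SX Sη w H f) i (τ := Fin p)
    (by simp [hp]) L fun c hc => ?_
  set z := R *ᵥ c with hz
  have hev : ∀ k, ev k c = ∑ r, H r (f - w * k) * z r := by
    intro k
    simp [ev, Fintype.linearCombination_apply, hz, mul_comm]
  have hzero : ∀ k : ℤ, f - w * k ∈ (⋃ q : Fin P, ⋃ _ : q < p, F q) →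
      ∑ r, H r (f - w * k) * z r = 0 := by
    intro k hk
    obtain ⟨q, hq, hkq⟩ := Set.mem_iUnion₂.1 hk
    have h1 := congrFun hc ⟨q, hq⟩
    have hex : ∃ k : ℤ, f - w * k ∈ F (emb ⟨q, hq⟩) := ⟨k, hkq⟩
    simp only [L, LinearMap.pi_apply, dif_pos hex] at h1
    rw [hF q _ _ (hκ _ hex) hkq, hev] at h1
    exact h1
  have e : star c ⬝ᵥ (matSXY SX Sη w H f *ᵥ c) = star z ⬝ᵥ (matK SX w H f *ᵥ z) := by
    rw [matSXY, ← hA, ← hR, invSqrt_conjTranspose, ← mulVec_mulVec, ← mulVec_mulVec, hz,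
      star_mulVec_dotProduct (invSqrt_isHermitian A)]
  rw [e]
  have hK := hasSum_re_quadForm (S := fun f => SX f ^ 2) (fun f => sq_nonneg _)
    (hf.source_sq hX hη) z
  have hY := (hasSum_re_quadForm (S := fun f => SX f + Sη f)
    (fun f => add_nonneg (hX f) (hη f)) hf.2 z).mul_left J
  have hle : (star z ⬝ᵥ (matK SX w H f *ᵥ z)).re ≤ J * (star z ⬝ᵥ (A *ᵥ z)).re := by
    refine hasSum_le (fun k => ?_) hK hY
    by_cases hk : f - w * k ∈ (⋃ q : Fin P, ⋃ _ : q < p, F q)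
    · rw [hzero k hk]; simp
    · rw [← mul_assoc, ← snr_mul hX hη]
      refine mul_le_mul_of_nonneg_right (mul_le_mul_of_nonneg_right ?_
        (add_nonneg (hX _) (hη _))) (by positivity)
      have hb := bddAbove_Jstar (snr_nonneg hX hη) (hf.snr hX hη)
        (⋃ q : Fin P, ⋃ _ : q < p, F q)ᶜ
      refine le_trans (le_of_eq ?_) (le_ciSup hb k)
      rw [mul_comm (k : ℝ) w, Set.indicator_of_mem (Set.mem_compl hk)]
  exact hle.trans (mul_le_mul_of_nonneg_left (re_invSqrt_quadForm_le hApsd c) hJ0)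

theorem sum_eigSXY (SX Sη : ℝ → ℝ) (w : ℝ) {P : ℕ} (H : Fin P → ℝ → ℂ) (f : ℝ) :
    ∑ i, eigSXY SX Sη w H f i = traceSXY SX Sη w H f :=
  sum_eigenvalues₀ (matSXY_isHermitian SX Sη w H f)

/-! ### The bank of indicators -/

theorem foldedMatrix_indicatorBank {S : ℝ → ℝ} {F : Fin P → Set ℝ}
    (hd : ∀ p q, p ≠ q → ∀ k : ℤ, f - w * k ∈ F p → f - w * k ∉ F q) :
    foldedMatrix S w (indicatorBank F) f =
      Matrix.diagonal fun p => ((∑' k : ℤ, (F p).indicator S (f - w * k) : ℝ) : ℂ) := by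
  ext i j
  rw [foldedMatrix, Matrix.of_apply]
  by_cases hij : i = j
  · subst hij
    rw [Matrix.diagonal_apply_eq, Complex.ofReal_tsum]
    refine tsum_congr fun k => ?_
    by_cases hk : f - w * k ∈ F i <;> simp [indicatorBank, hk]
  · rw [Matrix.diagonal_apply_ne _ hij]
    refine (tsum_congr fun k => ?_).trans tsum_zero
    by_cases hk : f - w * k ∈ F i
    · simp [indicatorBank, hd i j hij k hk]
    · simp [indicatorBank, hk]

theorem tsum_indicator_eq {S : ℝ → ℝ} {G : Set ℝ}
    (hG : ∀ k l : ℤ, f - w * k ∈ G → f - w * l ∈ G → k = l) {k : ℤ} (hk : f - w * k ∈ G) :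
    ∑' l : ℤ, G.indicator S (f - w * l) = S (f - w * k) := by
  rw [tsum_eq_single k fun l hl => Set.indicator_of_notMem (fun h => hl (hG _ _ h hk)) _,
    Set.indicator_of_mem hk]

theorem foldSummable_indicatorBank (hs : Summable fun k : ℤ => SX (f - w * k))
    {F : Fin P → Set ℝ} (hF : ∀ q, ∀ k l : ℤ, f - w * k ∈ F q → f - w * l ∈ F q → k = l) :
    FoldSummable SX Sη w (indicatorBank F) f := by
  refine ⟨hs, fun p => ?_⟩
  by_cases h : ∃ k : ℤ, f - w * k ∈ F p
  · obtain ⟨k, hk⟩ := h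
    refine (hasSum_single k fun l hl => ?_).summable
    simp [indicatorBank, Set.indicator_of_notMem fun h => hl (hF p l k h hk)]
  · push Not at h
    simp [indicatorBank, h, summable_zero]

/-- Cyclicity reduces the trace to `Tr (K Q)` with `Q` the square of `invSqrt`. As `K` is diagonal,
only the diagonal of `Q` enters, and it is read off from `A Q A = A` with `A` diagonal; where an
entry of `A` vanishes, so does that of `K`. -/
theorem traceSXY_indicatorBank (hX : ∀ f, 0 ≤ SX f) (hη : ∀ f, 0 ≤ Sη f) {F : Fin P → Set ℝ}
    (hs : Summable fun k : ℤ => SX (f - w * k))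
    (hF : ∀ q, ∀ k l : ℤ, f - w * k ∈ F q → f - w * l ∈ F q → k = l)
    (hd : ∀ p q, p ≠ q → ∀ k : ℤ, f - w * k ∈ F p → f - w * k ∉ F q) :
    traceSXY SX Sη w (indicatorBank F) f =
      ∑ p, ∑' k : ℤ, (F p).indicator (snr SX Sη) (f - w * k) := by
  have hpsd := matSY_posSemidef (foldSummable_indicatorBank (Sη := Sη) hs hF) hX hη
  have hA := foldedMatrix_indicatorBank (S := fun f => SX f + Sη f) hd
  have hK := foldedMatrix_indicatorBank (S := fun f => SX f ^ 2) hd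
  have hARRA := mul_invSqrt_sq_mul hpsd
  rw [traceSXY, matSXY, invSqrt_conjTranspose, Matrix.trace_mul_comm, ← mul_assoc,
    Matrix.trace_mul_comm, matK, hK, Matrix.trace, Complex.re_sum]
  refine Finset.sum_congr rfl fun p _ => ?_
  rw [Matrix.diag_apply, Matrix.diagonal_mul]
  have h1 := congrFun (congrFun hARRA p) p
  rw [mul_assoc (matSY SX Sη w (indicatorBank F) f)] at h1
  nth_rewrite 1 [matSY] at h1
  rw [hA] at h1
  set Q := invSqrt (matSY SX Sη w (indicatorBank F) f) * invSqrt (matSY SX Sη w (indicatorBank F) f)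
  by_cases h : ∃ k : ℤ, f - w * k ∈ F p
  · obtain ⟨k, hk⟩ := h
    rw [tsum_indicator_eq (hF p) hk, tsum_indicator_eq (hF p) hk]
    have h2 : matSY SX Sη w (indicatorBank F) f = _ := hA
    rw [h2, Matrix.mul_diagonal, Matrix.diagonal_mul, Matrix.diagonal_apply_eq,
      tsum_indicator_eq (hF p) hk] at h1
    by_cases hN : SX (f - w * k) + Sη (f - w * k) = 0
    · have : SX (f - w * k) = 0 := by linarith [hX (f - w * k), hη (f - w * k)]
      simp [this, snr]
    · have hN' : ((SX (f - w * k) + Sη (f - w * k) : ℝ) : ℂ) ≠ 0 := by exact_mod_cast hN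
      have h3 : ((SX (f - w * k) + Sη (f - w * k) : ℝ) : ℂ) * Q p p = 1 :=
        mul_right_cancel₀ hN' (by rw [h1, one_mul])
      have h4 : ((SX (f - w * k) ^ 2 : ℝ) : ℂ) * Q p p = (snr SX Sη (f - w * k) : ℂ) := by
        rw [← snr_mul hX hη, Complex.ofReal_mul, mul_assoc, h3, mul_one]
      rw [h4, Complex.ofReal_re]
  · push Not at h
    simp [h]

end Model

end

end FilterBank

namespace FilterBank

noncomputable section

/-! ### Optimality of successive maximal sets -/

section Optimality

variable {SX Sη : ℝ → ℝ} {w : ℝ} {P : ℕ} {F : Fin P → Set ℝ}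

theorem SuccessiveMaximal.ae_subsingleton {S : ℝ → ℝ} (hF : SuccessiveMaximal S w F)
    (hw : w ≠ 0) : ∀ᵐ f : ℝ, ∀ q, ∀ k l : ℤ, f - w * k ∈ F q → f - w * l ∈ F q → k = l :=
  ae_all_iff.2 fun q => (hF.aliasingFree q).ae_subsingleton hw

theorem SuccessiveMaximal.ae_disjoint {S : ℝ → ℝ} (hF : SuccessiveMaximal S w F) :
    ∀ᵐ f : ℝ, ∀ p q, p ≠ q → ∀ k : ℤ, f - w * k ∈ F p → f - w * k ∉ F q := by
  have : ∀ᵐ f : ℝ, ∀ p q, p ≠ q → f ∈ F p → f ∉ F q := by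
    refine ae_all_iff.2 fun p => ae_all_iff.2 fun q => ?_
    by_cases hpq : p = q
    · exact Eventually.of_forall fun f h => absurd hpq h
    · filter_upwards [measure_eq_zero_iff_ae_notMem.1 (hF.disjoint p q hpq)] with f hf _ h1 h2
      exact hf ⟨h1, h2⟩
  filter_upwards [ae_forall_shift this w] with f hf p q hpq k using hf k p q hpq

theorem ae_traceSXY_indicatorBank (hXm : Measurable SX) (hηm : Measurable Sη)
    (hX : ∀ f, 0 ≤ SX f) (hη : ∀ f, 0 ≤ Sη f) (hi : Integrable SX) (hw : 0 < w)
    (hF : SuccessiveMaximal (snr SX Sη) w F) :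
    ∀ᵐ f : ℝ, traceSXY SX Sη w (indicatorBank F) f = ∑ p, Jstar (snr SX Sη) w F p f := by
  filter_upwards [hF.ae_subsingleton hw.ne', hF.ae_disjoint, ae_summable_shift hi hw,
    ae_all_iff.2 fun p => (ae_tsum_indicator_eq_Jstar (measurable_snr hXm hηm) (snr_nonneg hX hη)
      (integrable_snr hXm hηm hX hη hi) hw hF p).2] with f h1 h2 h3 h4
  rw [traceSXY_indicatorBank hX hη h3 h1 h2]
  exact Finset.sum_congr rfl fun p _ => h4 p

/-- No diagonalization is needed: each eigenvalue is at most its `Jstar`, and the two families have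
the same sum, the trace. -/
theorem ae_eigSXY_indicatorBank (hXm : Measurable SX) (hηm : Measurable Sη)
    (hX : ∀ f, 0 ≤ SX f) (hη : ∀ f, 0 ≤ Sη f) (hi : Integrable SX) (hw : 0 < w)
    (hF : SuccessiveMaximal (snr SX Sη) w F) :
    ∀ᵐ f : ℝ, ∀ i, eigSXY SX Sη w (indicatorBank F) f i =
      Jstar (snr SX Sη) w F (i.cast (Fintype.card_fin P)) f := by
  filter_upwards [hF.ae_subsingleton hw.ne', ae_summable_shift hi hw,
    ae_traceSXY_indicatorBank hXm hηm hX hη hi hw hF] with f h1 h2 h3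
  have hle := eigSXY_le_Jstar (foldSummable_indicatorBank (Sη := Sη) h2 h1) hX hη h1
  rw [← sum_eigSXY, ← (finCongr (Fintype.card_fin P)).sum_comp] at h3
  intro i
  exact (Finset.sum_eq_sum_iff_of_le fun i _ => hle i).1 h3 i (Finset.mem_univ i)

theorem ae_eigSXY_le (hXm : Measurable SX) (hηm : Measurable Sη)
    (hX : ∀ f, 0 ≤ SX f) (hη : ∀ f, 0 ≤ Sη f) (hi : Integrable SX) (hw : 0 < w)
    (hF : SuccessiveMaximal (snr SX Sη) w F) {H : Fin P → ℝ → ℂ} (hH : Admissible SX Sη H) :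
    ∀ᵐ f : ℝ, ∀ i, eigSXY SX Sη w H f i ≤ eigSXY SX Sη w (indicatorBank F) f i := by
  filter_upwards [hF.ae_subsingleton hw.ne', ae_foldSummable hi hH hw,
    ae_eigSXY_indicatorBank hXm hηm hX hη hi hw hF] with f h1 h2 h3 i
  rw [h3]
  exact eigSXY_le_Jstar h2 hX hη h1 i

theorem ae_traceSXY_le (hXm : Measurable SX) (hηm : Measurable Sη)
    (hX : ∀ f, 0 ≤ SX f) (hη : ∀ f, 0 ≤ Sη f) (hi : Integrable SX) (hw : 0 < w)
    (hF : SuccessiveMaximal (snr SX Sη) w F) {H : Fin P → ℝ → ℂ} (hH : Admissible SX Sη H) :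
    ∀ᵐ f : ℝ, traceSXY SX Sη w H f ≤ traceSXY SX Sη w (indicatorBank F) f := by
  filter_upwards [ae_eigSXY_le hXm hηm hX hη hi hw hF hH] with f h
  rw [← sum_eigSXY, ← sum_eigSXY]
  exact Finset.sum_le_sum fun i _ => h i

theorem integral_traceSXY_indicatorBank (hXm : Measurable SX) (hηm : Measurable Sη)
    (hX : ∀ f, 0 ≤ SX f) (hη : ∀ f, 0 ≤ Sη f) (hi : Integrable SX) (hw : 0 < w)
    (hF : SuccessiveMaximal (snr SX Sη) w F) :
    IntervalIntegrable (traceSXY SX Sη w (indicatorBank F)) volume (-(w / 2)) (w / 2) ∧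
    ∫ f in (-(w / 2))..(w / 2), traceSXY SX Sη w (indicatorBank F) f =
      ∑ p, ∫ f in (-(w / 2))..(w / 2), Jstar (snr SX Sη) w F p f := by
  have hJ := fun p => (ae_tsum_indicator_eq_Jstar (measurable_snr hXm hηm) (snr_nonneg hX hη)
      (integrable_snr hXm hηm hX hη hi) hw hF p).1
  have hae := ae_traceSXY_indicatorBank hXm hηm hX hη hi hw hF
  constructor
  · have hs : IntervalIntegrable (fun f => ∑ p, Jstar (snr SX Sη) w F p f) volume
        (-(w / 2)) (w / 2) := by
      have := IntervalIntegrable.sum Finset.univ fun p (_ : p ∈ Finset.univ) => hJ p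
      rwa [Finset.sum_fn] at this
    exact hs.congr_ae (ae_restrict_of_ae (hae.mono fun f hf => hf.symm))
  · rw [← intervalIntegral.integral_finsetSum fun p _ => hJ p]
    exact intervalIntegral.integral_congr_ae (hae.mono fun f hf _ => hf)

end Optimality

end

end FilterBank

namespace FilterBank

noncomputable section

open Matrix
open scoped ComplexOrder

/-! ### The error of a linear estimator in the spectral domain -/

/-- The complex exponential `e^{2 π i f t}`. -/
def wave (t f : ℝ) : ℂ := Complex.exp (2 * Real.pi * Complex.I * f * t)

theorem wave_eq (t f : ℝ) : wave t f = Complex.exp ((2 * Real.pi * f * t : ℝ) * Complex.I) := by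
  rw [wave]; congr 1; push_cast; ring

@[simp]
theorem norm_wave (t f : ℝ) : ‖wave t f‖ = 1 := by
  rw [wave_eq, Complex.norm_exp_ofReal_mul_I]

theorem wave_add (s t f : ℝ) : wave (s + t) f = wave s f * wave t f := by
  simp only [wave, ← Complex.exp_add]; congr 1; push_cast; ring

theorem wave_sub_freq (t f g : ℝ) : wave t (f - g) = wave t f * conj (wave t g) := by
  rw [wave_eq, wave_eq, wave_eq, ← Complex.exp_conj, ← Complex.exp_add]
  congr 1
  simp only [map_mul, Complex.conj_ofReal, Complex.conj_I]
  push_cast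
  ring

theorem wave_div_mul_int {w : ℝ} (hw : w ≠ 0) (n k : ℤ) : wave (n / w) (w * k) = 1 := by
  rw [wave, Complex.exp_eq_one_iff]
  refine ⟨n * k, ?_⟩
  have : (w : ℂ) ≠ 0 := by exact_mod_cast hw
  push_cast
  field_simp

/-- Aliasing: at sampling instants the exponentials of `f` and `f - w k` coincide. -/
theorem wave_sample_sub {w : ℝ} (hw : w ≠ 0) (n k : ℤ) (f : ℝ) :
    wave (n / w) (f - w * k) = wave (n / w) f := by
  rw [wave_sub_freq, wave_div_mul_int hw, map_one, mul_one]

@[fun_prop]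
theorem continuous_wave : Continuous fun x : ℝ × ℝ => wave x.1 x.2 := by
  unfold wave; fun_prop

theorem measurable_wave (t : ℝ) : Measurable (wave t) :=
  (continuous_wave.comp (by fun_prop : Continuous fun f : ℝ => (t, f))).measurable

section Spectral

variable {SX Sη : ℝ → ℝ} {w : ℝ} {P : ℕ} {H : Fin P → ℝ → ℂ} {f t : ℝ}

/-- The folded cross spectrum of the source at time `t` and the filter outputs. -/
def crossVec (SX : ℝ → ℝ) (w : ℝ) {P : ℕ} (H : Fin P → ℝ → ℂ) (t f : ℝ) : Fin P → ℂ :=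
  fun p => ∑' k : ℤ, (SX (f - w * k) : ℂ) * conj (H p (f - w * k)) * wave t (f - w * k)

/-- The mean square error in estimating the source at time `t` by the filter with frequency
response `g`, applied to source plus noise. -/
def spectralError (SX Sη : ℝ → ℝ) (t : ℝ) (g : ℝ → ℂ) : ℝ :=
  ∫ f, (SX f * ‖wave t f - g f‖ ^ 2 + Sη f * ‖g f‖ ^ 2)

theorem FoldSummable.norm_source (hf : FoldSummable SX Sη w H f) (hX : ∀ f, 0 ≤ SX f)
    (hη : ∀ f, 0 ≤ Sη f) (p : Fin P) :
    Summable fun k : ℤ => SX (f - w * k) * ‖H p (f - w * k)‖ := by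
  refine (hf.1.add (hf.source hX hη p)).of_nonneg_of_le
    (fun k => mul_nonneg (hX _) (norm_nonneg _)) fun k => ?_
  nlinarith [hX (f - w * k), mul_nonneg (hX (f - w * k)) (sq_nonneg (‖H p (f - w * k)‖ - 1)),
    mul_nonneg (hX (f - w * k)) (sq_nonneg (‖H p (f - w * k)‖))]

theorem FoldSummable.hasSum_crossVec (hf : FoldSummable SX Sη w H f) (hX : ∀ f, 0 ≤ SX f)
    (hη : ∀ f, 0 ≤ Sη f) (t : ℝ) (p : Fin P) :
    HasSum (fun k : ℤ => (SX (f - w * k) : ℂ) * conj (H p (f - w * k)) * wave t (f - w * k))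
      (crossVec SX w H t f p) := by
  refine Summable.hasSum (Summable.of_norm_bounded (hf.norm_source hX hη p) fun k => ?_)
  rw [norm_mul, norm_mul, RCLike.norm_conj, Complex.norm_real, Real.norm_of_nonneg (hX _),
    norm_wave, mul_one]

theorem FoldSummable.hasSum_star_dotProduct_crossVec (hf : FoldSummable SX Sη w H f)
    (hX : ∀ f, 0 ≤ SX f) (hη : ∀ f, 0 ≤ Sη f) (t : ℝ) (c : Fin P → ℂ) :
    HasSum (fun k : ℤ => (SX (f - w * k) : ℂ) * conj (∑ p, H p (f - w * k) * c p) *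
      wave t (f - w * k)) (star c ⬝ᵥ crossVec SX w H t f) := by
  have h : HasSum (fun k : ℤ => ∑ p, star (c p) *
      ((SX (f - w * k) : ℂ) * conj (H p (f - w * k)) * wave t (f - w * k)))
      (∑ p, star (c p) * crossVec SX w H t f p) :=
    hasSum_sum fun p _ => (hf.hasSum_crossVec hX hη t p).mul_left _
  refine h.congr_fun fun k => ?_
  rw [map_sum, Finset.mul_sum, Finset.sum_mul]
  refine Finset.sum_congr rfl fun p _ => ?_
  rw [map_mul, Complex.star_def]
  ring

/-- If `A v = 0`, every nonnegative term of `v^* A v` vanishes, so along the class either `SX` or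
the combined filter of `v` is zero, which kills each term of the cross product. Thus the cross
spectrum lies in the range of `A`, as the Moore–Penrose minimum requires. -/
theorem FoldSummable.dotProduct_crossVec_eq_zero (hf : FoldSummable SX Sη w H f)
    (hX : ∀ f, 0 ≤ SX f) (hη : ∀ f, 0 ≤ Sη f) (t : ℝ) (v : Fin P → ℂ)
    (hv : matSY SX Sη w H f *ᵥ v = 0) : star v ⬝ᵥ crossVec SX w H t f = 0 := by
  have h := hasSum_re_quadForm (fun f => add_nonneg (hX f) (hη f)) hf.2 v
  change HasSum _ (star v ⬝ᵥ (matSY SX Sη w H f *ᵥ v)).re at h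
  rw [hv, dotProduct_zero, Complex.zero_re] at h
  have h0 := (hasSum_zero_iff_of_nonneg fun k => mul_nonneg
    (add_nonneg (hX (f - w * (k : ℤ))) (hη (f - w * k)))
      (sq_nonneg ‖∑ p, H p (f - w * k) * v p‖)).1 h
  refine (hf.hasSum_star_dotProduct_crossVec hX hη t v).unique ?_
  refine hasSum_zero.congr_fun fun k => ?_
  have hk := congrFun h0 k
  rcases mul_eq_zero.1 hk with h1 | h1
  · have : SX (f - w * k) = 0 := by linarith [hX (f - w * k), hη (f - w * k)]
    simp [this]
  · have : ∑ p, H p (f - w * k) * v p = 0 := by simpa using h1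
    simp [this]

theorem norm_sub_sq_eq (z u : ℂ) :
    ‖z - u‖ ^ 2 = ‖z‖ ^ 2 - 2 * (conj u * z).re + ‖u‖ ^ 2 := by
  rw [← Complex.normSq_eq_norm_sq, ← Complex.normSq_eq_norm_sq, ← Complex.normSq_eq_norm_sq,
    Complex.normSq_sub, mul_comm z]
  ring

theorem FoldSummable.hasSum_error (hf : FoldSummable SX Sη w H f)
    (hX : ∀ f, 0 ≤ SX f) (hη : ∀ f, 0 ≤ Sη f) (t : ℝ) (c : Fin P → ℂ) :
    HasSum (fun k : ℤ => SX (f - w * k) * ‖wave t (f - w * k) - ∑ p, H p (f - w * k) * c p‖ ^ 2 +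
        Sη (f - w * k) * ‖∑ p, H p (f - w * k) * c p‖ ^ 2)
      ((∑' k : ℤ, SX (f - w * k)) + quadValue (matSY SX Sη w H f) (crossVec SX w H t f) c) := by
  have h1 := hasSum_re_quadForm (fun f => add_nonneg (hX f) (hη f)) hf.2 c
  have h2 := Complex.hasSum_re (hf.hasSum_star_dotProduct_crossVec hX hη t c)
  have h3 := hf.1.hasSum.add (h1.sub (h2.mul_left 2))
  refine h3.congr_fun fun k => ?_
  rw [norm_sub_sq_eq, norm_wave, mul_assoc (SX (f - w * k) : ℂ), Complex.re_ofReal_mul]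
  ring

/-- The error of the minimizer, source power minus energy, is a sum of nonnegative terms. The bound
is uniform in `t` and integrable over a period. -/
theorem FoldSummable.energy_le (hf : FoldSummable SX Sη w H f)
    (hX : ∀ f, 0 ≤ SX f) (hη : ∀ f, 0 ≤ Sη f) (t : ℝ) :
    energy (matSY SX Sη w H f) (crossVec SX w H t f) ≤ ∑' k : ℤ, SX (f - w * k) := by
  have hA := matSY_posSemidef hf hX hη
  have hy := mulVec_invSqrt_invSqrt hA (hf.dotProduct_crossVec_eq_zero hX hη t)
  set y := invSqrt (matSY SX Sη w H f) *ᵥ (invSqrt (matSY SX Sη w H f) *ᵥ crossVec SX w H t f)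
  have h1 := (hf.hasSum_error hX hη t y).nonneg fun k => add_nonneg
    (mul_nonneg (hX _) (sq_nonneg _)) (mul_nonneg (hη _) (sq_nonneg _))
  have h2 := quadValue_add_energy hA hy y
  rw [sub_self, mulVec_zero, dotProduct_zero, Complex.zero_re] at h2
  linarith

/-! ### Measurability -/

theorem measurable_matSY (hXm : Measurable SX) (hηm : Measurable Sη)
    (hH : ∀ p, Measurable (H p)) (i j : Fin P) :
    Measurable fun f => matSY SX Sη w H f i j := by
  refine Measurable.tsum fun k => ?_
  have hs : Measurable fun f : ℝ => f - w * k := by fun_prop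
  exact ((Complex.measurable_ofReal.comp ((hXm.add hηm).comp hs)).mul
    (Complex.continuous_conj.measurable.comp ((hH i).comp hs))).mul ((hH j).comp hs)

theorem measurable_crossVec (hXm : Measurable SX) (hH : ∀ p, Measurable (H p)) (p : Fin P) :
    Measurable fun x : ℝ × ℝ => crossVec SX w H x.1 x.2 p := by
  refine Measurable.tsum fun k => ?_
  have hs : Measurable fun x : ℝ × ℝ => x.2 - w * k := by fun_prop
  refine ((Complex.measurable_ofReal.comp (hXm.comp hs)).mul
    (Complex.continuous_conj.measurable.comp ((hH p).comp hs))).mul ?_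
  exact (continuous_wave.comp
    (by fun_prop : Continuous fun x : ℝ × ℝ => (x.1, x.2 - w * k))).measurable

/-- Cramer's rule: adjugate divided by determinant, with value `0` for singular matrices on both
sides. -/
theorem measurable_matrix_inv {α : Type*} [MeasurableSpace α] {B : α → Matrix (Fin P) (Fin P) ℂ}
    (hB : ∀ i j, Measurable fun x => B x i j) (i j : Fin P) :
    Measurable fun x => (B x)⁻¹ i j := by
  have hm : Measurable fun x => (fun i j => B x i j : Fin P → Fin P → ℂ) :=
    measurable_pi_iff.2 fun i => measurable_pi_iff.2 fun j => hB i j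
  have hof : Continuous fun M : Fin P → Fin P → ℂ => (Matrix.of M) := continuous_id
  have hdet : Continuous fun M : Fin P → Fin P → ℂ => (Matrix.of M).det := hof.matrix_det
  have hadj : Continuous fun M : Fin P → Fin P → ℂ => (Matrix.of M).adjugate i j :=
    (hof.matrix_adjugate).matrix_elem i j
  have h := ((hdet.measurable.comp hm).inv).mul (hadj.measurable.comp hm)
  refine (congrArg Measurable (funext fun x => ?_)).mpr h
  rw [Matrix.inv_def, Matrix.smul_apply, Ring.inverse_eq_inv', smul_eq_mul]
  rfl

theorem measurable_ridge {α : Type*} [MeasurableSpace α] {B : α → Matrix (Fin P) (Fin P) ℂ}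
    {b : α → Fin P → ℂ} (hB : ∀ i j, Measurable fun x => B x i j)
    (hb : ∀ i, Measurable fun x => b x i) (ε : ℝ) (p : Fin P) :
    Measurable fun x => ridge (B x) ε (b x) p := by
  simp only [ridge, mulVec, dotProduct]
  refine Finset.measurable_sum _ fun j _ => (measurable_matrix_inv (fun i j => ?_) p j).mul (hb j)
  exact (hB i j).add_const _

theorem measurable_truncRidge {α : Type*} [MeasurableSpace α] {B : α → Matrix (Fin P) (Fin P) ℂ}
    {b : α → Fin P → ℂ} (hB : ∀ i j, Measurable fun x => B x i j)
    (hb : ∀ i, Measurable fun x => b x i) (n : ℕ) (p : Fin P) :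
    Measurable fun x => truncRidge (B x) (b x) n p := by
  have hr := measurable_ridge hB hb (1 / (n + 1))
  have hs : MeasurableSet {x | ∑ p, ‖ridge (B x) (1 / (n + 1)) (b x) p‖ ^ 2 ≤ n} :=
    measurableSet_le (Finset.measurable_sum _ fun p _ => (hr p).norm.pow_const 2) measurable_const
  have e : (fun x => truncRidge (B x) (b x) n p) = fun x =>
      if ∑ p, ‖ridge (B x) (1 / (n + 1)) (b x) p‖ ^ 2 ≤ n then ridge (B x) (1 / (n + 1)) (b x) p
        else 0 := by
    funext x
    simp only [truncRidge]
    split_ifs <;> rfl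
  rw [e]
  exact Measurable.ite hs (hr p) measurable_const

theorem measurable_quadValue {α : Type*} [MeasurableSpace α] {B : α → Matrix (Fin P) (Fin P) ℂ}
    {b c : α → Fin P → ℂ} (hB : ∀ i j, Measurable fun x => B x i j)
    (hb : ∀ i, Measurable fun x => b x i) (hc : ∀ i, Measurable fun x => c x i) :
    Measurable fun x => quadValue (B x) (b x) (c x) := by
  have hs : ∀ i, Measurable fun x => star (c x i) := fun i =>
    Complex.continuous_conj.measurable.comp (hc i)
  simp only [quadValue, dotProduct, mulVec, Pi.star_apply]
  refine (Complex.measurable_re.comp (Finset.measurable_sum _ fun i _ => (hs i).mul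
    (Finset.measurable_sum _ fun j _ => (hB i j).mul (hc j)))).sub (measurable_const.mul
    (Complex.measurable_re.comp (Finset.measurable_sum _ fun i _ => (hs i).mul (hb i))))

/-- Measurability of `invSqrt` in the frequency is never used: the energy is almost everywhere a
limit of values of the quadratic functional at truncated ridge solutions, which are built from
ordinary matrix inverses. -/
theorem aemeasurable_energy (hXm : Measurable SX) (hηm : Measurable Sη)
    (hX : ∀ f, 0 ≤ SX f) (hη : ∀ f, 0 ≤ Sη f) (hi : Integrable SX) (hw : 0 < w)
    (hH : Admissible SX Sη H) :
    AEMeasurable (fun x : ℝ × ℝ => energy (matSY SX Sη w H x.2) (crossVec SX w H x.1 x.2))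
      (volume.prod volume) := by
  have hA : ∀ i j, Measurable fun x : ℝ × ℝ => matSY SX Sη w H x.2 i j := fun i j =>
    (measurable_matSY hXm hηm (fun p => (hH p).1) i j).comp measurable_snd
  have hb := fun p => measurable_crossVec (w := w) hXm (fun p => (hH p).1) p
  have hq : ∀ n : ℕ, AEMeasurable (fun x : ℝ × ℝ => -quadValue (matSY SX Sη w H x.2)
      (crossVec SX w H x.1 x.2) (truncRidge (matSY SX Sη w H x.2) (crossVec SX w H x.1 x.2) n))
      (volume.prod volume) := fun n =>
    (measurable_quadValue hA hb fun p => measurable_truncRidge hA hb n p).neg.aemeasurable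
  refine aemeasurable_of_tendsto_metrizable_ae atTop hq ?_
  filter_upwards [Measure.quasiMeasurePreserving_snd.ae (ae_foldSummable hi hH hw)] with x hx
  simpa using (tendsto_quadValue_truncRidge (matSY_posSemidef hx hX hη)
    (hx.dotProduct_crossVec_eq_zero hX hη x.1)).neg

end Spectral

end

end FilterBank

namespace FilterBank

noncomputable section

open Matrix
open scoped ComplexOrder

/-! ### Density of trigonometric polynomials -/

/-- On the circle, with the image of `ρ`, a bounded function is approximated in `L²` by a continuous
one, and that one uniformly by Fourier polynomials; finiteness of the measure turns the uniform
bound into an `L²` bound. -/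
theorem exists_trigPoly_integral_le {w : ℝ} (hw : 0 < w) {ρ : Measure ℝ} [IsFiniteMeasure ρ]
    {φ : ℝ → ℂ} (hφ : Measurable φ) (hper : Function.Periodic φ w) {B : ℝ}
    (hB : ∀ f, ‖φ f‖ ≤ B) {ε : ℝ} (hε : 0 < ε) :
    ∃ q : ℤ →₀ ℂ, ∫ f, ‖φ f - q.sum fun n a => a * wave (n / w) f‖ ^ 2 ∂ρ ≤ ε := by
  have : Fact (0 < w) := ⟨hw⟩
  have hπ : Measurable fun x : ℝ => (x : AddCircle w) := AddCircle.measurable_mk'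
  set ρ' := ρ.map fun x : ℝ => (x : AddCircle w) with hρ'
  have hfin : IsFiniteMeasure ρ' := Measure.isFiniteMeasure_map _ _
  set φ' : AddCircle w → ℂ := fun x => φ (AddCircle.measurableEquivIoc w 0 x : ℝ) with hφ'
  have hφ'm : Measurable φ' :=
    hφ.comp (measurable_subtype_coe.comp (AddCircle.measurableEquivIoc w 0).measurable)
  have hlift : ∀ x : ℝ, φ' (x : AddCircle w) = φ x := by
    intro x
    have h1 : ((AddCircle.measurableEquivIoc w 0 (x : AddCircle w) : ℝ) : AddCircle w) = x :=
      (AddCircle.measurableEquivIoc w 0).symm_apply_apply (x : AddCircle w)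
    have h2 : hper.lift ((AddCircle.measurableEquivIoc w 0 (x : AddCircle w) : ℝ) : AddCircle w) =
      hper.lift (x : AddCircle w) := by rw [h1]
    rwa [Function.Periodic.lift_coe, Function.Periodic.lift_coe] at h2
  have hmem : MemLp φ' (ENNReal.ofReal 2) ρ' :=
    MemLp.of_bound hφ'm.aestronglyMeasurable B (Eventually.of_forall fun x => hB _)
  obtain ⟨g, hg, hgm⟩ := hmem.exists_boundedContinuous_integral_rpow_sub_le (by norm_num)
    (show 0 < ε / 4 by positivity)
  set M := ρ'.real Set.univ with hM
  have hM0 : 0 ≤ M := measureReal_nonneg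
  -- Each approximation may cost `ε / 2`: twice `ε / 4` for the continuous function, and `2 δ² M ≤ ε
  -- / 2` for the polynomial. `M + 1` guards against a zero measure.
  set δ := √(ε / (4 * (M + 1))) with hδ
  have hδ0 : 0 < δ := Real.sqrt_pos.2 (by positivity)
  have hδ2 : δ ^ 2 = ε / (4 * (M + 1)) := Real.sq_sqrt (by positivity)
  obtain ⟨h, hh, hdist⟩ : ∃ h ∈ (Submodule.span ℂ (Set.range (@fourier w)) :
      Set C(AddCircle w, ℂ)), dist g.toContinuousMap h < δ := by
    refine Metric.mem_closure_iff.1 ?_ δ hδ0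
    rw [← Submodule.topologicalClosure_coe, span_fourier_closure_eq_top]
    trivial
  obtain ⟨q, hq⟩ := Finsupp.mem_span_range_iff_exists_finsupp.1 hh
  refine ⟨q, ?_⟩
  have hqx : ∀ x : ℝ, q.sum (fun n a => a * wave (n / w) x) = h (x : AddCircle w) := by
    intro x
    rw [← hq, Finsupp.sum, Finsupp.sum, ContinuousMap.sum_apply]
    refine Finset.sum_congr rfl fun n _ => ?_
    rw [ContinuousMap.smul_apply, fourier_coe_apply, smul_eq_mul, wave]
    congr 2
    push_cast
    ring
  have e1 : ∫ f, ‖φ f - q.sum fun n a => a * wave (n / w) f‖ ^ 2 ∂ρ =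
      ∫ x, ‖φ' x - h x‖ ^ 2 ∂ρ' := by
    rw [hρ', integral_map hπ.aemeasurable]
    · simp only [hlift, hqx]
    · exact ((hφ'm.sub h.continuous.measurable).norm.pow_const 2).aestronglyMeasurable
  rw [e1]
  have hgi : Integrable (fun x => ‖φ' x - g x‖ ^ (2 : ℝ)) ρ' := by
    have := (hmem.sub hgm).integrable_norm_rpow (by simp) (by simp)
    simpa using this
  have hle : ∀ x, ‖φ' x - h x‖ ^ 2 ≤ 2 * ‖φ' x - g x‖ ^ (2 : ℝ) + 2 * δ ^ 2 := by
    intro x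
    rw [Real.rpow_two]
    have h1 : ‖g x - h x‖ ≤ δ := by
      rw [← dist_eq_norm]
      exact (ContinuousMap.dist_apply_le_dist (f := g.toContinuousMap) (g := h) x).trans hdist.le
    have h2 : ‖φ' x - h x‖ ≤ ‖φ' x - g x‖ + ‖g x - h x‖ := norm_sub_le_norm_sub_add_norm_sub _ _ _
    have h3 := norm_nonneg (φ' x - h x)
    have h4 := norm_nonneg (g x - h x)
    nlinarith [sq_nonneg (‖φ' x - g x‖ - ‖g x - h x‖), norm_nonneg (φ' x - g x)]
  calc ∫ x, ‖φ' x - h x‖ ^ 2 ∂ρ' ≤ ∫ x, (2 * ‖φ' x - g x‖ ^ (2 : ℝ) + 2 * δ ^ 2) ∂ρ' :=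
        integral_mono_of_nonneg (Eventually.of_forall fun x => by positivity)
          ((hgi.const_mul 2).add (integrable_const _)) (Eventually.of_forall hle)
    _ = 2 * ∫ x, ‖φ' x - g x‖ ^ (2 : ℝ) ∂ρ' + M * (2 * δ ^ 2) := by
        rw [integral_add (hgi.const_mul 2) (integrable_const _), integral_const_mul,
          integral_const, smul_eq_mul]
    _ ≤ 2 * (ε / 4) + ε / 2 := by
        gcongr
        rw [hδ2]
        have : M / (M + 1) ≤ 1 := (div_le_one (by positivity)).2 (by linarith)
        calc M * (2 * (ε / (4 * (M + 1)))) = M / (M + 1) * (ε / 2) := by field_simp; ring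
          _ ≤ 1 * (ε / 2) := by gcongr
          _ = ε / 2 := one_mul _
    _ = ε := by ring

/-! ### The infimum of the spectral error over trigonometric polynomials -/

section Infimum

variable {SX Sη : ℝ → ℝ} {w : ℝ} {P : ℕ} {H : Fin P → ℝ → ℂ} {f t : ℝ}

theorem norm_sum_mul_sq_le (h c : Fin P → ℂ) :
    ‖∑ p, h p * c p‖ ^ 2 ≤ P * ∑ p, ‖h p‖ ^ 2 * ‖c p‖ ^ 2 := by
  have h1 : ‖∑ p, h p * c p‖ ≤ ∑ p, ‖h p‖ * ‖c p‖ :=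
    (norm_sum_le _ _).trans (le_of_eq (by simp))
  calc ‖∑ p, h p * c p‖ ^ 2 ≤ (∑ p, ‖h p‖ * ‖c p‖) ^ 2 := by gcongr
    _ ≤ P * ∑ p, (‖h p‖ * ‖c p‖) ^ 2 := by
        simpa using sq_sum_le_card_mul_sum_sq (s := Finset.univ) (f := fun p => ‖h p‖ * ‖c p‖)
    _ = P * ∑ p, ‖h p‖ ^ 2 * ‖c p‖ ^ 2 := by simp only [mul_pow]

theorem measurable_sum_mul (hH : ∀ p, Measurable (H p)) {c : ℝ → Fin P → ℂ}
    (hc : ∀ p, Measurable fun f => c f p) : Measurable fun f => ∑ p, H p f * c f p :=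
  Finset.measurable_sum _ fun p _ => (hH p).mul (hc p)

theorem integrable_mul_norm_sum_sq (hXm : Measurable SX) (hηm : Measurable Sη)
    (hX : ∀ f, 0 ≤ SX f) (hη : ∀ f, 0 ≤ Sη f) (hH : Admissible SX Sη H) {c : ℝ → Fin P → ℂ}
    (hc : ∀ p, Measurable fun f => c f p) {B : ℝ} (hB : ∀ f p, ‖c f p‖ ^ 2 ≤ B) :
    Integrable fun f => (SX f + Sη f) * ‖∑ p, H p f * c f p‖ ^ 2 := by
  have hdom : Integrable fun f => P * ∑ p, B * ((SX f + Sη f) * ‖H p f‖ ^ 2) :=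
    (integrable_finsetSum _ fun p _ => (hH p).2.const_mul B).const_mul _
  refine hdom.mono' ((hXm.add hηm).mul
    ((measurable_sum_mul (fun p => (hH p).1) hc).norm.pow_const 2)).aestronglyMeasurable
    (Eventually.of_forall fun f => ?_)
  have hN : 0 ≤ SX f + Sη f := add_nonneg (hX f) (hη f)
  rw [Real.norm_of_nonneg (by positivity)]
  calc (SX f + Sη f) * ‖∑ p, H p f * c f p‖ ^ 2
      ≤ (SX f + Sη f) * (P * ∑ p, ‖H p f‖ ^ 2 * ‖c f p‖ ^ 2) := by
        gcongr; exact norm_sum_mul_sq_le _ _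
    _ ≤ (SX f + Sη f) * (P * ∑ p, ‖H p f‖ ^ 2 * B) := by
        gcongr with p; exact hB f p
    _ = P * ∑ p, B * ((SX f + Sη f) * ‖H p f‖ ^ 2) := by
        simp only [Finset.mul_sum]
        exact Finset.sum_congr rfl fun p _ => by ring

theorem integrable_error (hXm : Measurable SX) (hηm : Measurable Sη)
    (hX : ∀ f, 0 ≤ SX f) (hη : ∀ f, 0 ≤ Sη f) (hi : Integrable SX) {g : ℝ → ℂ}
    (hg : Measurable g) (hgi : Integrable fun f => (SX f + Sη f) * ‖g f‖ ^ 2) (t : ℝ) :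
    Integrable fun f => SX f * ‖wave t f - g f‖ ^ 2 + Sη f * ‖g f‖ ^ 2 := by
  refine ((hi.const_mul 2).add (hgi.const_mul 2)).mono'
    ((hXm.mul (((measurable_wave t).sub hg).norm.pow_const 2)).add
      (hηm.mul (hg.norm.pow_const 2))).aestronglyMeasurable (Eventually.of_forall fun f => ?_)
  have h1 := hX f
  have h2 := hη f
  rw [Real.norm_of_nonneg (by positivity)]
  have h3 : ‖wave t f - g f‖ ^ 2 ≤ 2 * 1 + 2 * ‖g f‖ ^ 2 := by
    have := norm_sub_le (wave t f) (g f)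
    rw [norm_wave] at this
    nlinarith [sq_nonneg (1 - ‖g f‖), norm_nonneg (wave t f - g f), norm_nonneg (g f)]
  simp only [Pi.add_apply]
  nlinarith [mul_le_mul_of_nonneg_left h3 h1, mul_nonneg h2 (sq_nonneg ‖g f‖)]

/-- Because `c` is periodic, one coefficient vector serves a whole class, so the folded integrand is
the sum computed in `FoldSummable.hasSum_error`. -/
theorem spectralError_eq (hXm : Measurable SX) (hηm : Measurable Sη)
    (hX : ∀ f, 0 ≤ SX f) (hη : ∀ f, 0 ≤ Sη f) (hi : Integrable SX) (hw : 0 < w)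
    (hH : Admissible SX Sη H) {c : ℝ → Fin P → ℂ} (hc : ∀ p, Measurable fun f => c f p) {B : ℝ}
    (hB : ∀ f p, ‖c f p‖ ^ 2 ≤ B) (hper : ∀ f, ∀ k : ℤ, c (f - w * k) = c f) (t : ℝ) :
    IntervalIntegrable (fun f => quadValue (matSY SX Sη w H f) (crossVec SX w H t f) (c f))
      volume (-(w / 2)) (w / 2) ∧
    spectralError SX Sη t (fun f => ∑ p, H p f * c f p) = (∫ f, SX f) +
      ∫ f in (-(w / 2))..(w / 2),
        quadValue (matSY SX Sη w H f) (crossVec SX w H t f) (c f) := by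
  have hint := integrable_error hXm hηm hX hη hi (measurable_sum_mul (fun p => (hH p).1) hc)
    (integrable_mul_norm_sum_sq hXm hηm hX hη hH hc hB) t
  have h1 := intervalIntegrable_tsum_shift hint hw
  have h2 := intervalIntegrable_tsum_shift hi hw
  have hae : ∀ᵐ f : ℝ, (∑' k : ℤ, (SX (f - w * k) *
      ‖wave t (f - w * k) - ∑ p, H p (f - w * k) * c (f - w * k) p‖ ^ 2 +
        Sη (f - w * k) * ‖∑ p, H p (f - w * k) * c (f - w * k) p‖ ^ 2)) -
      (∑' k : ℤ, SX (f - w * k)) =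
        quadValue (matSY SX Sη w H f) (crossVec SX w H t f) (c f) := by
    filter_upwards [ae_foldSummable hi hH hw] with f hf
    simp only [hper]
    rw [(hf.hasSum_error hX hη t (c f)).tsum_eq]
    ring
  refine ⟨(h1.sub h2).congr_ae (ae_restrict_of_ae hae), ?_⟩
  rw [← intervalIntegral.integral_congr_ae (hae.mono fun f hf _ => hf),
    intervalIntegral.integral_sub h1 h2, spectralError, integral_eq_integral_tsum_shift hint hw,
    integral_eq_integral_tsum_shift hi hw]
  ring

/-- The frequency response of the finite linear combination `c` of the samples. -/
def trigResponse (w : ℝ) {P : ℕ} (H : Fin P → ℝ → ℂ) (c : Fin P × ℤ →₀ ℂ) (f : ℝ) : ℂ :=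
  c.sum fun i a => a * (H i.1 f * wave (i.2 / w) f)

/-- The multiplier of the filter `p` in `trigResponse`. -/
def trigCoeff (w : ℝ) {P : ℕ} (c : Fin P × ℤ →₀ ℂ) (f : ℝ) (p : Fin P) : ℂ :=
  c.sum fun i a => if i.1 = p then a * wave (i.2 / w) f else 0

theorem trigResponse_eq (c : Fin P × ℤ →₀ ℂ) (f : ℝ) :
    trigResponse w H c f = ∑ p, H p f * trigCoeff w c f p := by
  simp only [trigResponse, trigCoeff, Finsupp.sum, Finset.mul_sum]
  rw [Finset.sum_comm]
  refine Finset.sum_congr rfl fun i _ => ?_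
  simp only [mul_ite, mul_zero, Finset.sum_ite_eq, Finset.mem_univ, if_true]
  ring

theorem measurable_trigCoeff (c : Fin P × ℤ →₀ ℂ) (p : Fin P) :
    Measurable fun f => trigCoeff w c f p := by
  refine Finset.measurable_sum _ fun i _ => ?_
  beta_reduce
  split_ifs
  · exact (measurable_wave _).const_mul _
  · exact measurable_const

theorem norm_trigCoeff_le (c : Fin P × ℤ →₀ ℂ) (f : ℝ) (p : Fin P) :
    ‖trigCoeff w c f p‖ ^ 2 ≤ (c.sum fun _ a => ‖a‖) ^ 2 := by
  refine pow_le_pow_left₀ (norm_nonneg _) ((norm_sum_le _ _).trans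
    (Finset.sum_le_sum fun i _ => ?_)) 2
  beta_reduce
  split_ifs
  · rw [norm_mul, norm_wave, mul_one]
  · rw [norm_zero]; exact norm_nonneg _

theorem trigCoeff_sub (hw : w ≠ 0) (c : Fin P × ℤ →₀ ℂ) (f : ℝ) (k : ℤ) :
    trigCoeff w c (f - w * k) = trigCoeff w c f := by
  funext p
  simp only [trigCoeff, wave_sample_sub hw]

theorem integrable_energy (hXm : Measurable SX) (hηm : Measurable Sη)
    (hX : ∀ f, 0 ≤ SX f) (hη : ∀ f, 0 ≤ Sη f) (hi : Integrable SX) (hw : 0 < w)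
    (hH : Admissible SX Sη H) (T : ℝ) :
    Integrable (fun x : ℝ × ℝ => energy (matSY SX Sη w H x.2) (crossVec SX w H x.1 x.2))
      ((volume.restrict (Set.Ioc 0 T)).prod (volume.restrict (Set.Ioc (-(w / 2)) (w / 2)))) := by
  have h2 := intervalIntegrable_tsum_shift hi hw
  rw [intervalIntegrable_iff_integrableOn_Ioc_of_le (by linarith)] at h2
  have hdom : Integrable (fun x : ℝ × ℝ => ∑' k : ℤ, SX (x.2 - w * k))
      ((volume.restrict (Set.Ioc 0 T)).prod (volume.restrict (Set.Ioc (-(w / 2)) (w / 2)))) :=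
    h2.comp_snd _
  have hm := aemeasurable_energy (w := w) hXm hηm hX hη hi hw hH
  refine hdom.mono' ?_ ?_
  · rw [Measure.prod_restrict]
    exact hm.restrict.aestronglyMeasurable
  · refine Measure.quasiMeasurePreserving_snd.ae (p := fun f => ∀ t : ℝ,
      ‖energy (matSY SX Sη w H f) (crossVec SX w H t f)‖ ≤ ∑' k : ℤ, SX (f - w * k))
      (ae_restrict_of_ae ?_) |>.mono fun x hx => hx x.1
    filter_upwards [ae_foldSummable hi hH hw] with f hf t
    rw [Real.norm_of_nonneg (energy_nonneg _ _)]
    exact hf.energy_le hX hη t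

end Infimum

end

end FilterBank

namespace FilterBank

noncomputable section

open Matrix
open scoped ComplexOrder

/-! ### Reduction of the infimum to pointwise minimization -/

section Infimum

variable {SX Sη : ℝ → ℝ} {w : ℝ} {P : ℕ} {H : Fin P → ℝ → ℂ} {f t : ℝ}

theorem spectralError_nonneg (hX : ∀ f, 0 ≤ SX f) (hη : ∀ f, 0 ≤ Sη f) (t : ℝ) (g : ℝ → ℂ) :
    0 ≤ spectralError SX Sη t g :=
  integral_nonneg fun f => add_nonneg (mul_nonneg (hX f) (sq_nonneg _))
    (mul_nonneg (hη f) (sq_nonneg _))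

theorem bddBelow_spectralError (hX : ∀ f, 0 ≤ SX f) (hη : ∀ f, 0 ≤ Sη f) (t : ℝ) :
    BddBelow (Set.range fun c : Fin P × ℤ →₀ ℂ => spectralError SX Sη t (trigResponse w H c)) :=
  ⟨0, Set.forall_mem_range.2 fun _ => spectralError_nonneg hX hη t _⟩

theorem norm_add_sq_le (a b : ℂ) {δ : ℝ} (hδ : 0 < δ) :
    ‖a + b‖ ^ 2 ≤ (1 + δ) * ‖a‖ ^ 2 + (1 + δ⁻¹) * ‖b‖ ^ 2 := by
  have h1 := norm_add_le a b
  have h2 : 2 * (‖a‖ * ‖b‖) ≤ δ * ‖a‖ ^ 2 + δ⁻¹ * ‖b‖ ^ 2 := by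
    have h3 : 0 ≤ δ⁻¹ * (δ * ‖a‖ - ‖b‖) ^ 2 := by positivity
    have h4 : δ⁻¹ * (δ * ‖a‖ - ‖b‖) ^ 2 =
        δ * ‖a‖ ^ 2 + δ⁻¹ * ‖b‖ ^ 2 - 2 * (‖a‖ * ‖b‖) := by
      field_simp
      ring
    linarith
  nlinarith [norm_nonneg (a + b), norm_nonneg a, norm_nonneg b]

/-- Admissibility makes `(SX + Sη) |H p|²` the density of a finite measure, so the density theorem
applies to each branch separately. One factor `P` comes from Cauchy–Schwarz across the branches, the
other from adding up the `P` errors. -/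
theorem exists_trigResponse_close (hXm : Measurable SX) (hηm : Measurable Sη)
    (hX : ∀ f, 0 ≤ SX f) (hη : ∀ f, 0 ≤ Sη f) (hw : 0 < w)
    (hH : Admissible SX Sη H) {c : ℝ → Fin P → ℂ} (hc : ∀ p, Measurable fun f => c f p) {B : ℝ}
    (hB : ∀ f p, ‖c f p‖ ≤ B) (hper : ∀ f, c (f + w) = c f) {ε : ℝ} (hε : 0 < ε) :
    ∃ q : Fin P × ℤ →₀ ℂ,
      ∫ f, (SX f + Sη f) * ‖(∑ p, H p f * c f p) - trigResponse w H q f‖ ^ 2 ≤ P * (P * ε) := by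
  have hN0 : ∀ f, 0 ≤ SX f + Sη f := fun f => add_nonneg (hX f) (hη f)
  have hDm : ∀ p, Measurable fun f => (SX f + Sη f) * ‖H p f‖ ^ 2 := fun p =>
    (hXm.add hηm).mul ((hH p).1.norm.pow_const 2)
  have hstep : ∀ p, ∃ q : ℤ →₀ ℂ, ∫ f, (SX f + Sη f) * ‖H p f‖ ^ 2 *
      ‖c f p - q.sum fun n a => a * wave (n / w) f‖ ^ 2 ≤ ε := by
    intro p
    set ρ : Measure ℝ := volume.withDensity fun f =>
      ENNReal.ofReal ((SX f + Sη f) * ‖H p f‖ ^ 2) with hρ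
    have : IsFiniteMeasure ρ := isFiniteMeasure_withDensity_ofReal (hH p).2.2
    obtain ⟨q, hq⟩ := exists_trigPoly_integral_le hw (ρ := ρ) (hc p)
      (fun f => congrFun (hper f) p) (fun f => hB f p) hε
    refine ⟨q, le_trans (le_of_eq ?_) hq⟩
    rw [hρ, integral_withDensity_eq_integral_toReal_smul (hDm p).ennreal_ofReal
      (Eventually.of_forall fun _ => ENNReal.ofReal_lt_top)]
    refine integral_congr_ae (Eventually.of_forall fun f => ?_)
    beta_reduce
    rw [ENNReal.toReal_ofReal (mul_nonneg (hN0 f) (sq_nonneg _)), smul_eq_mul]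
  choose q hq using hstep
  set Q : Fin P × ℤ →₀ ℂ := ∑ p, (q p).mapDomain (Prod.mk p) with hQ
  set d : ℝ → Fin P → ℂ := fun f p => c f p - (q p).sum fun n a => a * wave (n / w) f with hd
  have hQf : ∀ f, trigResponse w H Q f = ∑ p, H p f * (q p).sum fun n a => a * wave (n / w) f := by
    intro f
    rw [trigResponse, hQ, ← Finsupp.sum_finsetSum_index (by simp) (by intros; ring)]
    refine Finset.sum_congr rfl fun p _ => ?_
    rw [Finsupp.sum_mapDomain_index (by simp) (by intros; ring), Finsupp.mul_sum]
    refine Finset.sum_congr rfl fun n _ => ?_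
    ring
  have hdm : ∀ p, Measurable fun f => d f p := fun p => (hc p).sub
    (Finset.measurable_sum _ fun n _ => (measurable_wave _).const_mul _)
  have hdB : ∀ p, ∃ C : ℝ, ∀ f, ‖d f p‖ ^ 2 ≤ C := by
    intro p
    refine ⟨(B + (q p).sum fun _ a => ‖a‖) ^ 2, fun f => pow_le_pow_left₀ (norm_nonneg _) ?_ 2⟩
    refine (norm_sub_le _ _).trans (add_le_add (hB f p) ((norm_sum_le _ _).trans
      (Finset.sum_le_sum fun n _ => ?_)))
    rw [norm_mul, norm_wave, mul_one]
  have hdi : ∀ p, Integrable fun f => (SX f + Sη f) * ‖H p f‖ ^ 2 * ‖d f p‖ ^ 2 := by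
    intro p
    obtain ⟨C, hC⟩ := hdB p
    refine ((hH p).2.mul_const C).mono' ((hDm p).mul
      ((hdm p).norm.pow_const 2)).aestronglyMeasurable (Eventually.of_forall fun f => ?_)
    have := hN0 f
    rw [Real.norm_of_nonneg (by positivity)]
    exact mul_le_mul_of_nonneg_left (hC f) (by positivity)
  refine ⟨Q, ?_⟩
  calc ∫ f, (SX f + Sη f) * ‖(∑ p, H p f * c f p) - trigResponse w H Q f‖ ^ 2
      ≤ ∫ f, P * ∑ p, (SX f + Sη f) * ‖H p f‖ ^ 2 * ‖d f p‖ ^ 2 := by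
        refine integral_mono_of_nonneg (Eventually.of_forall fun f => mul_nonneg (hN0 f)
          (sq_nonneg _)) ((integrable_finsetSum _ fun p _ => hdi p).const_mul _)
          (Eventually.of_forall fun f => ?_)
        beta_reduce
        rw [hQf, ← Finset.sum_sub_distrib]
        simp only [← mul_sub]
        calc (SX f + Sη f) * ‖∑ p, H p f * d f p‖ ^ 2
            ≤ (SX f + Sη f) * (P * ∑ p, ‖H p f‖ ^ 2 * ‖d f p‖ ^ 2) :=
              mul_le_mul_of_nonneg_left (norm_sum_mul_sq_le _ _) (hN0 f)
          _ = P * ∑ p, (SX f + Sη f) * ‖H p f‖ ^ 2 * ‖d f p‖ ^ 2 := by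
              simp only [Finset.mul_sum]
              exact Finset.sum_congr rfl fun p _ => by ring
    _ = P * ∑ p, ∫ f, (SX f + Sη f) * ‖H p f‖ ^ 2 * ‖d f p‖ ^ 2 := by
        rw [integral_const_mul, integral_finsetSum _ fun p _ => hdi p]
    _ ≤ P * ∑ _p : Fin P, ε := by
        gcongr with p
        exact hq p
    _ = P * (P * ε) := by simp

/-- Replacing `g` by a nearby trigonometric response multiplies the error by `1 + δ` and adds `1 +
δ⁻¹` times the distance. The limit `ε → 0` is taken before `δ → 0`. -/
theorem iInf_spectralError_le (hXm : Measurable SX) (hηm : Measurable Sη)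
    (hX : ∀ f, 0 ≤ SX f) (hη : ∀ f, 0 ≤ Sη f) (hi : Integrable SX) (hw : 0 < w)
    (hH : Admissible SX Sη H) {c : ℝ → Fin P → ℂ} (hc : ∀ p, Measurable fun f => c f p) {B : ℝ}
    (hB : ∀ f p, ‖c f p‖ ≤ B) (hper : ∀ f, c (f + w) = c f) (t : ℝ) :
    ⨅ q : Fin P × ℤ →₀ ℂ, spectralError SX Sη t (trigResponse w H q) ≤
      spectralError SX Sη t fun f => ∑ p, H p f * c f p := by
  set I := ⨅ q : Fin P × ℤ →₀ ℂ, spectralError SX Sη t (trigResponse w H q) with hI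
  set g : ℝ → ℂ := fun f => ∑ p, H p f * c f p with hg
  have hgm : Measurable g := measurable_sum_mul (fun p => (hH p).1) hc
  have hgi : Integrable fun f => (SX f + Sη f) * ‖g f‖ ^ 2 :=
    integrable_mul_norm_sum_sq hXm hηm hX hη hH hc
      fun f p => pow_le_pow_left₀ (norm_nonneg _) (hB f p) 2
  have hE := integrable_error hXm hηm hX hη hi hgm hgi t
  have hqi : ∀ q : Fin P × ℤ →₀ ℂ, Measurable (trigResponse w H q) ∧
      Integrable fun f => (SX f + Sη f) * ‖trigResponse w H q f‖ ^ 2 := by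
    intro q
    have e : trigResponse w H q = fun f => ∑ p, H p f * trigCoeff w q f p :=
      funext fun f => trigResponse_eq q f
    rw [e]
    exact ⟨measurable_sum_mul (fun p => (hH p).1) (measurable_trigCoeff q),
      integrable_mul_norm_sum_sq hXm hηm hX hη hH (measurable_trigCoeff q)
        (norm_trigCoeff_le q)⟩
  have key : ∀ δ > 0, ∀ ε > 0, I ≤ (1 + δ) * spectralError SX Sη t g +
      (1 + δ⁻¹) * (P * (P * ε)) := by
    intro δ hδ ε hε
    obtain ⟨q, hq⟩ := exists_trigResponse_close hXm hηm hX hη hw hH hc hB hper hε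
    obtain ⟨hqm, hqi⟩ := hqi q
    have hDi : Integrable fun f => (SX f + Sη f) * ‖g f - trigResponse w H q f‖ ^ 2 := by
      refine ((hgi.const_mul 2).add (hqi.const_mul 2)).mono' ((hXm.add hηm).mul
        ((hgm.sub hqm).norm.pow_const 2)).aestronglyMeasurable (Eventually.of_forall fun f => ?_)
      have hN : 0 ≤ SX f + Sη f := add_nonneg (hX f) (hη f)
      rw [Real.norm_of_nonneg (by positivity), Pi.add_apply]
      have h3 : ‖g f - trigResponse w H q f‖ ^ 2 ≤
          2 * ‖g f‖ ^ 2 + 2 * ‖trigResponse w H q f‖ ^ 2 := by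
        have := norm_sub_le (g f) (trigResponse w H q f)
        nlinarith [sq_nonneg (‖g f‖ - ‖trigResponse w H q f‖),
          norm_nonneg (g f - trigResponse w H q f)]
      nlinarith [mul_le_mul_of_nonneg_left h3 hN]
    calc I ≤ spectralError SX Sη t (trigResponse w H q) :=
          ciInf_le (bddBelow_spectralError hX hη t) q
      _ ≤ ∫ f, ((1 + δ) * (SX f * ‖wave t f - g f‖ ^ 2 + Sη f * ‖g f‖ ^ 2) +
            (1 + δ⁻¹) * ((SX f + Sη f) * ‖g f - trigResponse w H q f‖ ^ 2)) := by
          refine integral_mono (integrable_error hXm hηm hX hη hi hqm hqi t)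
            ((hE.const_mul _).add (hDi.const_mul _)) fun f => ?_
          have h1 := norm_add_sq_le (wave t f - g f) (g f - trigResponse w H q f) hδ
          have h2 := norm_add_sq_le (g f) (trigResponse w H q f - g f) hδ
          rw [sub_add_sub_cancel] at h1
          rw [add_sub_cancel, norm_sub_rev (trigResponse w H q f)] at h2
          have h3 := mul_le_mul_of_nonneg_left h1 (hX f)
          have h4 := mul_le_mul_of_nonneg_left h2 (hη f)
          beta_reduce
          linarith
      _ = (1 + δ) * spectralError SX Sη t g + (1 + δ⁻¹) *
            ∫ f, (SX f + Sη f) * ‖g f - trigResponse w H q f‖ ^ 2 := by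
          rw [integral_add (hE.const_mul _) (hDi.const_mul _), integral_const_mul,
            integral_const_mul]
          rfl
      _ ≤ (1 + δ) * spectralError SX Sη t g + (1 + δ⁻¹) * (P * (P * ε)) := by gcongr
  have key2 : ∀ δ > 0, I ≤ (1 + δ) * spectralError SX Sη t g := by
    intro δ hδ
    have hl : Tendsto (fun ε : ℝ => (1 + δ) * spectralError SX Sη t g +
        (1 + δ⁻¹) * (P * (P * ε))) (𝓝[>] 0) (𝓝 ((1 + δ) * spectralError SX Sη t g +
        (1 + δ⁻¹) * (P * (P * 0)))) :=
      ((by fun_prop : Continuous fun ε : ℝ => (1 + δ) * spectralError SX Sη t g +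
        (1 + δ⁻¹) * (P * (P * ε))).tendsto 0).mono_left nhdsWithin_le_nhds
    have := ge_of_tendsto hl (eventually_nhdsWithin_of_forall fun ε hε => key δ hδ ε hε)
    simpa using this
  have hl : Tendsto (fun δ : ℝ => (1 + δ) * spectralError SX Sη t g) (𝓝[>] 0)
      (𝓝 ((1 + 0) * spectralError SX Sη t g)) :=
    ((by fun_prop : Continuous fun δ : ℝ => (1 + δ) * spectralError SX Sη t g).tendsto 0).mono_left
      nhdsWithin_le_nhds
  have := ge_of_tendsto hl (eventually_nhdsWithin_of_forall fun δ hδ => key2 δ hδ)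
  simpa using this

theorem crossVec_periodic (t : ℝ) : Function.Periodic (crossVec SX w H t) w := fun f =>
  funext fun p => tsum_shift_periodic
    (fun f => (SX f : ℂ) * conj (H p f) * wave t f) w f

theorem matSY_periodic : Function.Periodic (matSY SX Sη w H) w := fun f => by
  ext i j
  exact tsum_shift_periodic (fun f => ((SX f + Sη f : ℝ) : ℂ) * conj (H i f) * H j f) w f

theorem measurable_crossVec_right (hXm : Measurable SX) (hH : ∀ p, Measurable (H p)) (t : ℝ)
    (p : Fin P) : Measurable fun f => crossVec SX w H t f p := by
  have hm : Measurable fun f : ℝ => (t, f) := measurable_prodMk_left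
  have h := measurable_crossVec (w := w) hXm hH p
  generalize crossVec SX w H = C at h ⊢
  exact h.comp hm

/-- The multipliers of the filters that approximate the best linear estimator. -/
def approxCoeff (SX Sη : ℝ → ℝ) (w : ℝ) {P : ℕ} (H : Fin P → ℝ → ℂ) (t : ℝ) (n : ℕ) (f : ℝ) :
    Fin P → ℂ :=
  truncRidge (matSY SX Sη w H f) (crossVec SX w H t f) n

theorem measurable_approxCoeff (hXm : Measurable SX) (hηm : Measurable Sη)
    (hH : ∀ p, Measurable (H p)) (t : ℝ) (n : ℕ) (p : Fin P) :
    Measurable fun f => approxCoeff SX Sη w H t n f p :=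
  measurable_truncRidge (measurable_matSY hXm hηm hH) (measurable_crossVec_right hXm hH t) n p

theorem approxCoeff_periodic (t : ℝ) (n : ℕ) :
    Function.Periodic (approxCoeff SX Sη w H t n) w := fun f => by
  rw [approxCoeff, approxCoeff, matSY_periodic f, crossVec_periodic t f]

theorem measurable_quadValue_approxCoeff (hXm : Measurable SX) (hηm : Measurable Sη)
    (hH : ∀ p, Measurable (H p)) (t : ℝ) (n : ℕ) :
    Measurable fun f => quadValue (matSY SX Sη w H f) (crossVec SX w H t f)
      (approxCoeff SX Sη w H t n f) :=
  measurable_quadValue (measurable_matSY hXm hηm hH) (measurable_crossVec_right hXm hH t)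
    (measurable_approxCoeff hXm hηm hH t n)

theorem ae_tendsto_quadValue_approxCoeff (hX : ∀ f, 0 ≤ SX f) (hη : ∀ f, 0 ≤ Sη f)
    (hi : Integrable SX) (hw : 0 < w) (hH : Admissible SX Sη H) (t : ℝ) :
    ∀ᵐ f : ℝ, Tendsto (fun n => quadValue (matSY SX Sη w H f) (crossVec SX w H t f)
      (approxCoeff SX Sη w H t n f)) atTop
      (𝓝 (-energy (matSY SX Sη w H f) (crossVec SX w H t f))) := by
  filter_upwards [ae_foldSummable hi hH hw] with f hf
  exact tendsto_quadValue_truncRidge (matSY_posSemidef hf hX hη)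
    (hf.dotProduct_crossVec_eq_zero hX hη t)

theorem tendsto_integral_quadValue_approxCoeff (hXm : Measurable SX) (hηm : Measurable Sη)
    (hX : ∀ f, 0 ≤ SX f) (hη : ∀ f, 0 ≤ Sη f) (hi : Integrable SX) (hw : 0 < w)
    (hH : Admissible SX Sη H) (t : ℝ) :
    Tendsto (fun n => ∫ f in (-(w / 2))..(w / 2), quadValue (matSY SX Sη w H f)
      (crossVec SX w H t f) (approxCoeff SX Sη w H t n f)) atTop
      (𝓝 (∫ f in (-(w / 2))..(w / 2), -energy (matSY SX Sη w H f) (crossVec SX w H t f))) := by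
  refine intervalIntegral.tendsto_integral_filter_of_dominated_convergence
    (fun f => ∑' k : ℤ, SX (f - w * k)) (Eventually.of_forall fun n =>
      (measurable_quadValue_approxCoeff hXm hηm (fun p => (hH p).1) t n).aestronglyMeasurable)
    (Eventually.of_forall fun n => ?_) (intervalIntegrable_tsum_shift hi hw)
    ((ae_tendsto_quadValue_approxCoeff hX hη hi hw hH t).mono fun f hf _ => hf)
  filter_upwards [ae_foldSummable hi hH hw] with f hf _
  exact (abs_quadValue_truncRidge_le (matSY_posSemidef hf hX hη)
    (hf.dotProduct_crossVec_eq_zero hX hη t) n).trans (hf.energy_le hX hη t)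

theorem intervalIntegrable_energy (hXm : Measurable SX) (hηm : Measurable Sη)
    (hX : ∀ f, 0 ≤ SX f) (hη : ∀ f, 0 ≤ Sη f) (hi : Integrable SX) (hw : 0 < w)
    (hH : Admissible SX Sη H) (t : ℝ) :
    IntervalIntegrable (fun f => -energy (matSY SX Sη w H f) (crossVec SX w H t f))
      volume (-(w / 2)) (w / 2) := by
  refine (intervalIntegrable_tsum_shift hi hw).mono_fun ?_ (ae_restrict_of_ae ?_)
  · have hm : AEStronglyMeasurable
        (fun f => -energy (matSY SX Sη w H f) (crossVec SX w H t f)) volume :=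
      aestronglyMeasurable_of_tendsto_ae atTop (fun n => (measurable_quadValue_approxCoeff hXm hηm
        (fun p => (hH p).1) t n).aestronglyMeasurable)
        (ae_tendsto_quadValue_approxCoeff hX hη hi hw hH t)
    exact hm.restrict
  · filter_upwards [ae_foldSummable hi hH hw] with f hf
    rw [norm_neg, Real.norm_of_nonneg (energy_nonneg _ _),
      Real.norm_of_nonneg (tsum_nonneg fun k => hX _)]
    exact hf.energy_le hX hη t

/-- The lower bound is the pointwise minimum, integrated. For the upper bound the exact minimizer
may be unbounded, so the truncated ridge multipliers are used: they are measurable, periodic and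
bounded by `√n`, and their errors converge to the minimum by dominated convergence. -/
theorem iInf_spectralError_eq (hXm : Measurable SX) (hηm : Measurable Sη)
    (hX : ∀ f, 0 ≤ SX f) (hη : ∀ f, 0 ≤ Sη f) (hi : Integrable SX) (hw : 0 < w)
    (hH : Admissible SX Sη H) (t : ℝ) :
    ⨅ q : Fin P × ℤ →₀ ℂ, spectralError SX Sη t (trigResponse w H q) = (∫ f, SX f) -
      ∫ f in (-(w / 2))..(w / 2), energy (matSY SX Sη w H f) (crossVec SX w H t f) := by
  have hww : -(w / 2) ≤ w / 2 := by linarith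
  have hcm := fun n => measurable_approxCoeff (w := w) hXm hηm (fun p => (hH p).1) t n
  have hcB2 : ∀ n f p, ‖approxCoeff SX Sη w H t n f p‖ ^ 2 ≤ n := fun n f p =>
    norm_truncRidge_le _ _ n p
  have hcper' : ∀ n f, ∀ k : ℤ,
      approxCoeff SX Sη w H t n (f - w * k) = approxCoeff SX Sη w H t n f := fun n f k => by
    rw [mul_comm]; exact (approxCoeff_periodic t n).sub_int_mul_eq k
  rw [sub_eq_add_neg, ← intervalIntegral.integral_neg]
  refine le_antisymm (ge_of_tendsto ((tendsto_integral_quadValue_approxCoeff hXm hηm hX hη hi hw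
    hH t).const_add (∫ f, SX f)) (Eventually.of_forall fun n => ?_)) (le_ciInf fun q => ?_)
  · rw [← (spectralError_eq hXm hηm hX hη hi hw hH (hcm n) (hcB2 n) (hcper' n) t).2]
    exact iInf_spectralError_le hXm hηm hX hη hi hw hH (hcm n)
      (fun f p => Real.le_sqrt_of_sq_le (hcB2 n f p)) (approxCoeff_periodic t n) t
  · have e : trigResponse w H q = fun f => ∑ p, H p f * trigCoeff w q f p :=
      funext fun f => trigResponse_eq q f
    obtain ⟨h1, h2⟩ := spectralError_eq hXm hηm hX hη hi hw hH (measurable_trigCoeff q)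
      (norm_trigCoeff_le q) (trigCoeff_sub hw.ne' q) t
    rw [e, h2]
    refine add_le_add_right (intervalIntegral.integral_mono_ae hww
      (intervalIntegrable_energy hXm hηm hX hη hi hw hH t) h1 ?_) _
    filter_upwards [ae_foldSummable hi hH hw] with f hf
    exact neg_energy_le_quadValue (matSY_posSemidef hf hX hη)
      (hf.dotProduct_crossVec_eq_zero hX hη t) _

end Infimum

end

end FilterBank

namespace FilterBank

noncomputable section

open Matrix
open scoped ComplexOrder

/-! ### Averaging over time -/

theorem integral_wave_int {w : ℝ} (hw : 0 < w) (n : ℤ) :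
    ∫ t in (0 : ℝ)..1 / w, wave t (w * n) = if n = 0 then ((1 / w : ℝ) : ℂ) else 0 := by
  split_ifs with h
  · simp [wave, h]
  · have hn : (n : ℂ) ≠ 0 := by exact_mod_cast h
    have hw' : (w : ℂ) ≠ 0 := by exact_mod_cast hw.ne'
    have hc : 2 * (Real.pi : ℂ) * Complex.I * ((w * n : ℝ) : ℂ) ≠ 0 := by
      push_cast
      exact mul_ne_zero Complex.two_pi_I_ne_zero (mul_ne_zero hw' hn)
    simp only [wave]
    rw [integral_exp_mul_complex hc]
    have h1 : Complex.exp (2 * (Real.pi : ℂ) * Complex.I * ((w * n : ℝ) : ℂ) * ((1 / w : ℝ) : ℂ)) =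
        1 := by
      rw [Complex.exp_eq_one_iff]
      refine ⟨n, ?_⟩
      push_cast
      field_simp
    rw [h1]
    simp

/-- Parseval over one sampling interval. In the double series the phase of a pair depends only on
the difference of the indices, so `f` drops out; absolute summability permits termwise integration,
and only the diagonal survives. -/
theorem integral_norm_sq_tsum_wave {w : ℝ} (hw : 0 < w) (f : ℝ) {α : ℤ → ℂ}
    (hα : Summable fun k => ‖α k‖) :
    ∫ t in (0 : ℝ)..1 / w, ‖∑' k : ℤ, α k * wave t (f - w * k)‖ ^ 2 =
      (1 / w) * ∑' k : ℤ, ‖α k‖ ^ 2 := by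
  have hw1 : (0 : ℝ) ≤ 1 / w := by positivity
  set F : ℤ × ℤ → ℝ → ℂ := fun x t => α x.1 * conj (α x.2) * wave t (w * ((x.2 - x.1 : ℤ) : ℝ))
    with hF
  have hFc : ∀ x, Continuous (F x) := fun x => continuous_const.mul
    (continuous_wave.comp (by fun_prop : Continuous fun t : ℝ => (t, w * ((x.2 - x.1 : ℤ) : ℝ))))
  have hnF : ∀ x t, ‖F x t‖ = ‖α x.1‖ * ‖α x.2‖ := fun x t => by
    simp [hF]
  have hsum2 : Summable fun x : ℤ × ℤ => ‖α x.1‖ * ‖α x.2‖ :=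
    hα.mul_of_nonneg hα (fun _ => norm_nonneg _) fun _ => norm_nonneg _
  have hprod : ∀ t, ((‖∑' k : ℤ, α k * wave t (f - w * k)‖ ^ 2 : ℝ) : ℂ) = ∑' x, F x t := by
    intro t
    push_cast
    rw [← Complex.mul_conj', Complex.conj_tsum, tsum_mul_tsum_of_summable_norm]
    · refine tsum_congr fun x => ?_
      have e : w * ((x.2 - x.1 : ℤ) : ℝ) = (f - w * x.1) - (f - w * x.2) := by push_cast; ring
      simp only [hF]
      rw [e, wave_sub_freq t (f - w * x.1), map_mul]
      ring
    · simpa using hα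
    · simpa using hα
  have hint : ∀ x, ∫ t in Set.Ioc 0 (1 / w), F x t =
      if x.2 = x.1 then ((1 / w * ‖α x.1‖ ^ 2 : ℝ) : ℂ) else 0 := by
    intro x
    rw [← intervalIntegral.integral_of_le hw1]
    simp only [hF]
    rw [intervalIntegral.integral_const_mul, integral_wave_int hw]
    by_cases h : x.2 = x.1
    · rw [if_pos (by rw [h, sub_self]), if_pos h, h, Complex.mul_conj']
      push_cast
      ring
    · rw [if_neg (sub_ne_zero.2 h), if_neg h, mul_zero]
  have hHS := hasSum_integral_of_summable_integral_norm
    (μ := volume.restrict (Set.Ioc 0 (1 / w))) (F := F)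
    (fun x => (hFc x).integrableOn_Ioc) (by
      simp only [hnF, integral_const]
      exact hsum2.const_smul _)
  have h1 : ((∫ t in (0 : ℝ)..1 / w, ‖∑' k : ℤ, α k * wave t (f - w * k)‖ ^ 2 : ℝ) : ℂ) =
      ∑' x : ℤ × ℤ, if x.2 = x.1 then ((1 / w * ‖α x.1‖ ^ 2 : ℝ) : ℂ) else 0 := by
    rw [intervalIntegral.integral_of_le hw1, ← integral_complex_ofReal]
    simp only [hprod]
    rw [← hHS.tsum_eq]
    exact tsum_congr hint
  have hs : Summable fun x : ℤ × ℤ =>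
      if x.2 = x.1 then ((1 / w * ‖α x.1‖ ^ 2 : ℝ) : ℂ) else 0 :=
    hHS.summable.congr hint
  rw [hs.tsum_prod] at h1
  simp only [tsum_ite_eq] at h1
  rw [← Complex.ofReal_tsum, Complex.ofReal_inj, tsum_mul_left] at h1
  exact h1

section Average

variable {SX Sη : ℝ → ℝ} {w : ℝ} {P : ℕ} {H : Fin P → ℝ → ℂ} {f t : ℝ}

/-- The trace of `R K R` is the sum of the forms of `K` at the columns of `R`. Since `R` is
Hermitian, columns may be traded for conjugated rows, which gives exactly the Fourier coefficients
of `R b(t)`. -/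
theorem FoldSummable.traceSXY_eq (hf : FoldSummable SX Sη w H f) (hX : ∀ f, 0 ≤ SX f)
    (hη : ∀ f, 0 ≤ Sη f) :
    traceSXY SX Sη w H f = ∑ p, ∑' k : ℤ, ‖(SX (f - w * k) : ℂ) *
      ∑ j, invSqrt (matSY SX Sη w H f) p j * conj (H j (f - w * k))‖ ^ 2 := by
  set R := invSqrt (matSY SX Sη w H f) with hR
  rw [traceSXY, matSXY, ← hR, Matrix.trace, Complex.re_sum]
  refine Finset.sum_congr rfl fun p _ => ?_
  have h := hasSum_re_quadForm (S := fun f => SX f ^ 2) (fun f => sq_nonneg _)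
    (hf.source_sq hX hη) (R.col p)
  have e : star (R.col p) ⬝ᵥ (foldedMatrix (fun f => SX f ^ 2) w H f *ᵥ R.col p) =
      (Rᴴ * matK SX w H f * R) p p := by
    rw [mul_assoc, Matrix.mul_apply]
    rfl
  rw [e] at h
  rw [Matrix.diag_apply, ← h.tsum_eq]
  refine tsum_congr fun k => ?_
  rw [norm_mul, mul_pow, Complex.norm_real, Real.norm_eq_abs, sq_abs]
  congr 2
  rw [← RCLike.norm_conj, map_sum]
  congr 1
  refine Finset.sum_congr rfl fun j _ => ?_
  have : R p j = conj (R j p) := by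
    conv_lhs => rw [hR, ← invSqrt_conjTranspose]
    rfl
  rw [map_mul, this, Matrix.col_apply]
  ring

theorem FoldSummable.invSqrt_mulVec_crossVec (hf : FoldSummable SX Sη w H f)
    (hX : ∀ f, 0 ≤ SX f) (hη : ∀ f, 0 ≤ Sη f) (R : Matrix (Fin P) (Fin P) ℂ) (t : ℝ) (p : Fin P) :
    (R *ᵥ crossVec SX w H t f) p = ∑' k : ℤ, ((SX (f - w * k) : ℂ) *
      ∑ j, R p j * conj (H j (f - w * k))) * wave t (f - w * k) := by
  have h : HasSum (fun k : ℤ => ∑ j, R p j *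
      ((SX (f - w * k) : ℂ) * conj (H j (f - w * k)) * wave t (f - w * k)))
      (∑ j, R p j * crossVec SX w H t f j) :=
    hasSum_sum fun j _ => (hf.hasSum_crossVec hX hη t j).mul_left _
  refine h.tsum_eq.symm.trans (tsum_congr fun k => ?_)
  rw [Finset.mul_sum, Finset.sum_mul]
  exact Finset.sum_congr rfl fun j _ => by ring

theorem FoldSummable.summable_norm_coeff (hf : FoldSummable SX Sη w H f)
    (hX : ∀ f, 0 ≤ SX f) (hη : ∀ f, 0 ≤ Sη f) (R : Matrix (Fin P) (Fin P) ℂ) (p : Fin P) :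
    Summable fun k : ℤ => ‖(SX (f - w * k) : ℂ) * ∑ j, R p j * conj (H j (f - w * k))‖ := by
  have h : Summable fun k : ℤ => ∑ j, ‖R p j‖ * (SX (f - w * k) * ‖H j (f - w * k)‖) :=
    summable_sum fun j _ => (hf.norm_source hX hη j).mul_left _
  refine h.of_nonneg_of_le (fun k => norm_nonneg _) fun k => ?_
  rw [norm_mul, Complex.norm_real, Real.norm_of_nonneg (hX _)]
  refine (mul_le_mul_of_nonneg_left (norm_sum_le _ _) (hX _)).trans (le_of_eq ?_)
  rw [Finset.mul_sum]
  refine Finset.sum_congr rfl fun j _ => ?_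
  rw [norm_mul, RCLike.norm_conj]
  ring

theorem FoldSummable.integral_energy (hf : FoldSummable SX Sη w H f) (hX : ∀ f, 0 ≤ SX f)
    (hη : ∀ f, 0 ≤ Sη f) (hw : 0 < w) :
    ∫ t in (0 : ℝ)..1 / w, energy (matSY SX Sη w H f) (crossVec SX w H t f) =
      (1 / w) * traceSXY SX Sη w H f := by
  rw [hf.traceSXY_eq hX hη, Finset.mul_sum]
  simp only [energy_eq_sum, hf.invSqrt_mulVec_crossVec hX hη]
  rw [intervalIntegral.integral_finsetSum]
  · exact Finset.sum_congr rfl fun p _ =>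
      integral_norm_sq_tsum_wave hw f (hf.summable_norm_coeff hX hη _ p)
  · intro p _
    refine Continuous.intervalIntegrable (Continuous.pow (Continuous.norm ?_) 2) _ _
    refine continuous_tsum (fun k => ?_) (hf.summable_norm_coeff hX hη
      (invSqrt (matSY SX Sη w H f)) p) fun k t => ?_
    · exact continuous_const.mul (continuous_wave.comp
        (by fun_prop : Continuous fun t : ℝ => (t, f - w * k)))
    · rw [norm_mul, norm_wave, mul_one]

theorem energy_smul (A : Matrix (Fin P) (Fin P) ℂ) (b : Fin P → ℂ) (z : ℂ) :
    energy A (z • b) = ‖z‖ ^ 2 * energy A b := by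
  simp only [energy_eq_sum, mulVec_smul, Pi.smul_apply, norm_smul, mul_pow, Finset.mul_sum]

theorem crossVec_add_period (hw : w ≠ 0) (t f : ℝ) :
    crossVec SX w H (t + 1 / w) f = wave (1 / w) f • crossVec SX w H t f := by
  funext p
  simp only [crossVec, Pi.smul_apply, smul_eq_mul]
  rw [← tsum_mul_left]
  refine tsum_congr fun k => ?_
  have := wave_sample_sub hw 1 k f
  rw [Int.cast_one] at this
  rw [wave_add, this]
  ring

/-- A delay of `1 / w` multiplies the cross spectrum of a class by one unimodular scalar. -/
theorem energy_periodic (hw : w ≠ 0) (f : ℝ) :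
    Function.Periodic (fun t => energy (matSY SX Sη w H f) (crossVec SX w H t f)) (1 / w) :=
  fun t => by
    beta_reduce
    rw [crossVec_add_period hw, energy_smul, norm_wave, one_pow, one_mul]

/-- The least mean square error, averaged over time, is given by the trace. -/
theorem hasTimeAverage_energy (hXm : Measurable SX) (hηm : Measurable Sη)
    (hX : ∀ f, 0 ≤ SX f) (hη : ∀ f, 0 ≤ Sη f) (hi : Integrable SX) (hw : 0 < w)
    (hH : Admissible SX Sη H) :
    IntervalIntegrable (traceSXY SX Sη w H) volume (-(w / 2)) (w / 2) ∧
    HasTimeAverage (fun t => (∫ f, SX f) -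
      ∫ f in (-(w / 2))..(w / 2), energy (matSY SX Sη w H f) (crossVec SX w H t f))
      ((∫ f, SX f) - ∫ f in (-(w / 2))..(w / 2), traceSXY SX Sη w H f) := by
  have hww : -(w / 2) ≤ w / 2 := by linarith
  have hw1 : (0 : ℝ) < 1 / w := by positivity
  have hint := integrable_energy (w := w) hXm hηm hX hη hi hw hH (1 / w)
  have htr : ∀ᵐ f ∂volume.restrict (Set.Ioc (-(w / 2)) (w / 2)),
      w * ∫ t in Set.Ioc 0 (1 / w), energy (matSY SX Sη w H f) (crossVec SX w H t f) =
        traceSXY SX Sη w H f := by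
    refine ae_restrict_of_ae ?_
    filter_upwards [ae_foldSummable hi hH hw] with f hf
    rw [← intervalIntegral.integral_of_le hw1.le, hf.integral_energy hX hη hw]
    field_simp
  -- Fubini supplies the integrability of the trace, since it is `w` times the time integral of the
  -- jointly integrable energy.
  have htri : IntervalIntegrable (traceSXY SX Sη w H) volume (-(w / 2)) (w / 2) := by
    rw [intervalIntegrable_iff_integrableOn_Ioc_of_le hww]
    exact (hint.integral_prod_right.const_mul w).congr htr
  refine ⟨htri, ?_⟩
  set e : ℝ → ℝ := fun t => ∫ f in (-(w / 2))..(w / 2),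
    energy (matSY SX Sη w H f) (crossVec SX w H t f) with he
  have hei : IntervalIntegrable e volume 0 (1 / w) := by
    rw [intervalIntegrable_iff_integrableOn_Ioc_of_le hw1.le]
    simp only [he, intervalIntegral.integral_of_le hww]
    exact hint.integral_prod_left
  have hper : Function.Periodic (fun t => (∫ f, SX f) - e t) (1 / w) := fun t => by
    simp only [he]
    congr 1
    exact intervalIntegral.integral_congr fun f _ => energy_periodic hw.ne' f t
  have h := hasTimeAverage_of_periodic hw1 hper ((intervalIntegrable_const).sub hei)
  have hval : (1 / (1 / w)) * ∫ t in (0 : ℝ)..1 / w, ((∫ f, SX f) - e t) =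
      (∫ f, SX f) - ∫ f in (-(w / 2))..(w / 2), traceSXY SX Sη w H f := by
    rw [intervalIntegral.integral_sub intervalIntegrable_const hei,
      intervalIntegral.integral_const, intervalIntegral.integral_of_le hw1.le (f := e),
      intervalIntegral.integral_of_le hww, ← integral_congr_ae htr, integral_const_mul]
    simp only [he, intervalIntegral.integral_of_le hww]
    rw [integral_integral_swap hint]
    simp only [smul_eq_mul]
    field_simp
    ring
  rw [hval] at h
  exact h

end Average

end

end FilterBank

namespace FilterBank

noncomputable section

/-! ### The spectral isometry -/

section Isometry

variable {Ω : Type*} [MeasurableSpace Ω] {μ : Measure Ω}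

theorem IsFilteredGaussian.memLp {ι : Type*} {S : ℝ → ℝ} {G : ι → ℝ → ℂ} {W : ι → ℝ → Ω → ℂ}
    (h : IsFilteredGaussian μ S G W) (i : ι) (t : ℝ) : MemLp (W i t) 2 μ :=
  (h.gaussian.hasGaussianLaw_eval (i, t)).memLp_two

theorem MemLp.integrable_mul_conj {u v : Ω → ℂ} (hu : MemLp u 2 μ) (hv : MemLp v 2 μ) :
    Integrable (fun ω => u ω * conj (v ω)) μ :=
  hu.integrable_mul hv.star

theorem integrable_mul_mul_conj {S : ℝ → ℝ} (hSm : Measurable S) (hS : ∀ f, 0 ≤ S f) {g h : ℝ → ℂ}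
    (hg : Measurable g) (hh : Measurable h) (hgi : Integrable fun f => S f * ‖g f‖ ^ 2)
    (hhi : Integrable fun f => S f * ‖h f‖ ^ 2) :
    Integrable fun f => (S f : ℂ) * (g f * conj (h f)) := by
  refine (hgi.add hhi).mono' ((Complex.measurable_ofReal.comp hSm).mul
    (hg.mul (Complex.continuous_conj.measurable.comp hh))).aestronglyMeasurable
    (Eventually.of_forall fun f => ?_)
  rw [norm_mul, norm_mul, RCLike.norm_conj, Complex.norm_real, Real.norm_of_nonneg (hS f),
    Pi.add_apply]
  nlinarith [mul_nonneg (hS f) (sq_nonneg (‖g f‖ - ‖h f‖)), mul_nonneg (hS f) (sq_nonneg ‖g f‖),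
    mul_nonneg (hS f) (sq_nonneg ‖h f‖)]

theorem norm_sum_sq_eq {κ : Type*} (s : Finset κ) (z : κ → ℂ) :
    ((‖∑ k ∈ s, z k‖ ^ 2 : ℝ) : ℂ) = ∑ k ∈ s, ∑ l ∈ s, z k * conj (z l) := by
  push_cast
  rw [← Complex.mul_conj', map_sum, Finset.sum_mul_sum]

/-- The spectral isometry on finite combinations: both sides expand into double sums that `cov`
matches term by term. -/
theorem IsFilteredGaussian.integral_norm_sq_sum {ι κ : Type*} {S : ℝ → ℝ} {G : ι → ℝ → ℂ}
    {W : ι → ℝ → Ω → ℂ} (h : IsFilteredGaussian μ S G W) (hSm : Measurable S)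
    (hS : ∀ f, 0 ≤ S f) (hG : ∀ i, Measurable (G i))
    (hGi : ∀ i, Integrable fun f => S f * ‖G i f‖ ^ 2) (s : Finset κ) (a : κ → ℂ) (i : κ → ι)
    (τ : κ → ℝ) :
    ∫ ω, ‖∑ k ∈ s, a k * W (i k) (τ k) ω‖ ^ 2 ∂μ =
      ∫ f, S f * ‖∑ k ∈ s, a k * (G (i k) f * wave (τ k) f)‖ ^ 2 := by
  rw [← Complex.ofReal_inj, ← integral_complex_ofReal, ← integral_complex_ofReal]
  simp only [Complex.ofReal_mul, norm_sum_sq_eq]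
  have hW : ∀ k l, Integrable (fun ω => a k * W (i k) (τ k) ω * conj (a l * W (i l) (τ l) ω)) μ :=
    fun k l => MemLp.integrable_mul_conj ((h.memLp (i k) (τ k)).const_mul (a k))
      ((h.memLp (i l) (τ l)).const_mul (a l))
  have hGw : ∀ k, Integrable fun f => S f * ‖a k * (G (i k) f * wave (τ k) f)‖ ^ 2 := by
    intro k
    refine ((hGi (i k)).const_mul (‖a k‖ ^ 2)).congr (Eventually.of_forall fun f => ?_)
    simp only [norm_mul, norm_wave, mul_one, mul_pow]
    ring
  have hGm : ∀ k, Measurable fun f => a k * (G (i k) f * wave (τ k) f) := fun k =>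
    ((hG _).mul (measurable_wave _)).const_mul _
  have hR : ∀ k l, Integrable fun f => (S f : ℂ) * (a k * (G (i k) f * wave (τ k) f) *
      conj (a l * (G (i l) f * wave (τ l) f))) := fun k l =>
    integrable_mul_mul_conj hSm hS (hGm k) (hGm l) (hGw k) (hGw l)
  simp only [Finset.mul_sum]
  rw [integral_finsetSum _ fun k _ => integrable_finsetSum _ fun l _ => hW k l,
    integral_finsetSum _ fun k _ => integrable_finsetSum _ fun l _ => hR k l]
  refine Finset.sum_congr rfl fun k _ => ?_
  rw [integral_finsetSum _ fun l _ => hW k l, integral_finsetSum _ fun l _ => hR k l]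
  refine Finset.sum_congr rfl fun l _ => ?_
  have e1 : ∀ ω, a k * W (i k) (τ k) ω * conj (a l * W (i l) (τ l) ω) =
      a k * conj (a l) * (W (i k) (τ k) ω * conj (W (i l) (τ l) ω)) := fun ω => by
    rw [map_mul]; ring
  simp only [e1]
  rw [integral_const_mul, h.cov, ← integral_const_mul]
  refine integral_congr_ae (Eventually.of_forall fun f => ?_)
  have e2 : Complex.exp (2 * Real.pi * Complex.I * f * (τ k - τ l)) =
      wave (τ k) f * conj (wave (τ l) f) := by
    rw [wave_eq, wave_eq, ← Complex.exp_conj, ← Complex.exp_add]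
    congr 1
    simp only [map_mul, Complex.conj_ofReal, Complex.conj_I]
    push_cast
    ring
  simp only [e2, map_mul]
  ring

variable {SX Sη : ℝ → ℝ} {w : ℝ} {P : ℕ} {H : Fin P → ℝ → ℂ} {X : ℝ → Ω → ℝ}
  {U V : Fin P → ℝ → Ω → ℂ}

/-- The error splits into a source part `A` and a noise part `B`. They are independent and the noise
is centred, so the cross term vanishes, and the isometry evaluates each square. -/
theorem IsModel.integral_norm_sq (h : IsModel μ SX Sη H X U V)
    (hXm : Measurable SX) (hηm : Measurable Sη)
    (hX : ∀ f, 0 ≤ SX f) (hη : ∀ f, 0 ≤ Sη f) (hi : Integrable SX)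
    (hH : Admissible SX Sη H) (t : ℝ) (c : Fin P × ℤ →₀ ℂ) :
    ∫ ω, ‖(X t ω : ℂ) - c.sum fun i a => a * samples w U V i ω‖ ^ 2 ∂μ =
      spectralError SX Sη t (trigResponse w H c) := by
  have hprob : IsProbabilityMeasure μ := h.source.gaussian.isProbabilityMeasure
  set A : Ω → ℂ := fun ω => (X t ω : ℂ) - ∑ i ∈ c.support, c i * U i.1 (i.2 / w) ω with hA
  set B : Ω → ℂ := fun ω => ∑ i ∈ c.support, c i * V i.1 (i.2 / w) ω with hB
  have hXmem : MemLp (fun ω => (X t ω : ℂ)) 2 μ := h.source.memLp none t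
  have hUmem : ∀ p s, MemLp (U p s) 2 μ := fun p s => h.source.memLp (some p) s
  have hAmem : MemLp A 2 μ :=
    hXmem.sub (memLp_finsetSum _ fun i _ => (hUmem i.1 (i.2 / w)).const_mul (c i))
  have hBmem : MemLp B 2 μ :=
    memLp_finsetSum _ fun i _ => (h.noise.memLp i.1 (i.2 / w)).const_mul (c i)
  have hind : IndepFun A (fun ω => conj (B ω)) μ := by
    have hm1 : Measurable fun x : (ℝ → ℝ) × (Fin P → ℝ → ℂ) =>
        ((x.1 t : ℝ) : ℂ) - ∑ i ∈ c.support, c i * x.2 i.1 (i.2 / w) := by fun_prop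
    have hm2 : Measurable fun x : Fin P → ℝ → ℂ =>
        conj (∑ i ∈ c.support, c i * x i.1 (i.2 / w)) :=
      Complex.continuous_conj.measurable.comp (by fun_prop)
    exact h.indep.comp hm1 hm2
  have hB0 : ∫ ω, conj (B ω) ∂μ = 0 := by
    rw [integral_conj, hB, integral_finsetSum _ fun i _ =>
      ((h.noise.memLp i.1 (i.2 / w)).integrable one_le_two).const_mul (c i)]
    simp [integral_const_mul, h.noise.mean]
  have hcross : ∫ ω, A ω * conj (B ω) ∂μ = 0 := by
    rw [hind.integral_fun_mul_eq_mul_integral hAmem.1 hBmem.star.1, hB0, mul_zero]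
  have hsq : ∀ ω, ‖(X t ω : ℂ) - c.sum fun i a => a * samples w U V i ω‖ ^ 2 =
      ‖A ω‖ ^ 2 - 2 * (A ω * conj (B ω)).re + ‖B ω‖ ^ 2 := by
    intro ω
    have e : (X t ω : ℂ) - c.sum (fun i a => a * samples w U V i ω) = A ω - B ω := by
      simp only [hA, hB, Finsupp.sum, samples, mul_add, Finset.sum_add_distrib]
      ring
    rw [e, norm_sub_sq_eq, mul_comm (conj (B ω))]
  have hABi := MemLp.integrable_mul_conj hAmem hBmem
  have hre : ∫ ω, (A ω * conj (B ω)).re ∂μ = 0 := by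
    have := integral_re hABi
    simp only [RCLike.re_to_complex] at this
    rw [this, hcross, Complex.zero_re]
  have hA2 : Integrable (fun ω => ‖A ω‖ ^ 2) μ := hAmem.integrable_norm_pow (by norm_num)
  have hB2 : Integrable (fun ω => ‖B ω‖ ^ 2) μ := hBmem.integrable_norm_pow (by norm_num)
  simp only [hsq]
  have hABr : Integrable (fun ω => 2 * (A ω * conj (B ω)).re) μ := hABi.re.const_mul 2
  have hsub : Integrable (fun ω => ‖A ω‖ ^ 2 - 2 * (A ω * conj (B ω)).re) μ := hA2.sub hABr
  rw [integral_add hsub hB2, integral_sub hA2 hABr, integral_const_mul, hre, mul_zero, sub_zero]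
  have hHi : ∀ p, Integrable fun f => SX f * ‖H p f‖ ^ 2 := fun p =>
    (hH p).2.mono' (hXm.mul ((hH p).1.norm.pow_const 2)).aestronglyMeasurable
      (Eventually.of_forall fun f => by
        rw [Real.norm_of_nonneg (mul_nonneg (hX f) (sq_nonneg _))]
        exact mul_le_mul_of_nonneg_right (by linarith [hη f]) (sq_nonneg _))
  have hHi' : ∀ p, Integrable fun f => Sη f * ‖H p f‖ ^ 2 := fun p =>
    (hH p).2.mono' (hηm.mul ((hH p).1.norm.pow_const 2)).aestronglyMeasurable
      (Eventually.of_forall fun f => by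
        rw [Real.norm_of_nonneg (mul_nonneg (hη f) (sq_nonneg _))]
        exact mul_le_mul_of_nonneg_right (by linarith [hX f]) (sq_nonneg _))
  -- The added index `none` stands for the source itself, with coefficient `1` and filter `1`; the
  -- samples enter with `-c i`.
  have hSA := h.source.integral_norm_sq_sum hXm hX
    (by rintro (_ | p); exacts [measurable_const, (hH p).1])
    (by rintro (_ | p); exacts [by simpa using hi, hHi p])
    (Finset.insertNone c.support) (fun o => o.elim 1 fun i => -c i)
    (fun o => o.map Prod.fst) (fun o => o.elim t fun i => i.2 / w)
  have hSB := h.noise.integral_norm_sq_sum hηm hη (fun p => (hH p).1) hHi' c.support c Prod.fst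
    (fun i => i.2 / w)
  simp only [Finset.sum_insertNone, Option.elim_none, Option.elim_some, Option.map_none,
    Option.map_some, one_mul, neg_mul, Finset.sum_neg_distrib, ← sub_eq_add_neg] at hSA
  have hgi : Integrable fun f => (SX f + Sη f) * ‖trigResponse w H c f‖ ^ 2 := by
    simp only [trigResponse_eq]
    exact integrable_mul_norm_sum_sq hXm hηm hX hη hH (measurable_trigCoeff c)
      (norm_trigCoeff_le c)
  have hgm : Measurable (trigResponse w H c) := by
    have e : trigResponse w H c = fun f => ∑ p, H p f * trigCoeff w c f p :=
      funext fun f => trigResponse_eq c f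
    rw [e]
    exact measurable_sum_mul (fun p => (hH p).1) (measurable_trigCoeff c)
  have hE := integrable_error hXm hηm hX hη hi hgm hgi t
  have hE2 : Integrable fun f => Sη f * ‖trigResponse w H c f‖ ^ 2 :=
    hgi.mono' (hηm.mul (hgm.norm.pow_const 2)).aestronglyMeasurable
      (Eventually.of_forall fun f => by
        rw [Real.norm_of_nonneg (mul_nonneg (hη f) (sq_nonneg _))]
        exact mul_le_mul_of_nonneg_right (by linarith [hX f]) (sq_nonneg _))
  have hE1 : Integrable fun f => SX f * ‖wave t f - trigResponse w H c f‖ ^ 2 :=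
    (hE.sub hE2).congr (Eventually.of_forall fun f => by simp)
  rw [spectralError, integral_add hE1 hE2]
  exact congrArg₂ (· + ·) hSA hSB

theorem IsModel.linearError_eq (h : IsModel μ SX Sη H X U V)
    (hXm : Measurable SX) (hηm : Measurable Sη)
    (hX : ∀ f, 0 ≤ SX f) (hη : ∀ f, 0 ≤ Sη f) (hi : Integrable SX) (hw : 0 < w)
    (hH : Admissible SX Sη H) (t : ℝ) :
    linearError μ (X t) (samples w U V) = (∫ f, SX f) -
      ∫ f in (-(w / 2))..(w / 2), energy (matSY SX Sη w H f) (crossVec SX w H t f) := by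
  rw [← iInf_spectralError_eq hXm hηm hX hη hi hw hH t, linearError]
  exact iInf_congr fun c => h.integral_norm_sq hXm hηm hX hη hi hH t c

end Isometry

end

end FilterBank

namespace FilterBank

noncomputable section

/-! ### Linear estimation of jointly Gaussian variables -/

section Gaussian

variable {Ω : Type*} {m₀ : MeasurableSpace Ω} {μ : Measure Ω}

theorem integral_sub_sq_eq_add [IsFiniteMeasure μ] {m : MeasurableSpace Ω} (hm : m ≤ m₀)
    {x h : Ω → ℝ} (hx : MemLp x 2 μ) (hh : StronglyMeasurable[m] h) (hh2 : MemLp h 2 μ) :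
    ∫ ω, (x ω - h ω) ^ 2 ∂μ =
      ∫ ω, (x ω - (μ[x | m]) ω) ^ 2 ∂μ + ∫ ω, ((μ[x | m]) ω - h ω) ^ 2 ∂μ := by
  have hg : MemLp (μ[x | m]) 2 μ := hx.condExp one_le_two
  have hd : MemLp (fun ω => (μ[x | m]) ω - h ω) 2 μ := hg.sub hh2
  have hr : MemLp (fun ω => x ω - (μ[x | m]) ω) 2 μ := hx.sub hg
  have hdm : StronglyMeasurable[m] fun ω => (μ[x | m]) ω - h ω :=
    stronglyMeasurable_condExp.sub hh
  have hxd : Integrable (fun ω => x ω * ((μ[x | m]) ω - h ω)) μ := hx.integrable_mul hd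
  have hgd : Integrable (fun ω => (μ[x | m]) ω * ((μ[x | m]) ω - h ω)) μ := hg.integrable_mul hd
  have hcross : ∫ ω, (x ω - (μ[x | m]) ω) * ((μ[x | m]) ω - h ω) ∂μ = 0 := by
    have e := condExp_mul_of_stronglyMeasurable_right hdm hxd (hx.integrable one_le_two)
    have e2 := integral_congr_ae e
    rw [integral_condExp hm] at e2
    simp only [sub_mul]
    rw [integral_sub hxd hgd]
    exact sub_eq_zero.2 e2
  have hc : Integrable (fun ω => 2 * ((x ω - (μ[x | m]) ω) * ((μ[x | m]) ω - h ω))) μ :=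
    (hr.integrable_mul hd).const_mul 2
  have hs : ∀ ω, (x ω - h ω) ^ 2 = (x ω - (μ[x | m]) ω) ^ 2 + ((μ[x | m]) ω - h ω) ^ 2 +
      2 * ((x ω - (μ[x | m]) ω) * ((μ[x | m]) ω - h ω)) := fun ω => by ring
  simp only [hs]
  have hsum : Integrable (fun ω => (x ω - (μ[x | m]) ω) ^ 2 + ((μ[x | m]) ω - h ω) ^ 2) μ :=
    hr.integrable_sq.add hd.integrable_sq
  rw [integral_add hsum hc, integral_add hr.integrable_sq hd.integrable_sq, integral_const_mul,
    hcross, mul_zero, add_zero]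

/-- The normal equations are solved by orthogonal projection onto a finite-dimensional span, so the
covariance matrix may be singular. -/
theorem exists_sum_uncorrelated {ι : Type*} (s : Finset ι) {x : Ω → ℝ} {y : ι → Ω → ℝ}
    (hx : MemLp x 2 μ) (hy : ∀ i, MemLp (y i) 2 μ) :
    ∃ c : ι → ℝ, ∀ j ∈ s, ∫ ω, (x ω - ∑ i ∈ s, c i * y i ω) * y j ω ∂μ = 0 := by
  let v : ι → Lp ℝ 2 μ := fun i => (hy i).toLp (y i)
  let K : Submodule ℝ (Lp ℝ 2 μ) := Submodule.span ℝ (v '' (s : Set ι))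
  have : FiniteDimensional ℝ K := FiniteDimensional.span_of_finite ℝ (s.finite_toSet.image v)
  obtain ⟨c, hc⟩ := (Submodule.mem_span_image_finset_iff_exists_fun' ℝ).1
    (K.starProjection_apply_mem (hx.toLp x))
  refine ⟨c, fun j hj => ?_⟩
  have h0 := K.starProjection_inner_eq_zero (hx.toLp x) (v j)
    (Submodule.subset_span ⟨j, hj, rfl⟩)
  rw [← hc] at h0
  have hsm : MemLp (fun ω => x ω - ∑ i ∈ s, c i * y i ω) 2 μ :=
    hx.sub (memLp_finsetSum _ fun i _ => (hy i).const_mul (c i))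
  have e : hx.toLp x - ∑ i ∈ s, c i • v i = hsm.toLp _ := by
    have e1 : ∑ i ∈ s, c i • v i = (memLp_finsetSum s fun i _ => (hy i).const_mul (c i)).toLp
        (fun ω => ∑ i ∈ s, c i * y i ω) := by
      refine Lp.ext ((Lp.coeFn_finsetSum s _).trans ?_ |>.trans (MemLp.coeFn_toLp _).symm)
      have h1 : ∀ᵐ ω ∂μ, ∀ i ∈ s, (c i • v i : Lp ℝ 2 μ) ω = c i * y i ω := by
        rw [eventually_all_finset]
        intro i _
        filter_upwards [Lp.coeFn_smul (c i) (v i), MemLp.coeFn_toLp (hy i)] with ω h2 h3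
        rw [h2, Pi.smul_apply, h3, smul_eq_mul]
      filter_upwards [h1] with ω h
      simp only [Finset.sum_apply]
      exact Finset.sum_congr rfl h
    rw [e1, ← MemLp.toLp_sub]
    rfl
  rw [e, L2.inner_def] at h0
  rw [← h0]
  refine integral_congr_ae ?_
  filter_upwards [MemLp.coeFn_toLp hsm, MemLp.coeFn_toLp (hy j)] with ω h2 h3
  rw [h2, h3]
  simp [mul_comm]

/-- The residual of the linear regression is independent of the observations, so its conditional
expectation is its mean, `0`. -/
theorem exists_condExp_eq_sum {ι : Type*} (s : Finset ι) {x : Ω → ℝ}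
    {Y : ι → Ω → ℂ} (hx : Measurable x) (hY : ∀ i, Measurable (Y i))
    (hYr : ∀ i, ∀ᵐ ω ∂μ, (Y i ω).im = 0) (hx0 : ∫ ω, x ω ∂μ = 0) (hY0 : ∀ i, ∫ ω, Y i ω ∂μ = 0)
    (hG : HasGaussianLaw (fun ω => (x ω, fun i : s => Y i ω)) μ) (hY2 : ∀ i, MemLp (Y i) 2 μ) :
    ∃ c : ι → ℝ, μ[x | ⨆ i : s, MeasurableSpace.comap (Y i) inferInstance] =ᵐ[μ]
      fun ω => ∑ i ∈ s, c i * (Y i ω).re := by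
  have hprob := hG.isProbabilityMeasure
  have hx2 : MemLp x 2 μ := hG.fst.memLp_two
  have hy2 : ∀ i, MemLp (fun ω => (Y i ω).re) 2 μ := fun i => (hY2 i).re
  obtain ⟨c, hc⟩ := exists_sum_uncorrelated s hx2 hy2
  refine ⟨c, ?_⟩
  set R : Ω → ℝ := fun ω => x ω - ∑ i ∈ s, c i * (Y i ω).re with hR
  have hre0 : ∀ i, ∫ ω, (Y i ω).re ∂μ = 0 := fun i => by
    have := integral_re ((hY2 i).integrable one_le_two)
    simp only [RCLike.re_to_complex] at this
    rw [this, hY0, Complex.zero_re]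
  have hsumi : Integrable (fun ω => ∑ i ∈ s, c i * (Y i ω).re) μ :=
    integrable_finsetSum _ fun i _ => ((hy2 i).integrable one_le_two).const_mul (c i)
  have hR0 : ∫ ω, R ω ∂μ = 0 := by
    rw [hR, integral_sub (hx2.integrable one_le_two) hsumi, hx0,
      integral_finsetSum _ fun i _ => ((hy2 i).integrable one_le_two).const_mul (c i)]
    simp [integral_const_mul, hre0]
  have hRm : Measurable R :=
    hx.sub (Finset.measurable_sum s fun i _ => (Complex.measurable_re.comp (hY i)).const_mul (c i))
  have hR2 : MemLp R 2 μ :=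
    hx2.sub (memLp_finsetSum _ fun i _ => (hy2 i).const_mul (c i))
  -- the residual and the observations are jointly Gaussian and uncorrelated, hence independent
  have hind : IndepFun R (fun ω (i : s) => Y i ω) μ := by
    -- This map sends source and observations to the residual and the real parts of the
    -- observations, which determine the observations almost surely.
    let L : ℝ × (s → ℂ) →L[ℝ] (Unit → ℝ) × (s → ℝ) :=
      (ContinuousLinearMap.pi fun _ => ContinuousLinearMap.fst ℝ ℝ (s → ℂ) - ∑ i : s, c i •
        (Complex.reCLM ∘L ContinuousLinearMap.proj (R := ℝ) i ∘L
          ContinuousLinearMap.snd ℝ ℝ (s → ℂ))).prod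
      (ContinuousLinearMap.pi fun i : s => Complex.reCLM ∘L
        ContinuousLinearMap.proj (R := ℝ) i ∘L ContinuousLinearMap.snd ℝ ℝ (s → ℂ))
    have hL : HasGaussianLaw (fun ω => (fun _ : Unit => R ω, fun i : s => (Y i ω).re)) μ := by
      refine (hG.map_fun L).congr (Eventually.of_forall fun ω => ?_)
      refine Prod.ext ?_ ?_
      · funext
        simp only [L, hR, ContinuousLinearMap.prod_apply, ContinuousLinearMap.pi_apply,
          sub_apply, ContinuousLinearMap.coe_fst', sum_apply,
          smul_apply, ContinuousLinearMap.comp_apply,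
          ContinuousLinearMap.coe_snd', ContinuousLinearMap.proj_apply, Complex.reCLM_apply,
          smul_eq_mul]
        rw [Finset.sum_coe_sort s fun i => c i * (Y i ω).re]
      · funext i
        simp [L]
    have hI := hL.indepFun_of_covariance_eval (fun _ j => by
      rw [covariance_eq_sub hR2 (hy2 j), hR0, zero_mul, sub_zero]
      exact hc j j.2)
    have hI2 : IndepFun R (fun ω (i : s) => ((Y i ω).re : ℂ)) μ := hI.comp (φ := fun r : Unit → ℝ => r ())
      (ψ := fun (y : s → ℝ) i => (y i : ℂ)) (measurable_pi_apply ()) (by fun_prop)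
    refine hI2.congr (Eventually.of_forall fun ω => rfl) ?_
    have : ∀ᵐ ω ∂μ, ∀ i ∈ s, (Y i ω).im = 0 := by
      rw [eventually_all_finset]
      exact fun i _ => hYr i
    filter_upwards [this] with ω h
    funext i
    exact Complex.ext rfl (by simp [h i i.2])
  set m : MeasurableSpace Ω := ⨆ i : s, MeasurableSpace.comap (Y i) inferInstance with hm
  have hmle : m ≤ m₀ := iSup_le fun i => (hY i).comap_le
  have hind' : Indep (MeasurableSpace.comap R inferInstance) m μ := by
    refine indep_of_indep_of_le_right ((IndepFun_iff_Indep _ _ _).1 hind) (iSup_le fun i => ?_)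
    have : Y i = (fun y : s → ℂ => y i) ∘ fun ω (i : s) => Y i ω := rfl
    rw [this, ← MeasurableSpace.comap_comp]
    exact MeasurableSpace.comap_mono (measurable_pi_apply i).comap_le
  have hcR : μ[R | m] =ᵐ[μ] fun _ => 0 := by
    have := condExp_indep_eq hRm.comap_le hmle (comap_measurable R).stronglyMeasurable hind'
    rwa [hR0] at this
  have hYm : ∀ i ∈ s, Measurable[m] (Y i) := fun i hi =>
    (comap_measurable (Y i)).mono (le_iSup (fun i : s => MeasurableSpace.comap (Y i) inferInstance)
      ⟨i, hi⟩) le_rfl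
  have hsm : StronglyMeasurable[m] fun ω => ∑ i ∈ s, c i * (Y i ω).re :=
    (Finset.measurable_fun_sum s fun i hi =>
      (Complex.measurable_re.comp (hYm i hi)).const_mul (c i)).stronglyMeasurable
  have hxe : x = R + fun ω => ∑ i ∈ s, c i * (Y i ω).re := by
    funext ω
    simp [hR]
  have hadd := condExp_add (hR2.integrable one_le_two) hsumi m
  rw [← hxe, condExp_of_stronglyMeasurable hmle hsm hsumi] at hadd
  filter_upwards [hadd, hcR] with ω h1 h2
  rw [h1, Pi.add_apply, h2, zero_add]

theorem integrable_norm_sub_sum_sq {ι : Type*} {x : Ω → ℝ} {Y : ι → Ω → ℂ} (hx : MemLp x 2 μ)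
    (hY2 : ∀ i, MemLp (Y i) 2 μ) (c : ι →₀ ℂ) :
    Integrable (fun ω => ‖(x ω : ℂ) - c.sum fun i a => a * Y i ω‖ ^ 2) μ := by
  have h1 : MemLp (fun ω => (x ω : ℂ)) 2 μ := hx.ofReal
  exact (h1.sub (memLp_finsetSum c.support fun i _ => (hY2 i).const_mul (c i))).integrable_norm_pow
    (by norm_num)

theorem linearError_le {ι : Type*} (x : Ω → ℝ) (Y : ι → Ω → ℂ) (c : ι →₀ ℂ) :
    linearError μ x Y ≤ ∫ ω, ‖(x ω : ℂ) - c.sum fun i a => a * Y i ω‖ ^ 2 ∂μ :=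
  ciInf_le ⟨0, by rintro _ ⟨c, rfl⟩; exact integral_nonneg fun ω => sq_nonneg _⟩ c

/-- As `x` is real, the real part of a complex linear estimator does no worse; it is measurable with
respect to the observations, and conditional expectation is the best such estimator. -/
theorem condExpError_le_linearError [IsFiniteMeasure μ] {ι : Type*} {x : Ω → ℝ} {Y : ι → Ω → ℂ}
    (hY : ∀ i, Measurable (Y i)) (hx2 : MemLp x 2 μ) (hY2 : ∀ i, MemLp (Y i) 2 μ) :
    condExpError μ x Y ≤ linearError μ x Y := by
  refine le_ciInf fun c => ?_
  let h : Ω → ℝ := fun ω => (c.sum fun i a => a * Y i ω).re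
  have hh2 : MemLp h 2 μ :=
    (memLp_finsetSum c.support fun i _ => (hY2 i).const_mul (c i)).re
  have hxh : Integrable (fun ω => (x ω - h ω) ^ 2) μ := (hx2.sub hh2).integrable_sq
  have hcomp : ∫ ω, (x ω - h ω) ^ 2 ∂μ ≤
      ∫ ω, ‖(x ω : ℂ) - c.sum fun i a => a * Y i ω‖ ^ 2 ∂μ := by
    refine integral_mono hxh (integrable_norm_sub_sum_sq hx2 hY2 c) fun ω => ?_
    have := Complex.abs_re_le_norm ((x ω : ℂ) - c.sum fun i a => a * Y i ω)
    rw [Complex.sub_re, Complex.ofReal_re] at this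
    exact sq_le_sq.2 (this.trans (le_abs_self _))
  refine le_trans ?_ hcomp
  have hpos : ∀ u : Ω → ℝ, 0 ≤ ∫ ω, u ω ^ 2 ∂μ := fun u => integral_nonneg fun ω => sq_nonneg _
  set m : MeasurableSpace Ω := ⨆ i, MeasurableSpace.comap (Y i) inferInstance with hm
  have hmle : m ≤ m₀ := iSup_le fun i => (hY i).comap_le
  have hYm : ∀ i, Measurable[m] (Y i) := fun i =>
    (comap_measurable (Y i)).mono
      (le_iSup (fun i => MeasurableSpace.comap (Y i) inferInstance) i) le_rfl
  have hhm : StronglyMeasurable[m] h :=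
    (Complex.measurable_re.comp (Finset.measurable_fun_sum c.support fun i _ =>
      (hYm i).const_mul (c i))).stronglyMeasurable
  refine le_of_le_of_eq ?_ (integral_sub_sq_eq_add hmle hx2 hhm hh2).symm
  exact le_add_of_nonneg_right (hpos _)

/-- Along an exhaustion by finite subfamilies the conditional expectations converge almost surely as
a martingale. Each finite stage has an error of at least the linear error, so its second moment is
at most `∫ x²` minus that error; Fatou passes this to the limit and Pythagoras turns it back into an
error bound. -/
theorem linearError_le_condExpError {ι : Type*} [Countable ι] {x : Ω → ℝ} {Y : ι → Ω → ℂ}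
    (hx : Measurable x) (hY : ∀ i, Measurable (Y i))
    (hYr : ∀ i, ∀ᵐ ω ∂μ, (Y i ω).im = 0) (hx0 : ∫ ω, x ω ∂μ = 0) (hY0 : ∀ i, ∫ ω, Y i ω ∂μ = 0)
    (hY2 : ∀ i, MemLp (Y i) 2 μ)
    (hG : ∀ s : Finset ι, HasGaussianLaw (fun ω => (x ω, fun i : s => Y i ω)) μ) :
    linearError μ x Y ≤ condExpError μ x Y := by
  have hprob := (hG ∅).isProbabilityMeasure
  have hx2 : MemLp x 2 μ := (hG ∅).fst.memLp_two
  let σ : Finset ι → MeasurableSpace Ω := fun s =>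
    ⨆ i : s, MeasurableSpace.comap (Y i) inferInstance
  have hσle : ∀ s, σ s ≤ m₀ := fun s => iSup_le fun i => (hY i).comap_le
  have hσmono : Monotone σ := fun s s' h => iSup_le fun i =>
    le_iSup (fun i : s' => MeasurableSpace.comap (Y i) inferInstance) ⟨i, h i.2⟩
  -- a finite family of observations does not beat linear estimation
  have hfin : ∀ s, linearError μ x Y ≤ ∫ ω, (x ω - (μ[x | σ s]) ω) ^ 2 ∂μ := by
    intro s
    obtain ⟨c, hc⟩ := exists_condExp_eq_sum s hx hY hYr hx0 hY0 (hG s) hY2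
    refine (linearError_le x Y (Finsupp.indicator s fun i _ => (c i : ℂ))).trans_eq ?_
    refine integral_congr_ae ?_
    have : ∀ᵐ ω ∂μ, ∀ i ∈ s, (Y i ω).im = 0 := by
      rw [eventually_all_finset]
      exact fun i _ => hYr i
    filter_upwards [hc, this] with ω h1 h2
    have e : ((Finsupp.indicator s fun i _ => (c i : ℂ)).sum fun i a => a * Y i ω) =
        ((∑ i ∈ s, c i * (Y i ω).re : ℝ) : ℂ) := by
      rw [Finsupp.sum_of_support_subset _ (Finsupp.support_indicator_subset _ _) _ (by simp)]
      push_cast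
      refine Finset.sum_congr rfl fun i hi => ?_
      rw [Finsupp.indicator_of_mem hi]
      congr 1
      exact Complex.ext (by simp) (by simp [h2 i hi])
    rw [h1, e, ← Complex.ofReal_sub, Complex.norm_real, Real.norm_eq_abs, sq_abs]
  have hpyth : ∀ m : MeasurableSpace Ω, m ≤ m₀ → ∫ ω, x ω ^ 2 ∂μ =
      ∫ ω, (x ω - (μ[x | m]) ω) ^ 2 ∂μ + ∫ ω, ((μ[x | m]) ω) ^ 2 ∂μ := fun m hm => by
    simpa using integral_sub_sq_eq_add hm hx2
      (h := fun _ => 0) stronglyMeasurable_const (memLp_const 0)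
  obtain ⟨s, hs, hst⟩ := exists_seq_monotone_tendsto_atTop_atTop (Finset ι)
  let ℱ : Filtration ℕ m₀ := ⟨fun n => σ (s n), fun _ _ h => hσmono (hs h), fun n => hσle _⟩
  have hsup : ⨆ n, ℱ n = ⨆ i, MeasurableSpace.comap (Y i) inferInstance := by
    refine le_antisymm (iSup_le fun n => iSup_le fun i =>
      le_iSup (fun i => MeasurableSpace.comap (Y i) inferInstance) (i : ι)) (iSup_le fun i => ?_)
    obtain ⟨n, hn⟩ := (hst.eventually_ge_atTop {i}).exists
    refine le_trans ?_ (le_iSup (fun n => ℱ n) n)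
    exact le_iSup (fun i : s n => MeasurableSpace.comap (Y i) inferInstance)
      ⟨i, Finset.singleton_subset_iff.1 hn⟩
  have h0 : linearError μ x Y ≤ ∫ ω, x ω ^ 2 ∂μ := by
    simpa using linearError_le (μ := μ) x Y 0
  refine le_of_not_gt fun hlt => ?_
  change ∫ ω, (x ω - (μ[x | ⨆ i, MeasurableSpace.comap (Y i) inferInstance]) ω) ^ 2 ∂μ < _ at hlt
  generalize linearError μ x Y = e at hfin h0 hlt
  have hlim := tendsto_ae_condExp (μ := μ) (ℱ := ℱ) x
  rw [hsup] at hlim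
  set m : MeasurableSpace Ω := ⨆ i, MeasurableSpace.comap (Y i) inferInstance with hm
  have hmle : m ≤ m₀ := iSup_le fun i => (hY i).comap_le
  have hsqm : ∀ m' : MeasurableSpace Ω, m' ≤ m₀ → Measurable[m₀] fun ω => ENNReal.ofReal
      ((μ[x | m']) ω ^ 2) := fun m' h' =>
    ((stronglyMeasurable_condExp.mono h').measurable.pow_const 2).ennreal_ofReal
  have hint : ∀ m' : MeasurableSpace Ω, ∫⁻ ω, ENNReal.ofReal ((μ[x | m']) ω ^ 2) ∂μ =
      ENNReal.ofReal (∫ ω, ((μ[x | m']) ω) ^ 2 ∂μ) := fun m' =>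
    (ofReal_integral_eq_lintegral_ofReal (hx2.condExp one_le_two).integrable_sq
      (Eventually.of_forall fun ω => sq_nonneg _)).symm
  have hfatou : ENNReal.ofReal (∫ ω, ((μ[x | m]) ω) ^ 2 ∂μ) ≤
      ENNReal.ofReal (∫ ω, x ω ^ 2 ∂μ - e) := by
    rw [← hint]
    calc ∫⁻ ω, ENNReal.ofReal ((μ[x | m]) ω ^ 2) ∂μ
        = ∫⁻ ω, liminf (fun n => ENNReal.ofReal ((μ[x | ℱ n]) ω ^ 2)) atTop ∂μ := by
          refine lintegral_congr_ae ?_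
          filter_upwards [hlim] with ω h
          exact ((ENNReal.continuous_ofReal.tendsto _).comp (h.pow 2)).liminf_eq.symm
      _ ≤ liminf (fun n => ∫⁻ ω, ENNReal.ofReal ((μ[x | ℱ n]) ω ^ 2) ∂μ) atTop :=
          lintegral_liminf_le fun n => hsqm _ (hσle _)
      _ ≤ liminf (fun _ : ℕ => ENNReal.ofReal (∫ ω, x ω ^ 2 ∂μ - e)) atTop := by
          refine liminf_le_liminf (Eventually.of_forall fun n => ?_)
          rw [hint]
          refine ENNReal.ofReal_le_ofReal ?_
          have h1 := hpyth _ (hσle (s n))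
          have h2 := hfin (s n)
          change ∫ ω, ((μ[x | σ (s n)]) ω) ^ 2 ∂μ ≤ _
          linarith
      _ = _ := liminf_const _
  have h1 := (ENNReal.ofReal_le_ofReal_iff (sub_nonneg.2 h0)).1 hfatou
  have h2 := hpyth m hmle
  linarith

end Gaussian

/-! ### Filters with real impulse response -/

section RealBank

variable {Ω : Type*} [MeasurableSpace Ω] {μ : Measure Ω}

/-- For such a filter covariance and pseudo-covariance agree at equal times, while `Re (|W|² - W²) =
2 (Im W)²`; so the imaginary part has zero second moment. -/
theorem IsFilteredGaussian.ae_im_eq_zero {ι : Type*} {S : ℝ → ℝ} {G : ι → ℝ → ℂ}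
    {W : ι → ℝ → Ω → ℂ} (h : IsFilteredGaussian μ S G W) {i : ι}
    (hG : ∀ᵐ f : ℝ, G i (-f) = conj (G i f)) (t : ℝ) : ∀ᵐ ω ∂μ, (W i t ω).im = 0 := by
  have hW := h.memLp i t
  have e : ∫ ω, W i t ω * W i t ω ∂μ = ∫ ω, W i t ω * conj (W i t ω) ∂μ := by
    rw [h.cov, h.pseudoCov]
    refine integral_congr_ae ?_
    filter_upwards [hG] with f hf
    rw [hf]
  have h1 : Integrable (fun ω => W i t ω * W i t ω) μ := hW.integrable_mul hW
  have h2 := MemLp.integrable_mul_conj hW hW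
  have h3 : ∫ ω, (W i t ω * conj (W i t ω) - W i t ω * W i t ω) ∂μ = 0 := by
    rw [integral_sub h2 h1, e, sub_self]
  have h4 := integral_re (h2.sub h1)
  simp only [Pi.sub_apply, RCLike.re_to_complex] at h4
  rw [h3, Complex.zero_re] at h4
  have h5 : ∀ ω, (W i t ω * conj (W i t ω) - W i t ω * W i t ω).re = 2 * (W i t ω).im ^ 2 := by
    intro ω
    simp
    ring
  have h6 := (h2.sub h1).re
  simp only [Pi.sub_apply, RCLike.re_to_complex] at h6
  simp only [h5] at h4 h6
  have := (integral_eq_zero_iff_of_nonneg (fun ω => by positivity) h6).1 h4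
  filter_upwards [this] with ω hω
  simpa using hω

variable {SX Sη : ℝ → ℝ} {w : ℝ} {P : ℕ} {H : Fin P → ℝ → ℂ} {X : ℝ → Ω → ℝ}
  {U V : Fin P → ℝ → Ω → ℂ}

/-- The source block and the noise block are linear images of finite Gaussian marginals. Being
independent they are jointly Gaussian, and the samples depend linearly on the pair. -/
theorem IsModel.hasGaussianLaw_samples (h : IsModel μ SX Sη H X U V) (t : ℝ)
    (s : Finset (Fin P × ℤ)) :
    HasGaussianLaw (fun ω => (X t ω, fun i : s => samples w U V i ω)) μ := by
  let I : Finset (Option (Fin P) × ℝ) := insert (none, t)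
    (s.image fun i => (some i.1, (i.2 : ℝ) / w))
  let J : Finset (Fin P × ℝ) := s.image fun i => (i.1, (i.2 : ℝ) / w)
  have hI : ∀ i : s, (some i.1.1, (i.1.2 : ℝ) / w) ∈ I := fun i =>
    Finset.mem_insert_of_mem (Finset.mem_image_of_mem _ i.2)
  have hJ : ∀ i : s, (i.1.1, (i.1.2 : ℝ) / w) ∈ J := fun i => Finset.mem_image_of_mem _ i.2
  let A : Ω → ℝ × (s → ℂ) := fun ω => (X t ω, fun i => U i.1.1 (i.1.2 / w) ω)
  let B : Ω → s → ℂ := fun ω i => V i.1.1 (i.1.2 / w) ω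
  have hA : HasGaussianLaw A μ := by
    let L : (I → ℂ) →L[ℝ] ℝ × (s → ℂ) :=
      (Complex.reCLM ∘L ContinuousLinearMap.proj (R := ℝ) ⟨(none, t), Finset.mem_insert_self _ _⟩).prod
        (ContinuousLinearMap.pi fun i => ContinuousLinearMap.proj (R := ℝ) ⟨_, hI i⟩)
    refine ((h.source.gaussian.hasGaussianLaw I).map_fun L).congr (Eventually.of_forall fun ω => ?_)
    simp [L, A, Finset.restrict]
  have hB : HasGaussianLaw B μ := by
    let L : (J → ℂ) →L[ℝ] s → ℂ :=
      ContinuousLinearMap.pi fun i => ContinuousLinearMap.proj (R := ℝ) ⟨_, hJ i⟩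
    exact ((h.noise.gaussian.hasGaussianLaw J).map_fun L).congr (Eventually.of_forall fun ω => rfl)
  have hAB : IndepFun A B μ := by
    have hm1 : Measurable fun x : (ℝ → ℝ) × (Fin P → ℝ → ℂ) =>
        (x.1 t, fun i : s => x.2 i.1.1 (i.1.2 / w)) := by fun_prop
    have hm2 : Measurable fun (x : Fin P → ℝ → ℂ) (i : s) => x i.1.1 (i.1.2 / w) := by fun_prop
    exact h.indep.comp hm1 hm2
  let L : (ℝ × (s → ℂ)) × (s → ℂ) →L[ℝ] ℝ × (s → ℂ) :=
    ContinuousLinearMap.fst ℝ _ _ +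
      (ContinuousLinearMap.inr ℝ ℝ (s → ℂ)) ∘L ContinuousLinearMap.snd ℝ _ _
  have : BorelSpace ((ℝ × (s → ℂ)) × (s → ℂ)) := Prod.borelSpace
  refine ((hAB.hasGaussianLaw hA hB).map_fun L).congr (Eventually.of_forall fun ω => ?_)
  refine Prod.ext ?_ ?_
  · simp [L, A]
  · funext i
    simp [L, A, B, samples]

theorem IsModel.condExpError_eq_linearError (h : IsModel μ SX Sη H X U V) (hH : RealResponse H)
    (t : ℝ) : condExpError μ (X t) (samples w U V) = linearError μ (X t) (samples w U V) := by
  have hprob : IsProbabilityMeasure μ := h.source.gaussian.isProbabilityMeasure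
  have hXm : Measurable (X t) := Complex.measurable_re.comp (h.source.measurable none t)
  have hUm : ∀ p s, MemLp (U p s) 2 μ := fun p s => h.source.memLp (some p) s
  have hYm : ∀ i, Measurable (samples w U V i) := fun i =>
    (h.source.measurable (some i.1) _).add (h.noise.measurable i.1 _)
  have hY2 : ∀ i, MemLp (samples w U V i) 2 μ := fun i => (hUm i.1 _).add (h.noise.memLp i.1 _)
  have hG := h.hasGaussianLaw_samples (w := w) t
  refine le_antisymm (condExpError_le_linearError hYm (hG ∅).fst.memLp_two hY2)
    (linearError_le_condExpError hXm hYm (fun i => ?_) ?_ (fun i => ?_) hY2 hG)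
  · filter_upwards [h.source.ae_im_eq_zero (i := some i.1) (hH i.1) (i.2 / w),
      h.noise.ae_im_eq_zero (hH i.1) (i.2 / w)] with ω h1 h2
    change (U i.1 (i.2 / w) ω).im = 0 at h1
    rw [samples, Complex.add_im, h1, h2, add_zero]
  · have := h.source.mean none t
    simp only [Option.elim_none] at this
    rw [integral_complex_ofReal] at this
    exact_mod_cast this
  · have h1 := h.source.mean (some i.1) (i.2 / w)
    simp only [Option.elim_some] at h1
    simp only [samples]
    rw [integral_add ((hUm i.1 _).integrable one_le_two)
      ((h.noise.memLp i.1 _).integrable one_le_two), h1, h.noise.mean, add_zero]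

end RealBank

end

end FilterBank

/-! ### The main theorem -/

open FilterBank in
theorem mainTheorem10 (SX Sη : ℝ → ℝ)
    (hSX_meas : Measurable SX) (hSη_meas : Measurable Sη)
    (hSX_nonneg : ∀ f, 0 ≤ SX f) (hSη_nonneg : ∀ f, 0 ≤ Sη f)
    (hSX_even : ∀ f, SX (-f) = SX f) (hSη_even : ∀ f, Sη (-f) = Sη f)
    (hSX_int : Integrable SX)
    (fs : ℝ) (hfs : 0 < fs) (P : ℕ) (hP : 0 < P) (w : ℝ) (hw : w = fs / P) :
    -- successive maximal aliasing-free sets exist, and can be chosen symmetric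
    (∃ F : Fin P → Set ℝ, SuccessiveMaximal (snr SX Sη) w F ∧ ∀ p f, -f ∈ F p ↔ f ∈ F p) ∧
    -- for every filter bank, the MMSE exists and is determined by the trace
    (∀ H : Fin P → ℝ → ℂ, Admissible SX Sη H →
      ∀ (Ω : Type*) [MeasurableSpace Ω] (μ : Measure Ω) [IsProbabilityMeasure μ]
        (X : ℝ → Ω → ℝ) (U V : Fin P → ℝ → Ω → ℂ), IsModel μ SX Sη H X U V →
        HasTimeAverage (fun t => linearError μ (X t) (samples w U V))
          ((∫ f, SX f) - ∫ f in (-(w / 2))..(w / 2), traceSXY SX Sη w H f) ∧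
        (RealResponse H →
          HasTimeAverage (fun t => condExpError μ (X t) (samples w U V))
            ((∫ f, SX f) - ∫ f in (-(w / 2))..(w / 2), traceSXY SX Sη w H f))) ∧
    -- optimality of the indicators of such sets
    ∀ F : Fin P → Set ℝ, SuccessiveMaximal (snr SX Sη) w F →
      (∀ H : Fin P → ℝ → ℂ, Admissible SX Sη H →
        (∀ᵐ f : ℝ, traceSXY SX Sη w H f ≤ traceSXY SX Sη w (indicatorBank F) f) ∧
        (∀ᵐ f : ℝ, ∀ i, eigSXY SX Sη w H f i ≤ eigSXY SX Sη w (indicatorBank F) f i) ∧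
        (∫ f, SX f) - ∫ f in (-(w / 2))..(w / 2), traceSXY SX Sη w (indicatorBank F) f ≤
          (∫ f, SX f) - ∫ f in (-(w / 2))..(w / 2), traceSXY SX Sη w H f) ∧
      (∫ f, SX f) - ∫ f in (-(w / 2))..(w / 2), traceSXY SX Sη w (indicatorBank F) f =
        (∫ f, SX f) - ∑ p, ∫ f in F p, snr SX Sη f ∧
      (∫ f, SX f) - ∑ p, ∫ f in F p, snr SX Sη f =
        (∫ f, SX f) -
          ∑ p, ∫ f in (-(w / 2))..(w / 2), Jstar (snr SX Sη) w F p f := by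
  have hw0 : 0 < w := hw ▸ div_pos hfs (Nat.cast_pos.2 hP)
  have hFint : ∀ F : Fin P → Set ℝ, SuccessiveMaximal (snr SX Sη) w F →
      ∑ p, ∫ f in F p, snr SX Sη f =
        ∑ p, ∫ f in (-(w / 2))..(w / 2), Jstar (snr SX Sη) w F p f := fun F hF =>
    Finset.sum_congr rfl fun p _ => hF.maximal p
  refine ⟨exists_successiveMaximal (measurable_snr hSX_meas hSη_meas)
      (snr_nonneg hSX_nonneg hSη_nonneg)
      (integrable_snr hSX_meas hSη_meas hSX_nonneg hSη_nonneg hSX_int)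
      (fun f => by simp only [snr, hSX_even, hSη_even]) hw0 P, ?_, ?_⟩
  · intro H hH Ω _ μ _ X U V hM
    have hlin : HasTimeAverage (fun t => linearError μ (X t) (samples w U V))
        ((∫ f, SX f) - ∫ f in (-(w / 2))..(w / 2), traceSXY SX Sη w H f) := by
      simp only [hM.linearError_eq hSX_meas hSη_meas hSX_nonneg hSη_nonneg hSX_int hw0 hH]
      exact (hasTimeAverage_energy hSX_meas hSη_meas hSX_nonneg hSη_nonneg hSX_int hw0 hH).2
    refine ⟨hlin, fun hR => ?_⟩
    simp only [hM.condExpError_eq_linearError hR]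
    exact hlin
  · intro F hF
    obtain ⟨hFi, hFe⟩ := integral_traceSXY_indicatorBank hSX_meas hSη_meas hSX_nonneg hSη_nonneg
      hSX_int hw0 hF
    refine ⟨fun H hH => ?_, by rw [hFe, hFint F hF], by rw [hFint F hF]⟩
    have htr := ae_traceSXY_le hSX_meas hSη_meas hSX_nonneg hSη_nonneg hSX_int hw0 hF hH
    refine ⟨htr, ae_eigSXY_le hSX_meas hSη_meas hSX_nonneg hSη_nonneg hSX_int hw0 hF hH,
      sub_le_sub_left ?_ _⟩
    exact intervalIntegral.integral_mono_ae (by linarith)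
      (hasTimeAverage_energy hSX_meas hSη_meas hSX_nonneg hSη_nonneg hSX_int hw0 hH).1 hFi htr
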